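/- Let $F$ be a field, let $m\ge 2$ and $k\ge 1$ be integers, and put $n=mk+m-1$. Let $\mathbb{P}(1,m,n)$ be the weighted projective plane over $F$, i.e. the toric surface over $F$ of the complete fan in $\mathbb{Z}^2$ with ray generators $u_0=-me_1-ne_2$, $u_1=e_1$, $u_2=e_2$. Let $\bar\Delta$ be the fan in $\mathbb{Z}^2$ whose two-dimensional cones are the cones spanned by pairs of adjacent (linearly independent, with no further element of the set in their cone) elements of the set $$\left\{\begin{bmatrix}1\\0\end{bmatrix},\begin{bmatrix}0\\-1\end{bmatrix},\begin{bmatrix}-1\\-(k+1)\end{bmatrix},v_0,\dots,v_m\right\},\qquad v_j=\begin{bmatrix}-j\\-(jk+j-1)\end{bmatrix}\quad(0\le j\le m).$$ Then $\bar\Delta$ is a complete fan, the set $\bar\Delta(1)$ of primitive generators of its rays is exactly this set, and its toric surface $X(\bar\Delta)$ is complete (proper over $F$) and is the minimal desingularization of $\mathbb{P}(1,m,n)$. More precisely, $\bar\Delta$ refines the fan of $\mathbb{P}(1,m,n)$, and the $F$-morphism $f\colon X(\bar\Delta)\to\mathbb{P}(1,m,n)$ induced by the identity of $\mathbb{Z}^2$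 is a desingularization (that is, $f$ is proper and birational and all local rings of $X(\bar\Delta)$ are regular) through which every desingularization $g\colon Z\to\mathbb{P}(1,m,n)$ factors uniquely: there is exactly one morphism $h\colon Z\to X(\bar\Delta)$ with $f\circ h=g$. -/

import Mathlib

open CategoryTheory AlgebraicGeometry Limits

universe u

noncomputable section

namespace Toric

/-- The lattice `N = ℤ²`. -/
abbrev Lattice : Type := Fin 2 → ℤ

/-- The real plane `N ⊗ ℝ = ℝ²`. -/
abbrev Plane : Type := Fin 2 → ℝ

/-- The inclusion `N → N ⊗ ℝ`. -/
def toPlane (v : Lattice) : Plane := fun i => (v i : ℝ)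

/-- The pairing of `u` in the dual lattice `M = ℤ²` with a point `x` of `N ⊗ ℝ`. -/
def pairing (u : Lattice) (x : Plane) : ℝ := ∑ i, (u i : ℝ) * x i

theorem pairing_add (u : Lattice) (x y : Plane) :
    pairing u (x + y) = pairing u x + pairing u y := by
  simp [pairing]; ring

theorem pairing_smul (u : Lattice) (c : ℝ) (x : Plane) :
    pairing u (c • x) = c * pairing u x := by
  simp [pairing]; ring

theorem pairing_zero_right (u : Lattice) : pairing u 0 = 0 := by simp [pairing]

theorem pairing_zero_left (x : Plane) : pairing 0 x = 0 := by simp [pairing]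

theorem pairing_add_left (u w : Lattice) (x : Plane) :
    pairing (u + w) x = pairing u x + pairing w x := by
  simp [pairing]; ring

theorem pairing_nsmul_left (n : ℕ) (u : Lattice) (x : Plane) :
    pairing (n • u) x = n * pairing u x := by
  simp [pairing]; ring

/-- The cone in `N ⊗ ℝ` generated over `ℝ≥0` by a set of lattice points. -/
def latticeCone (S : Set Lattice) : PointedCone ℝ Plane := PointedCone.hull ℝ (toPlane '' S)

/-- The semigroup `S_σ = σ^∨ ∩ M` of lattice points of the dual cone. -/
def dualMonoid (σ : PointedCone ℝ Plane) : AddSubmonoid Lattice where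
  carrier := {u | ∀ x ∈ σ, 0 ≤ pairing u x}
  zero_mem' := fun x _ => (pairing_zero_left x).ge
  add_mem' := fun {a b} ha hb x hx => by
    rw [pairing_add_left]; exact add_nonneg (ha x hx) (hb x hx)

theorem dualMonoid_anti {σ τ : PointedCone ℝ Plane} (h : τ ≤ σ) : dualMonoid σ ≤ dualMonoid τ :=
  fun _ hu x hx => hu x (h hx)

/-- `τ` is a face of the rational cone `σ`: `τ = σ ∩ u^⊥` for some `u ∈ σ^∨ ∩ M`. -/
def IsFace (τ σ : PointedCone ℝ Plane) : Prop :=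
  ∃ u ∈ dualMonoid σ, ∀ x, x ∈ τ ↔ x ∈ σ ∧ pairing u x = 0

/-- A fan in the lattice `N = ℤ²`: a finite nonempty collection of rational strongly convex
polyhedral cones, containing the faces of its members, in which any two members meet in a face
of each. -/
structure Fan where
  cones : Set (PointedCone ℝ Plane)
  finite : cones.Finite
  nonempty : cones.Nonempty
  rational : ∀ σ ∈ cones, ∃ S : Set Lattice, S.Finite ∧ σ = latticeCone S
  stronglyConvex : ∀ σ ∈ cones, ∀ x, x ∈ σ → -x ∈ σ → x = 0
  face_mem : ∀ σ ∈ cones, ∀ τ, IsFace τ σ → τ ∈ cones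
  inter_isFace : ∀ σ ∈ cones, ∀ τ ∈ cones, IsFace (σ ⊓ τ) σ

/-- The fan is complete: its cones cover the plane. -/
def Fan.IsComplete (Δ : Fan) : Prop := ∀ x : Plane, ∃ σ ∈ Δ.cones, x ∈ σ

/-- The set `Δ(1)`: the primitive lattice generators of the one-dimensional cones. -/
def Fan.rays (Δ : Fan) : Set Lattice :=
  {v | IsCoprime (v 0) (v 1) ∧ latticeCone {v} ∈ Δ.cones}

/-- The index category of the affine charts: the cones of the fan, ordered by inclusion. -/
abbrev Fan.Index (Δ : Fan) : Type := {σ : PointedCone ℝ Plane // σ ∈ Δ.cones}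

theorem Fan.isFace_of_le (Δ : Fan) {τ σ : Δ.Index} (h : τ ≤ σ) : IsFace τ.1 σ.1 := by
  have := Δ.inter_isFace σ.1 σ.2 τ.1 τ.2
  rwa [inf_eq_right.mpr (show τ.1 ≤ σ.1 from h)] at this

section Algebra

variable (F : Type u) [Field F]

/-- The semigroup algebra `F[S_σ]`. -/
abbrev coneAlgebra (σ : PointedCone ℝ Plane) : Type u := AddMonoidAlgebra F (dualMonoid σ)

/-- The inclusion `F[S_σ] → F[S_τ]` for `τ ⊆ σ`. -/
def coneAlgebraMap {τ σ : PointedCone ℝ Plane} (h : τ ≤ σ) :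
    coneAlgebra F σ →ₐ[F] coneAlgebra F τ :=
  AddMonoidAlgebra.mapDomainAlgHom F F (AddSubmonoid.inclusion (dualMonoid_anti h))

/-- The affine toric surface `U_σ = Spec F[S_σ]`. -/
abbrev affineToric (σ : PointedCone ℝ Plane) : Scheme.{u} := Spec (CommRingCat.of (coneAlgebra F σ))

/-- The morphism `U_τ → U_σ` for `τ ⊆ σ`. -/
def affineToricMap {τ σ : PointedCone ℝ Plane} (h : τ ≤ σ) :
    affineToric F τ ⟶ affineToric F σ :=
  Spec.map (CommRingCat.ofHom (coneAlgebraMap F h).toRingHom)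

theorem coneAlgebraMap_refl (σ : PointedCone ℝ Plane) :
    coneAlgebraMap F (le_refl σ) = AlgHom.id F _ :=
  AddMonoidAlgebra.mapDomainAlgHom_id

theorem coneAlgebraMap_comp {ρ τ σ : PointedCone ℝ Plane} (h : ρ ≤ τ) (h' : τ ≤ σ) :
    (coneAlgebraMap F h).comp (coneAlgebraMap F h') = coneAlgebraMap F (h.trans h') :=
  (AddMonoidAlgebra.mapDomainAlgHom_comp ..).symm

theorem affineToricMap_refl (σ : PointedCone ℝ Plane) :
    affineToricMap F (le_refl σ) = 𝟙 _ := by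
  unfold affineToricMap
  rw [coneAlgebraMap_refl]
  exact Spec.map_id _

theorem affineToricMap_comp {ρ τ σ : PointedCone ℝ Plane} (h : ρ ≤ τ) (h' : τ ≤ σ) :
    affineToricMap F h ≫ affineToricMap F h' = affineToricMap F (h.trans h') := by
  unfold affineToricMap
  rw [← coneAlgebraMap_comp F h h']
  exact (Spec.map_comp _ _).symm

/-- The structure morphism `U_σ → Spec F`. -/
def affineToricToSpec (σ : PointedCone ℝ Plane) : affineToric F σ ⟶ Spec (CommRingCat.of F) :=
  Spec.map (CommRingCat.ofHom (algebraMap F (coneAlgebra F σ)))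

theorem affineToricMap_toSpec {τ σ : PointedCone ℝ Plane} (h : τ ≤ σ) :
    affineToricMap F h ≫ affineToricToSpec F σ = affineToricToSpec F τ := by
  unfold affineToricMap affineToricToSpec
  rw [← Spec.map_comp, ← CommRingCat.ofHom_comp]
  congr 2
  exact (coneAlgebraMap F h).comp_algebraMap

/-- The character `x^u` as an element of `F[S_σ]`. -/
def character {σ : PointedCone ℝ Plane} (u : dualMonoid σ) : coneAlgebra F σ :=
  AddMonoidAlgebra.single u 1

theorem exists_nsmul_add_mem {τ σ : PointedCone ℝ Plane}
    (hσ : ∃ S : Set Lattice, S.Finite ∧ σ = latticeCone S) {u : Lattice} (hu : u ∈ dualMonoid σ)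
    (hτ : ∀ x, x ∈ τ ↔ x ∈ σ ∧ pairing u x = 0) {w : Lattice} (hw : w ∈ dualMonoid τ) :
    ∃ n : ℕ, ∀ k : ℕ, n ≤ k → w + k • u ∈ dualMonoid σ := by
  obtain ⟨S, hS, rfl⟩ := hσ
  have key : ∀ s ∈ S, ∃ n : ℕ, ∀ k : ℕ, n ≤ k → 0 ≤ pairing (w + k • u) (toPlane s) := by
    intro s hs
    have hsσ : toPlane s ∈ latticeCone S := Submodule.subset_span ⟨s, hs, rfl⟩
    have h0 := hu _ hsσ
    rcases h0.eq_or_lt with h | h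
    · refine ⟨0, fun k _ => ?_⟩
      rw [pairing_add_left, pairing_nsmul_left, ← h, mul_zero, add_zero]
      exact hw _ ((hτ _).2 ⟨hsσ, h.symm⟩)
    · obtain ⟨n, hn⟩ := exists_nat_gt (-(pairing w (toPlane s)) / pairing u (toPlane s))
      refine ⟨n, fun k hk => ?_⟩
      rw [pairing_add_left, pairing_nsmul_left]
      rw [div_lt_iff₀ h] at hn
      have : (n : ℝ) * pairing u (toPlane s) ≤ k * pairing u (toPlane s) :=
        mul_le_mul_of_nonneg_right (by exact_mod_cast hk) h.le
      linarith
  choose! n hn using key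
  obtain ⟨B, hB⟩ := (hS.image n).bddAbove
  refine ⟨B, fun k hk x hx => ?_⟩
  refine Submodule.span_induction (p := fun x _ => 0 ≤ pairing (w + k • u) x) ?_ ?_ ?_ ?_ hx
  · rintro _ ⟨s, hs, rfl⟩
    exact hn s hs k ((hB ⟨s, hs, rfl⟩).trans hk)
  · exact (pairing_zero_right _).ge
  · intro x y _ _ h1 h2
    rw [pairing_add]; exact add_nonneg h1 h2
  · intro a x _ h
    have : a • x = (a : ℝ) • x := rfl
    rw [this, pairing_smul]; exact mul_nonneg a.2 h

/-- For a face `τ = σ ∩ u^⊥`, the ring `F[S_τ]` is the localization of `F[S_σ]` at `x^u`. -/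
theorem isLocalization_face {τ σ : PointedCone ℝ Plane} (h : τ ≤ σ)
    (hσ : ∃ S : Set Lattice, S.Finite ∧ σ = latticeCone S) (u : dualMonoid σ)
    (hτ : ∀ x, x ∈ τ ↔ x ∈ σ ∧ pairing u x = 0) :
    letI := (coneAlgebraMap F h).toRingHom.toAlgebra
    IsLocalization.Away (character F u) (coneAlgebra F τ) := by
  let _ := (coneAlgebraMap F h).toRingHom.toAlgebra
  have hmap : ∀ (v : dualMonoid σ) (c : F),
      algebraMap (coneAlgebra F σ) (coneAlgebra F τ) (AddMonoidAlgebra.single v c) =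
        AddMonoidAlgebra.single (AddSubmonoid.inclusion (dualMonoid_anti h) v) c := by
    intro v c
    exact AddMonoidAlgebra.mapDomain_single
  have hneg : -(u : Lattice) ∈ dualMonoid τ := by
    intro x hx
    have h1 := ((hτ x).1 hx).2
    have h2 := pairing_add_left (u : Lattice) (-u) x
    rw [add_neg_cancel, pairing_zero_left, h1, zero_add] at h2
    exact h2.le
  have hpow : ∀ n : ℕ, algebraMap (coneAlgebra F σ) (coneAlgebra F τ) (character F u ^ n) =
      AddMonoidAlgebra.single (AddSubmonoid.inclusion (dualMonoid_anti h) (n • u)) 1 := by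
    intro n
    rw [character, AddMonoidAlgebra.single_pow, one_pow, hmap]
  have hsurj : ∀ z : coneAlgebra F τ, ∃ n : ℕ, ∀ k : ℕ, n ≤ k → ∃ a : coneAlgebra F σ,
      z * algebraMap (coneAlgebra F σ) (coneAlgebra F τ) (character F u ^ k) =
        algebraMap (coneAlgebra F σ) (coneAlgebra F τ) a := by
    intro z
    induction z using AddMonoidAlgebra.induction_linear with
    | zero => exact ⟨0, fun k _ => ⟨0, by simp⟩⟩
    | add f g hf hg =>
      obtain ⟨n, hn⟩ := hf
      obtain ⟨n', hn'⟩ := hg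
      refine ⟨max n n', fun k hk => ?_⟩
      obtain ⟨a, ha⟩ := hn k (le_of_max_le_left hk)
      obtain ⟨b, hb⟩ := hn' k (le_of_max_le_right hk)
      exact ⟨a + b, by rw [add_mul, ha, hb, map_add]⟩
    | single w c =>
      obtain ⟨n, hn⟩ := exists_nsmul_add_mem hσ u.2 hτ w.2
      refine ⟨n, fun k hk => ⟨AddMonoidAlgebra.single ⟨_, hn k hk⟩ c, ?_⟩⟩
      rw [hpow, hmap, AddMonoidAlgebra.single_mul_single, mul_one]
      congr 1
  refine IsLocalization.Away.mk _ ?_ ?_ ?_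
  · refine IsUnit.of_mul_eq_one (AddMonoidAlgebra.single ⟨-(u : Lattice), hneg⟩ 1) ?_
    rw [character, hmap, AddMonoidAlgebra.single_mul_single, mul_one, AddMonoidAlgebra.one_def]
    congr 1
    exact Subtype.ext (add_neg_cancel (u : Lattice))
  · intro z
    obtain ⟨n, hn⟩ := hsurj z
    simp only [← map_pow]
    exact ⟨n, hn n le_rfl⟩
  · intro a b hab
    refine ⟨0, ?_⟩
    have : a = b := AddMonoidAlgebra.mapDomain_injective
      (AddSubmonoid.inclusion_injective (dualMonoid_anti h)) hab
    rw [this]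

theorem isOpenImmersion_face {τ σ : PointedCone ℝ Plane} (h : τ ≤ σ)
    (hσ : ∃ S : Set Lattice, S.Finite ∧ σ = latticeCone S) (hf : IsFace τ σ) :
    IsOpenImmersion (affineToricMap F h) := by
  obtain ⟨u, hu, hτ⟩ := hf
  let _ := (coneAlgebraMap F h).toRingHom.toAlgebra
  have := isLocalization_face F h hσ ⟨u, hu⟩ hτ
  exact IsOpenImmersion.of_isLocalization (R := coneAlgebra F σ) (S := coneAlgebra F τ)
    (character F ⟨u, hu⟩)

theorem range_face {τ σ : PointedCone ℝ Plane} (h : τ ≤ σ)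
    (hσ : ∃ S : Set Lattice, S.Finite ∧ σ = latticeCone S) (u : dualMonoid σ)
    (hτ : ∀ x, x ∈ τ ↔ x ∈ σ ∧ pairing u x = 0) :
    Set.range (affineToricMap F h) =
      (PrimeSpectrum.basicOpen (character F u) : Set (PrimeSpectrum (coneAlgebra F σ))) := by
  let _ := (coneAlgebraMap F h).toRingHom.toAlgebra
  have := isLocalization_face F h hσ u hτ
  exact PrimeSpectrum.localization_away_comap_range (coneAlgebra F τ) (character F u)

end Algebra

section Gluing

variable (F : Type u) [Field F] (Δ : Fan)

/-- The diagram of the affine charts of the toric surface of a fan. -/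
def toricDiagram : Δ.Index ⥤ Scheme.{u} where
  obj σ := affineToric F σ.1
  map f := affineToricMap F (leOfHom f)
  map_id σ := affineToricMap_refl F σ.1
  map_comp f g := (affineToricMap_comp F (leOfHom f) (leOfHom g)).symm

instance {i j : Δ.Index} (f : i ⟶ j) : IsOpenImmersion ((toricDiagram F Δ).map f) :=
  isOpenImmersion_face F (leOfHom f) (Δ.rational j.1 j.2) (Δ.isFace_of_le (leOfHom f))

theorem Fan.inter_mem {σ τ : PointedCone ℝ Plane} (hσ : σ ∈ Δ.cones) (hτ : τ ∈ Δ.cones) :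
    σ ⊓ τ ∈ Δ.cones :=
  Δ.face_mem σ hσ _ (Δ.inter_isFace σ hσ τ hτ)

instance : (toricDiagram F Δ ⋙ Scheme.forget).IsLocallyDirected where
  cond {i j k} fi fj xi xj hx := by
    have hi : i.1 ≤ k.1 := leOfHom fi
    have hj : j.1 ≤ k.1 := leOfHom fj
    obtain ⟨u, hu, hui⟩ := Δ.isFace_of_le (leOfHom fi)
    obtain ⟨w, hw, hwj⟩ := Δ.isFace_of_le (leOfHom fj)
    have hx' : affineToricMap F hi xi = affineToricMap F hj xj := hx
    let l : Δ.Index := ⟨i.1 ⊓ j.1, Δ.inter_mem i.2 j.2⟩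
    have hli : l ≤ i := inf_le_left (a := i.1) (b := j.1)
    have hlj : l ≤ j := inf_le_right (a := i.1) (b := j.1)
    have hlk : l.1 ≤ k.1 := le_trans (show l.1 ≤ i.1 from hli) hi
    let uw : dualMonoid k.1 := ⟨u, hu⟩ + ⟨w, hw⟩
    have hface : ∀ x, x ∈ l.1 ↔ x ∈ k.1 ∧ pairing uw x = 0 := by
      intro x
      have e : pairing uw x = pairing u x + pairing w x := pairing_add_left u w x
      change x ∈ i.1 ∧ x ∈ j.1 ↔ _
      rw [hui, hwj, e]
      constructor
      · rintro ⟨⟨h1, h2⟩, _, h3⟩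
        exact ⟨h1, by rw [h2, h3, add_zero]⟩
      · rintro ⟨h1, h2⟩
        have h3 := hu x h1
        have h4 := hw x h1
        exact ⟨⟨h1, by linarith⟩, h1, by linarith⟩
    have m1 : affineToricMap F hi xi ∈ Set.range (affineToricMap F hi) := ⟨xi, rfl⟩
    have m2 : affineToricMap F hi xi ∈ Set.range (affineToricMap F hj) := ⟨xj, hx'.symm⟩
    rw [range_face F hi (Δ.rational k.1 k.2) ⟨u, hu⟩ hui] at m1
    rw [range_face F hj (Δ.rational k.1 k.2) ⟨w, hw⟩ hwj] at m2
    have hch : character F uw = character F ⟨u, hu⟩ * character F ⟨w, hw⟩ := by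
      rw [character, character, character, AddMonoidAlgebra.single_mul_single, mul_one]
    have m3 : affineToricMap F hi xi ∈ Set.range (affineToricMap F hlk) := by
      rw [range_face F hlk (Δ.rational k.1 k.2) uw hface, hch, PrimeSpectrum.basicOpen_mul]
      exact ⟨m1, m2⟩
    obtain ⟨x, hxl⟩ := m3
    have inj {a b : Δ.Index} (h : a ≤ b) :
        Function.Injective (affineToricMap F (show a.1 ≤ b.1 from h)) :=
      have := isOpenImmersion_face F (show a.1 ≤ b.1 from h) (Δ.rational b.1 b.2) (Δ.isFace_of_le h)
      (affineToricMap F (show a.1 ≤ b.1 from h)).isOpenEmbedding.injective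
    refine ⟨l, homOfLE hli, homOfLE hlj, x, ?_, ?_⟩
    · apply inj (leOfHom fi)
      change affineToricMap F hi (affineToricMap F hli x) = affineToricMap F hi xi
      rw [← hxl, ← affineToricMap_comp F hli hi]
      rfl
    · apply inj (leOfHom fj)
      change affineToricMap F hj (affineToricMap F hlj x) = affineToricMap F hj xj
      rw [← hx', ← hxl, ← affineToricMap_comp F hlj hj]
      rfl

instance : Finite Δ.Index := Δ.finite

/-- The toric surface `X(Δ)` over the field `F`: the affine charts `U_σ = Spec F[S_σ]`, `σ ∈ Δ`,
glued along the open subschemes given by the common faces. -/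
def toricSurface : Scheme.{u} := colimit (toricDiagram F Δ)

/-- The open immersion of the chart `U_σ` into `X(Δ)`. -/
def toricChart (σ : Δ.Index) : affineToric F σ.1 ⟶ toricSurface F Δ :=
  colimit.ι (toricDiagram F Δ) σ

/-- The structure morphism `X(Δ) → Spec F`. -/
def toricSurfaceToSpec : toricSurface F Δ ⟶ Spec (CommRingCat.of F) :=
  colimit.desc (toricDiagram F Δ)
    { pt := Spec (CommRingCat.of F)
      ι :=
        { app := fun σ => affineToricToSpec F σ.1
          naturality := fun _ _ f =>
            (affineToricMap_toSpec F (leOfHom f)).trans (Category.comp_id _).symm } }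

end Gluing
section PlanarFan

/-- The determinant `|a b|`. -/
def det (a b : Lattice) : ℤ := a 0 * b 1 - a 1 * b 0

theorem mem_latticeCone_singleton {a : Lattice} {x : Plane} :
    x ∈ latticeCone {a} ↔ ∃ s : ℝ, 0 ≤ s ∧ s • toPlane a = x := by
  rw [latticeCone, Set.image_singleton, PointedCone.hull, Submodule.mem_span_singleton]
  constructor
  · rintro ⟨s, rfl⟩; exact ⟨s, s.2, rfl⟩
  · rintro ⟨s, hs, rfl⟩; exact ⟨⟨s, hs⟩, rfl⟩

theorem mem_latticeCone_pair {a b : Lattice} {x : Plane} :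
    x ∈ latticeCone {a, b} ↔
      ∃ s t : ℝ, 0 ≤ s ∧ 0 ≤ t ∧ s • toPlane a + t • toPlane b = x := by
  rw [latticeCone, Set.image_pair, PointedCone.hull, Submodule.mem_span_pair]
  constructor
  · rintro ⟨s, t, rfl⟩; exact ⟨s, t, s.2, t.2, rfl⟩
  · rintro ⟨s, t, hs, ht, rfl⟩; exact ⟨⟨s, hs⟩, ⟨t, ht⟩, rfl⟩

theorem latticeCone_mono {S T : Set Lattice} (h : S ⊆ T) : latticeCone S ≤ latticeCone T :=
  Submodule.span_mono (Set.image_mono h)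

theorem toPlane_mem_latticeCone {S : Set Lattice} {a : Lattice} (h : a ∈ S) :
    toPlane a ∈ latticeCone S := Submodule.subset_span ⟨a, h, rfl⟩

theorem latticeCone_le {S : Set Lattice} {σ : PointedCone ℝ Plane}
    (h : ∀ a ∈ S, toPlane a ∈ σ) : latticeCone S ≤ σ :=
  Submodule.span_le.2 (by rintro _ ⟨a, ha, rfl⟩; exact h a ha)

theorem latticeCone_pair_eq {a b : Lattice} (h : det a b ≠ 0) {s t s' t' : ℝ}
    (e : s • toPlane a + t • toPlane b = s' • toPlane a + t' • toPlane b) : s = s' ∧ t = t' := by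
  have e0 := congrFun e 0
  have e1 := congrFun e 1
  simp only [toPlane, Pi.add_apply, Pi.smul_apply, smul_eq_mul] at e0 e1
  have hd : ((a 0 : ℝ) * b 1 - a 1 * b 0) ≠ 0 := by exact_mod_cast h
  constructor
  · apply mul_right_cancel₀ hd; linear_combination (b 1 : ℝ) * e0 - (b 0 : ℝ) * e1
  · apply mul_right_cancel₀ hd; linear_combination (a 0 : ℝ) * e1 - (a 1 : ℝ) * e0

theorem exists_coords {a b : Lattice} (h : det a b ≠ 0) (x : Plane) :
    ∃ s t : ℝ, s • toPlane a + t • toPlane b = x := by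
  have hd : ((a 0 : ℝ) * b 1 - a 1 * b 0) ≠ 0 := by exact_mod_cast h
  refine ⟨(x 0 * b 1 - x 1 * b 0) / (a 0 * b 1 - a 1 * b 0),
    (a 0 * x 1 - a 1 * x 0) / (a 0 * b 1 - a 1 * b 0), ?_⟩
  funext i
  fin_cases i <;>
    simp only [toPlane, Pi.add_apply, Pi.smul_apply, smul_eq_mul, Fin.zero_eta, Fin.mk_one] <;>
    rw [div_mul_eq_mul_div, div_mul_eq_mul_div, ← add_div, div_eq_iff hd] <;> ring

theorem pair_interior_aux {R : Finset Lattice} {a b d : Lattice} (hd : d ∈ R)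
    (hab : det a b ≠ 0) (had : det a d ≠ 0)
    (habR : ∀ r ∈ R, toPlane r ∈ latticeCone {a, b} → r = a ∨ r = b)
    {s t : ℝ} (ht : 0 < t)
    (hx : s • toPlane a + t • toPlane b ∈ latticeCone {a, d}) :
    toPlane a ∈ latticeCone {a, d} ∧ toPlane b ∈ latticeCone {a, d} := by
  refine ⟨toPlane_mem_latticeCone (by simp), ?_⟩
  obtain ⟨p, q, hp, hq, e⟩ := mem_latticeCone_pair.1 hx
  obtain ⟨d1, d2, ed⟩ := exists_coords hab (toPlane d)
  have e' : (p + q * d1) • toPlane a + (q * d2) • toPlane b =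
      s • toPlane a + t • toPlane b := by
    rw [← e, ← ed]; module
  obtain ⟨-, h2⟩ := latticeCone_pair_eq hab e'
  have hd2 : 0 < d2 := by
    by_contra hn
    have := mul_nonpos_of_nonneg_of_nonpos hq (not_lt.1 hn)
    linarith
  rcases le_total 0 d1 with hd1 | hd1
  · rcases habR d hd (mem_latticeCone_pair.2 ⟨d1, d2, hd1, hd2.le, ed⟩) with rfl | rfl
    · exact absurd (by simp [det, mul_comm]) had
    · exact toPlane_mem_latticeCone (by simp)
  · refine mem_latticeCone_pair.2 ⟨-d1 / d2, 1 / d2, div_nonneg (by linarith) hd2.le,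
      by positivity, ?_⟩
    rw [← ed, smul_add, smul_smul, smul_smul, ← add_assoc, ← add_smul]
    have h1 : -d1 / d2 + 1 / d2 * d1 = 0 := by field_simp; ring
    have h2 : 1 / d2 * d2 = 1 := by field_simp
    rw [h1, h2, zero_smul, zero_add, one_smul]

theorem det_swap (a b : Lattice) : det b a = -det a b := by simp only [det]; ring

/-- Two cones spanned by adjacent pairs from `R` coincide if the interior of one meets the other. -/
theorem pair_interior {R : Finset Lattice} {a b c d : Lattice} (ha : a ∈ R)
    (hc : c ∈ R) (hd : d ∈ R) (hab : det a b ≠ 0) (hcd : det c d ≠ 0)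
    (habR : ∀ r ∈ R, toPlane r ∈ latticeCone {a, b} → r = a ∨ r = b)
    (hcdR : ∀ r ∈ R, toPlane r ∈ latticeCone {c, d} → r = c ∨ r = d)
    {s t : ℝ} (hs : 0 < s) (ht : 0 < t)
    (hx : s • toPlane a + t • toPlane b ∈ latticeCone {c, d}) :
    toPlane a ∈ latticeCone {c, d} ∧ toPlane b ∈ latticeCone {c, d} := by
  have hba : det b a ≠ 0 := by rw [det_swap]; exact neg_ne_zero.2 hab
  have hdc : det d c ≠ 0 := by rw [det_swap]; exact neg_ne_zero.2 hcd
  have hbaR : ∀ r ∈ R, toPlane r ∈ latticeCone {b, a} → r = b ∨ r = a := fun r hr h =>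
    (habR r hr (by rwa [Set.pair_comm])).symm
  by_cases h : c = a ∨ c = b ∨ d = a ∨ d = b
  · rcases h with rfl | rfl | rfl | rfl
    · exact pair_interior_aux hd hab hcd habR ht hx
    · exact (pair_interior_aux hd hba hcd hbaR hs (by rwa [add_comm])).symm
    · rw [Set.pair_comm] at hx ⊢
      exact pair_interior_aux hc hab hdc habR ht hx
    · rw [Set.pair_comm] at hx ⊢
      exact (pair_interior_aux hc hba hdc hbaR hs (by rwa [add_comm])).symm
  exfalso
  push Not at h
  obtain ⟨hca, hcb, hda, hdb⟩ := h
  obtain ⟨p, q, hp, hq, e⟩ := mem_latticeCone_pair.1 hx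
  obtain ⟨c1, c2, ec⟩ := exists_coords hab (toPlane c)
  obtain ⟨d1, d2, ed⟩ := exists_coords hab (toPlane d)
  have e' : (p * c1 + q * d1) • toPlane a + (p * c2 + q * d2) • toPlane b =
      s • toPlane a + t • toPlane b := by
    rw [← e, ← ec, ← ed]; module
  obtain ⟨h1, h2⟩ := latticeCone_pair_eq hab e'
  have hc' : ¬ (0 ≤ c1 ∧ 0 ≤ c2) := fun h => by
    rcases habR c hc (mem_latticeCone_pair.2 ⟨c1, c2, h.1, h.2, ec⟩) with h | h
    exacts [hca h, hcb h]
  have hd' : ¬ (0 ≤ d1 ∧ 0 ≤ d2) := fun h => by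
    rcases habR d hd (mem_latticeCone_pair.2 ⟨d1, d2, h.1, h.2, ed⟩) with h | h
    exacts [hda h, hdb h]
  have hacd : toPlane a ∉ latticeCone {c, d} := fun h => by
    rcases hcdR a ha h with h | h
    exacts [hca h.symm, hda h.symm]
  have key : ∀ δ : ℝ, δ = c1 * d2 - c2 * d1 → δ ≠ 0 → 0 ≤ d2 / δ → 0 ≤ -c2 / δ → False := by
    intro δ hδ h0 i1 i2
    refine hacd (mem_latticeCone_pair.2 ⟨d2 / δ, -c2 / δ, i1, i2, ?_⟩)
    rw [← ec, ← ed, smul_add, smul_add, smul_smul, smul_smul, smul_smul, smul_smul,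
      add_add_add_comm, ← add_smul, ← add_smul]
    have j1 : d2 / δ * c1 + -c2 / δ * d1 = 1 := by field_simp; rw [hδ]; ring
    have j2 : d2 / δ * c2 + -c2 / δ * d2 = 0 := by field_simp; ring
    rw [j1, j2, one_smul, zero_smul, add_zero]
  have pos_of {x y : ℝ} (hx : 0 ≤ x) (h : 0 < x * y) : 0 < x ∧ 0 < y := by
    have hy : 0 < y := pos_of_mul_pos_right h hx
    exact ⟨pos_of_mul_pos_left h hy.le, hy⟩
  rcases lt_or_ge c1 0 with k | k
  · obtain ⟨q0, d10⟩ := pos_of hq (by nlinarith : 0 < q * d1)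
    have d20 : d2 < 0 := by
      by_contra hn; exact hd' ⟨d10.le, not_lt.1 hn⟩
    obtain ⟨p0, c20⟩ := pos_of hp (by nlinarith : 0 < p * c2)
    have hδ : c1 * d2 - c2 * d1 < 0 := by
      have i1 : p * (-c1) < q * d1 := by linarith
      have i2 : q * (-d2) < p * c2 := by linarith
      have i3 := mul_lt_mul'' i1 i2 (by nlinarith) (by nlinarith)
      have i4 : (p * q) * (c1 * d2 - c2 * d1) < 0 := by nlinarith
      by_contra hn
      have := mul_nonneg (mul_pos p0 q0).le (not_lt.1 hn)
      linarith
    exact key _ rfl hδ.ne (div_nonneg_of_nonpos d20.le hδ.le)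
      (div_nonneg_of_nonpos (by linarith) hδ.le)
  · have c20 : c2 < 0 := by
      by_contra hn; exact hc' ⟨k, not_lt.1 hn⟩
    obtain ⟨q0, d20⟩ := pos_of hq (by nlinarith : 0 < q * d2)
    have d10 : d1 < 0 := by
      by_contra hn; exact hd' ⟨not_lt.1 hn, d20.le⟩
    obtain ⟨p0, c10⟩ := pos_of hp (by nlinarith : 0 < p * c1)
    have hδ : 0 < c1 * d2 - c2 * d1 := by
      have i1 : q * (-d1) < p * c1 := by linarith
      have i2 : p * (-c2) < q * d2 := by linarith
      have i3 := mul_lt_mul'' i1 i2 (by nlinarith) (by nlinarith)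
      have i4 : 0 < (p * q) * (c1 * d2 - c2 * d1) := by nlinarith
      exact pos_of_mul_pos_right i4 (mul_pos p0 q0).le
    exact key _ rfl hδ.ne' (div_nonneg d20.le hδ.le) (div_nonneg (by linarith) hδ.le)

/-- `a` and `b` span a strongly convex two-dimensional cone containing no further element
of `R`. -/
def IsAdjacent (R : Finset Lattice) (a b : Lattice) : Prop :=
  a ∈ R ∧ b ∈ R ∧ det a b ≠ 0 ∧ ∀ r ∈ R, toPlane r ∈ latticeCone {a, b} → r = a ∨ r = b

/-- The cones of the fan with prescribed ray generators: the origin, the rays through the elements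
of `R`, and the cones spanned by adjacent pairs of elements of `R`. -/
def planarCones (R : Finset Lattice) : Set (PointedCone ℝ Plane) :=
  {σ | σ = latticeCone ∅ ∨ (∃ a ∈ R, σ = latticeCone {a}) ∨
    ∃ a b, IsAdjacent R a b ∧ σ = latticeCone {a, b}}

theorem mem_latticeCone_empty {x : Plane} : x ∈ latticeCone ∅ ↔ x = 0 := by
  simp [latticeCone]

theorem pairing_nonneg {σ : PointedCone ℝ Plane} {S : Set Lattice} (h : σ = latticeCone S)
    {u : Lattice} (hu : ∀ a ∈ S, 0 ≤ pairing u (toPlane a)) : u ∈ dualMonoid σ := by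
  subst h
  intro x hx
  refine Submodule.span_induction (p := fun x _ => 0 ≤ pairing u x) ?_ ?_ ?_ ?_ hx
  · rintro _ ⟨s, hs, rfl⟩; exact hu s hs
  · exact (pairing_zero_right _).ge
  · intro x y _ _ h1 h2
    rw [pairing_add]; exact add_nonneg h1 h2
  · intro a x _ h
    have : a • x = (a : ℝ) • x := rfl
    rw [this, pairing_smul]; exact mul_nonneg a.2 h

theorem isFace_self (σ : PointedCone ℝ Plane) : IsFace σ σ :=
  ⟨0, (dualMonoid σ).zero_mem, fun x => by simp [pairing_zero_left]⟩

theorem pairing_self_pos {a : Lattice} (ha : toPlane a ≠ 0) : 0 < pairing a (toPlane a) := by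
  have h : pairing a (toPlane a) = (toPlane a 0) ^ 2 + (toPlane a 1) ^ 2 := by
    simp [pairing, toPlane]; ring
  rw [h]
  by_contra hn
  apply ha
  have h0 : toPlane a 0 = 0 := by nlinarith [sq_nonneg (toPlane a 0), sq_nonneg (toPlane a 1)]
  have h1 : toPlane a 1 = 0 := by nlinarith [sq_nonneg (toPlane a 0), sq_nonneg (toPlane a 1)]
  funext i
  fin_cases i <;> assumption

theorem isFace_origin_ray (a : Lattice) : IsFace (latticeCone ∅) (latticeCone {a}) := by
  by_cases ha : toPlane a = 0
  · have e : latticeCone ∅ = latticeCone {a} := by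
      apply le_antisymm (latticeCone_mono (Set.empty_subset _))
      exact latticeCone_le fun b hb => by
        rw [Set.mem_singleton_iff.1 hb, ha]; exact zero_mem _
    rw [e]
    exact isFace_self _
  · refine ⟨a, pairing_nonneg rfl fun b hb => ?_, fun x => ?_⟩
    · rw [Set.mem_singleton_iff.1 hb]; exact (pairing_self_pos ha).le
    · rw [mem_latticeCone_empty, mem_latticeCone_singleton]
      constructor
      · rintro rfl; exact ⟨⟨0, le_rfl, zero_smul _ _⟩, pairing_zero_right _⟩
      · rintro ⟨⟨s, -, rfl⟩, h⟩
        rw [pairing_smul] at h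
        rw [(mul_eq_zero.1 h).resolve_right (pairing_self_pos ha).ne', zero_smul]

/-- An integral linear form vanishing on `a` and positive on `b`. -/
theorem exists_form {a b : Lattice} (h : det a b ≠ 0) :
    ∃ u : Lattice, pairing u (toPlane a) = 0 ∧ 0 < pairing u (toPlane b) := by
  have hv : ∀ e : ℤ, pairing ![-(e * a 1), e * a 0] (toPlane b) = ((e * det a b : ℤ) : ℝ) := by
    intro e; simp [pairing, toPlane, det]; ring
  have hz : ∀ e : ℤ, pairing ![-(e * a 1), e * a 0] (toPlane a) = 0 := by
    intro e; simp [pairing, toPlane]; ring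
  refine ⟨_, hz (det a b), ?_⟩
  rw [hv]
  exact_mod_cast mul_self_pos.2 h

theorem isFace_ray_pair {a b : Lattice} (h : det a b ≠ 0) :
    IsFace (latticeCone {a}) (latticeCone {a, b}) := by
  obtain ⟨u, hua, hub⟩ := exists_form h
  refine ⟨u, pairing_nonneg rfl ?_, fun x => ?_⟩
  · rintro c (rfl | rfl)
    exacts [hua.ge, hub.le]
  · rw [mem_latticeCone_singleton, mem_latticeCone_pair]
    constructor
    · rintro ⟨s, hs, rfl⟩
      exact ⟨⟨s, 0, hs, le_rfl, by simp⟩, by rw [pairing_smul, hua, mul_zero]⟩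
    · rintro ⟨⟨s, t, hs, ht, rfl⟩, e⟩
      rw [pairing_add, pairing_smul, pairing_smul, hua, mul_zero, zero_add] at e
      exact ⟨s, hs, by rw [(mul_eq_zero.1 e).resolve_right hub.ne', zero_smul, add_zero]⟩

theorem isFace_origin_pair {a b : Lattice} (h : det a b ≠ 0) :
    IsFace (latticeCone ∅) (latticeCone {a, b}) := by
  obtain ⟨u, hua, hub⟩ := exists_form h
  obtain ⟨w, hwb, hwa⟩ := exists_form (a := b) (b := a) (by rw [det_swap]; exact neg_ne_zero.2 h)
  refine ⟨u + w, pairing_nonneg rfl ?_, fun x => ?_⟩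
  · rintro c (rfl | rfl) <;> rw [pairing_add_left] <;> linarith
  · rw [mem_latticeCone_empty, mem_latticeCone_pair]
    constructor
    · rintro rfl; exact ⟨⟨0, 0, le_rfl, le_rfl, by simp⟩, pairing_zero_right _⟩
    · rintro ⟨⟨s, t, hs, ht, rfl⟩, e⟩
      rw [pairing_add, pairing_smul, pairing_smul, pairing_add_left, pairing_add_left, hua, hwb,
        zero_add, add_zero] at e
      have i1 := mul_nonneg hs hwa.le
      have i2 := mul_nonneg ht hub.le
      have hs0 : s = 0 := (mul_eq_zero.1 (by linarith : s * pairing w (toPlane a) = 0)).resolve_right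
        hwa.ne'
      have ht0 : t = 0 := (mul_eq_zero.1 (by linarith : t * pairing u (toPlane b) = 0)).resolve_right
        hub.ne'
      simp [hs0, ht0]

/-- A subcone of a two-dimensional cone, contained in a third cone `τ`, is a face as soon as `τ`
contains the cone once it meets its interior. -/
theorem isFace_inter_pair {a b : Lattice} (h : det a b ≠ 0) {τ : PointedCone ℝ Plane}
    (H : ∀ s t : ℝ, 0 < s → 0 < t → s • toPlane a + t • toPlane b ∈ τ →
      toPlane a ∈ τ ∧ toPlane b ∈ τ) :
    IsFace (latticeCone {a, b} ⊓ τ) (latticeCone {a, b}) := by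
  have hscale : ∀ (v : Plane) (s : ℝ), 0 < s → s • v ∈ τ → v ∈ τ := by
    intro v s hs hv
    have := τ.smul_mem (inv_nonneg.2 hs.le) hv
    rwa [smul_smul, inv_mul_cancel₀ hs.ne', one_smul] at this
  have hcase : ∀ s t : ℝ, 0 ≤ s → 0 ≤ t → s • toPlane a + t • toPlane b ∈ τ →
      (s = 0 ∨ toPlane a ∈ τ) ∧ (t = 0 ∨ toPlane b ∈ τ) := by
    intro s t hs ht hx
    rcases hs.eq_or_lt with rfl | hs
    · refine ⟨Or.inl rfl, ?_⟩
      rcases ht.eq_or_lt with rfl | ht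
      · exact Or.inl rfl
      · rw [zero_smul, zero_add] at hx
        exact Or.inr (hscale _ t ht hx)
    · rcases ht.eq_or_lt with rfl | ht
      · rw [zero_smul, add_zero] at hx
        exact ⟨Or.inr (hscale _ s hs hx), Or.inl rfl⟩
      · obtain ⟨h1, h2⟩ := H s t hs ht hx
        exact ⟨Or.inr h1, Or.inr h2⟩
  by_cases hA : toPlane a ∈ τ <;> by_cases hB : toPlane b ∈ τ
  · have e : latticeCone {a, b} ≤ τ := latticeCone_le (by rintro c (rfl | rfl) <;> assumption)
    rw [inf_eq_left.2 e]
    exact isFace_self _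
  · convert isFace_ray_pair h using 1
    apply le_antisymm
    · rintro x ⟨hx, hxτ⟩
      obtain ⟨s, t, hs, ht, rfl⟩ := mem_latticeCone_pair.1 hx
      have := (hcase s t hs ht hxτ).2.resolve_right hB
      exact mem_latticeCone_singleton.2 ⟨s, hs, by simp [this]⟩
    · exact le_inf (latticeCone_mono (by simp)) (latticeCone_le (by rintro c rfl; exact hA))
  · rw [Set.pair_comm]
    convert isFace_ray_pair (a := b) (b := a) (by rw [det_swap]; exact neg_ne_zero.2 h) using 1
    apply le_antisymm
    · rintro x ⟨hx, hxτ⟩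
      rw [Set.pair_comm] at hx
      obtain ⟨s, t, hs, ht, rfl⟩ := mem_latticeCone_pair.1 hx
      have := (hcase s t hs ht hxτ).1.resolve_right hA
      exact mem_latticeCone_singleton.2 ⟨t, ht, by simp [this]⟩
    · exact le_inf (latticeCone_mono (by simp)) (latticeCone_le (by rintro c rfl; exact hB))
  · convert isFace_origin_pair h using 1
    apply le_antisymm
    · rintro x ⟨hx, hxτ⟩
      obtain ⟨s, t, hs, ht, rfl⟩ := mem_latticeCone_pair.1 hx
      obtain ⟨h1, h2⟩ := hcase s t hs ht hxτ
      rw [h1.resolve_right hA, h2.resolve_right hB]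
      exact mem_latticeCone_empty.2 (by simp)
    · exact latticeCone_le (by rintro c ⟨⟩)

/-- The fan in `ℤ²` whose two-dimensional cones are spanned by the pairs of adjacent elements
of `R`. -/
def planarFan (R : Finset Lattice) : Fan where
  cones := planarCones R
  finite := by
    have : planarCones R ⊆ (fun T : Finset Lattice => latticeCone T) '' (R.powerset : Set _) := by
      classical
      rintro σ (rfl | ⟨a, ha, rfl⟩ | ⟨a, b, h, rfl⟩)
      · exact ⟨∅, by simp⟩
      · exact ⟨{a}, by simp [ha], by simp⟩
      · exact ⟨{a, b}, by simp [Set.insert_subset_iff, h.1, h.2.1], by simp⟩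
    exact ((Finset.finite_toSet _).image _).subset this
  nonempty := ⟨_, Or.inl rfl⟩
  rational := by
    rintro σ (rfl | ⟨a, ha, rfl⟩ | ⟨a, b, h, rfl⟩)
    exacts [⟨∅, by simp, rfl⟩, ⟨{a}, by simp, rfl⟩, ⟨{a, b}, by simp, rfl⟩]
  stronglyConvex := by
    rintro σ (rfl | ⟨a, ha, rfl⟩ | ⟨a, b, h, rfl⟩) x hx hnx
    · exact mem_latticeCone_empty.1 hx
    · obtain ⟨s, hs, rfl⟩ := mem_latticeCone_singleton.1 hx
      obtain ⟨t, ht, e⟩ := mem_latticeCone_singleton.1 hnx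
      have e1 : (s + t) • toPlane a = 0 := by rw [add_smul, e, add_neg_cancel]
      rcases smul_eq_zero.1 e1 with h | h
      · rw [show s = 0 by linarith, zero_smul]
      · rw [h, smul_zero]
    · obtain ⟨s, t, hs, ht, rfl⟩ := mem_latticeCone_pair.1 hx
      obtain ⟨s', t', hs', ht', e⟩ := mem_latticeCone_pair.1 hnx
      have e1 : (s + s') • toPlane a + (t + t') • toPlane b =
          (0 : ℝ) • toPlane a + (0 : ℝ) • toPlane b := by
        rw [add_smul, add_smul, add_add_add_comm, e]; simp
      obtain ⟨h1, h2⟩ := latticeCone_pair_eq h.2.2.1 e1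
      rw [show s = 0 by linarith, show t = 0 by linarith]; simp
  face_mem := by
    rintro σ (rfl | ⟨a, ha, rfl⟩ | ⟨a, b, h, rfl⟩) τ ⟨u, hu, hτ⟩
    · left
      ext x
      rw [hτ, mem_latticeCone_empty]
      constructor
      · exact fun h => h.1
      · rintro rfl; exact ⟨rfl, pairing_zero_right _⟩
    · by_cases h0 : pairing u (toPlane a) = 0
      · right; left
        refine ⟨a, ha, ?_⟩
        ext x
        rw [hτ]
        refine ⟨fun h => h.1, fun h => ⟨h, ?_⟩⟩
        obtain ⟨s, hs, rfl⟩ := mem_latticeCone_singleton.1 h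
        rw [pairing_smul, h0, mul_zero]
      · left
        ext x
        rw [hτ, mem_latticeCone_empty, mem_latticeCone_singleton]
        constructor
        · rintro ⟨⟨s, -, rfl⟩, h⟩
          rw [pairing_smul] at h
          rw [(mul_eq_zero.1 h).resolve_right h0, zero_smul]
        · rintro rfl; exact ⟨⟨0, le_rfl, zero_smul _ _⟩, pairing_zero_right _⟩
    · have ha0 := hu _ (toPlane_mem_latticeCone (show a ∈ ({a, b} : Set Lattice) by simp))
      have hb0 := hu _ (toPlane_mem_latticeCone (show b ∈ ({a, b} : Set Lattice) by simp))
      have hτ' : ∀ x, x ∈ τ ↔ ∃ s t : ℝ, 0 ≤ s ∧ 0 ≤ t ∧ s * pairing u (toPlane a) = 0 ∧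
          t * pairing u (toPlane b) = 0 ∧ s • toPlane a + t • toPlane b = x := by
        intro x
        rw [hτ, mem_latticeCone_pair]
        constructor
        · rintro ⟨⟨s, t, hs, ht, rfl⟩, e⟩
          rw [pairing_add, pairing_smul, pairing_smul] at e
          have i1 := mul_nonneg hs ha0
          have i2 := mul_nonneg ht hb0
          exact ⟨s, t, hs, ht, by linarith, by linarith, rfl⟩
        · rintro ⟨s, t, hs, ht, h1, h2, rfl⟩
          exact ⟨⟨s, t, hs, ht, rfl⟩, by
            rw [pairing_add, pairing_smul, pairing_smul, h1, h2, add_zero]⟩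
      by_cases hA : pairing u (toPlane a) = 0 <;> by_cases hB : pairing u (toPlane b) = 0
      · right; right
        refine ⟨a, b, h, ?_⟩
        ext x
        simp [hτ', mem_latticeCone_pair, hA, hB]
      · right; left
        refine ⟨a, h.1, ?_⟩
        ext x
        rw [hτ', mem_latticeCone_singleton]
        constructor
        · rintro ⟨s, t, hs, ht, -, h2, rfl⟩
          exact ⟨s, hs, by simp [(mul_eq_zero.1 h2).resolve_right hB]⟩
        · rintro ⟨s, hs, rfl⟩
          exact ⟨s, 0, hs, le_rfl, by simp [hA], by simp, by simp⟩
      · right; left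
        refine ⟨b, h.2.1, ?_⟩
        ext x
        rw [hτ', mem_latticeCone_singleton]
        constructor
        · rintro ⟨s, t, hs, ht, h1, -, rfl⟩
          exact ⟨t, ht, by simp [(mul_eq_zero.1 h1).resolve_right hA]⟩
        · rintro ⟨t, ht, rfl⟩
          exact ⟨0, t, le_rfl, ht, by simp, by simp [hB], by simp⟩
      · left
        ext x
        rw [hτ', mem_latticeCone_empty]
        constructor
        · rintro ⟨s, t, hs, ht, h1, h2, rfl⟩
          simp [(mul_eq_zero.1 h1).resolve_right hA, (mul_eq_zero.1 h2).resolve_right hB]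
        · rintro rfl
          exact ⟨0, 0, le_rfl, le_rfl, by simp, by simp, by simp⟩
  inter_isFace := by
    rintro σ (rfl | ⟨a, ha, rfl⟩ | ⟨a, b, h, rfl⟩) τ hτ
    · have e : latticeCone ∅ ≤ τ := latticeCone_le (by rintro c ⟨⟩)
      rw [inf_eq_left.2 e]
      exact isFace_self _
    · by_cases hA : toPlane a ∈ τ
      · have e : latticeCone {a} ≤ τ := latticeCone_le (by rintro c rfl; exact hA)
        rw [inf_eq_left.2 e]
        exact isFace_self _
      · convert isFace_origin_ray a using 1
        apply le_antisymm
        · rintro x ⟨hx, hxτ⟩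
          obtain ⟨s, hs, rfl⟩ := mem_latticeCone_singleton.1 hx
          rcases hs.eq_or_lt with rfl | hs
          · rw [zero_smul]; exact zero_mem _
          · exfalso
            apply hA
            have := τ.smul_mem (inv_nonneg.2 hs.le) hxτ
            rwa [smul_smul, inv_mul_cancel₀ hs.ne', one_smul] at this
        · exact latticeCone_le (by rintro c ⟨⟩)
    · apply isFace_inter_pair h.2.2.1
      intro s t hs ht hx
      rcases hτ with rfl | ⟨r, hr, rfl⟩ | ⟨c, d, h', rfl⟩
      · exfalso
        have e : s • toPlane a + t • toPlane b = (0 : ℝ) • toPlane a + (0 : ℝ) • toPlane b := by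
          rw [mem_latticeCone_empty.1 hx]; simp
        exact hs.ne' (latticeCone_pair_eq h.2.2.1 e).1
      · exfalso
        obtain ⟨l, hl, e⟩ := mem_latticeCone_singleton.1 hx
        have hl0 : l ≠ 0 := by
          rintro rfl
          have e : s • toPlane a + t • toPlane b = (0 : ℝ) • toPlane a + (0 : ℝ) • toPlane b := by
            rw [← e]; simp
          exact hs.ne' (latticeCone_pair_eq h.2.2.1 e).1
        have hlp : 0 < l := lt_of_le_of_ne hl hl0.symm
        have er : (s / l) • toPlane a + (t / l) • toPlane b = toPlane r := by
          rw [div_eq_inv_mul, div_eq_inv_mul, ← smul_smul, ← smul_smul, ← smul_add, ← e, smul_smul,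
            inv_mul_cancel₀ hl0, one_smul]
        rcases h.2.2.2 r hr (mem_latticeCone_pair.2 ⟨_, _, by positivity, by positivity, er⟩) with
          rfl | rfl
        · have e1 : (s / l) • toPlane r + (t / l) • toPlane b =
            (1 : ℝ) • toPlane r + (0 : ℝ) • toPlane b := by rw [er]; simp
          have := (latticeCone_pair_eq h.2.2.1 e1).2
          exact (div_pos ht hlp).ne' this
        · have e1 : (s / l) • toPlane a + (t / l) • toPlane r =
            (0 : ℝ) • toPlane a + (1 : ℝ) • toPlane r := by rw [er]; simp
          have := (latticeCone_pair_eq h.2.2.1 e1).1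
          exact (div_pos hs hlp).ne' this
      · exact pair_interior h.1 h'.1 h'.2.1 h.2.2.1 h'.2.2.1 h.2.2.2 h'.2.2.2 hs ht hx

end PlanarFan

section ToricMorphism

variable (F : Type u) [Field F]

/-- `Δ'` is a refinement of `Δ`, and `f : X(Δ') → X(Δ)` is the toric morphism induced by the
identity of the lattice: on the charts of cones `σ' ⊆ σ` it is given by the inclusion
`F[S_σ] → F[S_σ']`. -/
def IsRefinementMorphism {Δ' Δ : Fan} (f : toricSurface F Δ' ⟶ toricSurface F Δ) : Prop :=
  (∀ σ' : Δ'.Index, ∃ σ : Δ.Index, σ'.1 ≤ σ.1) ∧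
    ∀ (σ' : Δ'.Index) (σ : Δ.Index) (h : σ'.1 ≤ σ.1),
      toricChart F Δ' σ' ≫ f = affineToricMap F h ≫ toricChart F Δ σ

end ToricMorphism

section Desingularization

/-- `f : Y → X` is a desingularization: `Y` is nonsingular (all local rings are regular) and `f`
is proper and birational (an isomorphism over a dense open subset of `X` whose preimage is
dense). -/
structure IsDesingularization {Y X : Scheme.{u}} (f : Y ⟶ X) : Prop where
  regular : ∀ y : Y, IsRegularLocalRing (Y.presheaf.stalk y)
  proper : IsProper f
  birational : ∃ U : X.Opens, Dense (U : Set X) ∧ Dense ((f ⁻¹ᵁ U : Y.Opens) : Set Y) ∧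
    IsIso (f ∣_ U)

/-- `f : Y → X` is the minimal desingularization: every desingularization of `X` factors uniquely
through `f`. -/
structure IsMinimalDesingularization {Y X : Scheme.{u}} (f : Y ⟶ X) : Prop where
  isDesingularization : IsDesingularization f
  factors : ∀ (Z : Scheme.{u}) (g : Z ⟶ X), IsDesingularization g → ∃! h : Z ⟶ Y, h ≫ f = g

end Desingularization

section WeightedProjectivePlane

/-- The fan of the weighted projective plane `P(1,m,n)`: its ray generators are
`u₀ = -m e₁ - n e₂`, `u₁ = e₁`, `u₂ = e₂`, which span `ℤ²` and satisfy
`u₀ + m u₁ + n u₂ = 0`. -/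
def weightedProjectivePlaneFan (m n : ℕ) : Fan :=
  planarFan {![-(m : ℤ), -(n : ℤ)], ![1, 0], ![0, 1]}

/-- The weighted projective plane `P(1,m,n)` over the field `F`. -/
abbrev weightedProjectivePlane (F : Type u) [Field F] (m n : ℕ) : Scheme.{u} :=
  toricSurface F (weightedProjectivePlaneFan m n)

/-- The lattice points `v_j = (-j, -(jk + j - 1))`. -/
def rayV (k j : ℕ) : Lattice := ![-(j : ℤ), -((j : ℤ) * k + j - 1)]

/-- The set consisting of `e₁`, `-e₂`, `(-1, -(k+1))` and `v_0, …, v_m`. -/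
def desingularizationRays (m k : ℕ) : Finset Lattice :=
  {![1, 0], ![0, -1], ![-1, -((k : ℤ) + 1)]} ∪ (Finset.range (m + 1)).image (rayV k)

end WeightedProjectivePlane

end Toric

end

/-!
The minimal desingularization of the weighted projective plane `P(1,m,mk+m-1)` is the toric surface
of an explicit refinement of its fan.

*The surface.* The rays of the refined fan, listed counterclockwise (`rayCycle`), have consecutive
determinants `1` (`det_rayCycle_succ`), so the charts are affine planes and all local rings are
regular (`isRegularLocalRing_stalk_toricSurface`). Separatedness is the separation of the cones of a
fan by integral forms (`exists_separating_form`, `lift_coneAlgebraMap_surjective`). Properness is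
the valuative criterion: the signs of the valuations of the characters normal to the rays change
somewhere along the cycle of rays, and the cone where they change is the chart into which a point
extends (`exists_rayCycle`, `exists_lift_of_valuationRing`). Over the torus the refinement morphism
is an isomorphism.

*Minimality.* Neither intersection theory nor the classification of desingularizations of surfaces
is used. Let `g : Z → P(1,m,n)` be a desingularization. A factorization of `g` through the
refinement is determined over the torus, and spreads out from local rings, so one is needed only at
each local ring `O` of `Z` (`existsUnique_factorization`). The ring `O` is regular of dimension at most two,
because its field of fractions is the function field of the torus (`ringKrullDim_le_of_trdeg_le`,
`trdeg_le_two`), and hence factorial (`uniqueFactorizationMonoid_of_isRegularLocalRing`). Let `σ` be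
a two-dimensional cone of `P(1,m,n)` whose chart contains the image of the closed point. Every new
ray `r` in the interior of `σ` takes the value `1` on a linear form `s` that is positive on `σ`. If
`u` is normal to `r`, then `s, u` is a basis of `M`, and `x^u` or `x^{-u}` lies in `O`
(`torusChar_normal_mem_range_or`). This is clear if `t = x^s` is a unit of `O`, since `t^N x^u` lies
in `O` for large `N`. Otherwise suppose that `x^u = a/b` in lowest terms with non-units `a` and `b`.
The residue of `a/b` is transcendental, so every non-unit of `O` is divisible by `t` for the `t`-adic
valuation of `F(x^u)(t)`. But `a` and `b` divide a power of `t`, so `t` is a product of two non-units,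
which is impossible (`mem_or_inv_mem_of_factorial`). The resulting signs at the
rays of the subdivision of `σ` change at some cone `τ`, and the generators of `F[S_τ]` lie in `O`
(`exists_cycleCone_of_weightedCone`, `exists_factorization_coneAlgebra`).
-/

noncomputable section

namespace Toric

/-! ### Regular local rings of dimension at most two are factorial -/

section RegularLocal

open IsLocalRing

/-- A Noetherian local ring of dimension at least `n` whose maximal ideal has `n` generators is a
domain. The induction divides by an element `x ∈ 𝔪 ∖ 𝔪²` outside all minimal primes: if `(x)` is
prime, then a minimal prime `q ⊆ (x)` satisfies `q = xq`, so it vanishes. -/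
theorem isDomain_of_span_eq_maximalIdeal (n : ℕ) : ∀ (R : Type u) [CommRing R] [IsLocalRing R]
    [IsNoetherianRing R] (s : Finset R), Ideal.span (s : Set R) = maximalIdeal R → s.card ≤ n →
    (n : WithBot ℕ∞) ≤ ringKrullDim R → IsDomain R := by
  classical
  induction n with
  | zero =>
    intro R _ _ _ s hs hn _
    rw [Finset.card_eq_zero.1 (Nat.le_zero.1 hn)] at hs
    have : IsField R := isField_iff_maximalIdeal_eq.2 (by rw [← hs]; simp)
    exact this.isDomain
  | succ n ih =>
    intro R _ _ _ s hs hn hd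
    have hd0 : ringKrullDim R ≠ 0 := by
      intro h
      rw [h] at hd
      have h2 : ((n + 1 : ℕ) : WithBot ℕ∞) ≤ ((0 : ℕ) : WithBot ℕ∞) := by exact_mod_cast hd
      rw [Nat.cast_le] at h2
      omega
    obtain ⟨x, hxm, hx⟩ : ∃ x ∈ maximalIdeal R, x ∉ maximalIdeal R ^ 2 ∧
        ∀ q ∈ minimalPrimes R, x ∉ q := by
      by_contra hcon
      push Not at hcon
      have hfin : ({maximalIdeal R ^ 2} ∪ minimalPrimes R : Set (Ideal R)).Finite :=
        (Set.finite_singleton _).union (minimalPrimes.finite_of_isNoetherianRing R)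
      have hsub : (maximalIdeal R : Set R) ⊆
          ⋃ I ∈ ({maximalIdeal R ^ 2} ∪ minimalPrimes R : Set (Ideal R)), (id I : Ideal R) := by
        intro x hx
        by_cases h2 : x ∈ maximalIdeal R ^ 2
        · exact Set.mem_biUnion (Or.inl rfl) h2
        · obtain ⟨q, hq, hxq⟩ := hcon x hx h2
          exact Set.mem_biUnion (Or.inr hq) hxq
      obtain ⟨I, hI, hle⟩ := (Ideal.subset_union_prime_finite hfin (maximalIdeal R ^ 2)
        (maximalIdeal R ^ 2) (by
          rintro I (rfl | hI) h1 _
          · exact absurd rfl h1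
          · exact hI.1.1)).1 hsub
      rcases hI with rfl | hI
      · exact (maximalIdeal_sq_lt_of_ringKrullDim_ne_zero hd0).not_ge hle
      · have := hI.1.1
        have e : I = maximalIdeal R := le_antisymm (le_maximalIdeal this.ne_top) hle
        rw [e] at hI
        apply hd0
        rw [← maximalIdeal_height_eq_ringKrullDim, Ideal.height_eq_zero_iff.2 hI]
        rfl
    obtain ⟨hx2, hxq⟩ := hx
    -- Since `x ∉ 𝔪²`, it can replace one of the generators.
    obtain ⟨y, hys, hy⟩ : ∃ y ∈ s, y ∈ Ideal.span (insert x (s.erase y : Set R)) := by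
      rw [← hs, Submodule.mem_span_finset] at hxm
      obtain ⟨a, -, ha⟩ := hxm
      obtain ⟨y, hy, hau⟩ : ∃ y ∈ s, IsUnit (a y) := by
        by_contra hcon
        push Not at hcon
        apply hx2
        rw [← ha, pow_two]
        refine Ideal.sum_mem _ fun y hy => Ideal.mul_mem_mul (hcon y hy) ?_
        rw [← hs]; exact Ideal.subset_span hy
      refine ⟨y, hy, ?_⟩
      obtain ⟨v, hv⟩ := hau.exists_left_inv
      rw [← Finset.add_sum_erase s _ hy] at ha
      have e : y = v * (x - ∑ z ∈ s.erase y, a z • z) := by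
        rw [← ha, add_sub_cancel_right, smul_eq_mul, ← mul_assoc, hv, one_mul]
      rw [e]
      refine Ideal.mul_mem_left _ _ (Ideal.sub_mem _ (Ideal.subset_span (Or.inl rfl)) ?_)
      refine Ideal.sum_mem _ fun z hz => Ideal.mul_mem_left _ _ (Ideal.subset_span (Or.inr ?_))
      rwa [← e]
    have hne : Ideal.span {x} ≠ ⊤ := fun h =>
      (maximalIdeal.isMaximal R).ne_top (top_le_iff.1 (h ▸ (Ideal.span_singleton_le_iff_mem _).2 hxm))
    have : Nontrivial (R ⧸ Ideal.span {x}) := Ideal.Quotient.nontrivial_iff.2 hne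
    have := IsLocalRing.of_surjective' (Ideal.Quotient.mk (Ideal.span {x}))
      Ideal.Quotient.mk_surjective
    have hmax := map_maximalIdeal_of_surjective (Ideal.Quotient.mk (Ideal.span {x}))
      Ideal.Quotient.mk_surjective
    have hspan : Ideal.span (((s.erase y).image (Ideal.Quotient.mk (Ideal.span {x})) :
        Finset (R ⧸ Ideal.span {x})) : Set (R ⧸ Ideal.span {x})) =
        maximalIdeal (R ⧸ Ideal.span {x}) := by
      rw [Finset.coe_image, ← Ideal.map_span, ← hmax]
      apply le_antisymm
      · apply Ideal.map_mono
        rw [← hs]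
        exact Ideal.span_mono (Finset.coe_subset.2 (Finset.erase_subset _ _))
      · rw [← hs, Ideal.map_le_iff_le_comap, Ideal.span_le]
        have key : Ideal.span (insert x (s.erase y : Set R)) ≤ Ideal.comap
            (Ideal.Quotient.mk (Ideal.span {x}))
            ((Ideal.span (s.erase y : Set R)).map (Ideal.Quotient.mk (Ideal.span {x}))) := by
          rw [Ideal.span_le]
          rintro z (rfl | hz)
          · rw [SetLike.mem_coe, Ideal.mem_comap,
              Ideal.Quotient.eq_zero_iff_mem.2 (Ideal.mem_span_singleton_self _)]
            exact zero_mem _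
          · exact Ideal.mem_map_of_mem _ (Ideal.subset_span hz)
        intro z hz
        by_cases hzy : z = y
        · subst hzy; exact key hy
        · exact key (Ideal.subset_span (Or.inr (by simp [hzy, Finset.mem_coe.1 hz])))
    have hcard : ((s.erase y).image (Ideal.Quotient.mk (Ideal.span {x}))).card ≤ n := by
      refine Finset.card_image_le.trans ?_
      rw [Finset.card_erase_of_mem hys]; omega
    have hdim : (n : WithBot ℕ∞) ≤ ringKrullDim (R ⧸ Ideal.span {x}) := by
      have h := ringKrullDim_le_ringKrullDim_quotient_add_card (R := R) {x} (by
        rw [IsLocalRing.ringJacobson_eq_maximalIdeal]; simpa using hxm)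
      have h2 := hd.trans h
      rw [Finset.card_singleton, Finset.coe_singleton, Nat.cast_add, Nat.cast_one] at h2
      exact ENat.WithBot.add_le_add_one_right_iff.1 h2
    have hdom := ih _ _ hspan hcard hdim
    have hprime : (Ideal.span {x}).IsPrime := (Ideal.Quotient.isDomain_iff_prime _).1 hdom
    obtain ⟨q, hq, hqx⟩ := Ideal.exists_minimalPrimes_le (I := (⊥ : Ideal R)) (J := Ideal.span {x})
      bot_le
    have hqp : q.IsPrime := hq.1.1
    have hbot : q = ⊥ := by
      refine Submodule.eq_bot_of_le_smul_of_le_jacobson_bot (maximalIdeal R) q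
        (IsNoetherian.noetherian _) ?_ (maximalIdeal_le_jacobson _)
      intro z hz
      obtain ⟨w, rfl⟩ := Ideal.mem_span_singleton.1 (hqx hz)
      exact Submodule.smul_mem_smul hxm ((hqp.mem_or_mem hz).resolve_left (hxq q hq))
    rw [hbot] at hqp
    exact (IsDomain.of_bot_isPrime R)

/-- Kaplansky's criterion for a local domain with a prime element `b` such that `R/(b)` is a
principal ideal domain: a prime ideal `P` not containing `b` is principal, because its image in
`R/(b)` is, and `P ∩ (b) = bP`. -/
theorem uniqueFactorizationMonoid_of_quotient_isPrincipalIdealRing (R : Type u) [CommRing R]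
    [IsDomain R] [IsLocalRing R] [IsNoetherianRing R] {b : R} (hb : b ∈ maximalIdeal R)
    (hb0 : b ≠ 0) [IsDomain (R ⧸ Ideal.span {b})] [IsPrincipalIdealRing (R ⧸ Ideal.span {b})] :
    UniqueFactorizationMonoid R := by
  refine UniqueFactorizationMonoid.iff_exists_prime_mem_of_isPrime.2 fun P hP hPp => ?_
  by_cases hbP : b ∈ P
  · exact ⟨b, hbP, (Ideal.span_singleton_prime hb0).1
      ((Ideal.Quotient.isDomain_iff_prime _).1 inferInstance)⟩
  obtain ⟨π', hπ'⟩ := (IsPrincipalIdealRing.principal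
    (P.map (Ideal.Quotient.mk (Ideal.span {b})))).principal
  have hmem : π' ∈ P.map (Ideal.Quotient.mk (Ideal.span {b})) := by
    rw [hπ']; exact Submodule.mem_span_singleton_self _
  obtain ⟨p, hp, rfl⟩ := (Ideal.mem_map_iff_of_surjective _ Ideal.Quotient.mk_surjective).1 hmem
  have hle : P ≤ Ideal.span {p} := by
    refine Submodule.le_of_le_smul_of_le_jacobson_bot (I := maximalIdeal R)
      (IsNoetherian.noetherian _) (maximalIdeal_le_jacobson _) ?_
    intro z hz
    have h1 := Ideal.mem_map_of_mem (Ideal.Quotient.mk (Ideal.span {b})) hz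
    rw [hπ'] at h1
    obtain ⟨c, hc⟩ := Submodule.mem_span_singleton.1 h1
    obtain ⟨c, rfl⟩ := Ideal.Quotient.mk_surjective c
    rw [smul_eq_mul, ← map_mul, eq_comm, Ideal.Quotient.eq, Ideal.mem_span_singleton] at hc
    obtain ⟨d, hd⟩ := hc
    have hdP : d ∈ P := by
      refine (hPp.mem_or_mem ?_).resolve_left hbP
      rw [← hd]
      exact Ideal.sub_mem _ hz (Ideal.mul_mem_left _ _ hp)
    rw [show z = c * p + b * d by rw [← hd]; ring]
    exact Submodule.add_mem_sup (Ideal.mul_mem_left _ _ (Ideal.mem_span_singleton_self _))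
      (Submodule.smul_mem_smul hb hdP)
  have e : P = Ideal.span {p} := le_antisymm hle ((Ideal.span_singleton_le_iff_mem _).2 hp)
  refine ⟨p, hp, (Ideal.span_singleton_prime ?_).1 (e ▸ hPp)⟩
  rintro rfl
  exact hP (by simpa using e)

theorem exists_finset_span_eq_maximalIdeal (R : Type u) [CommRing R] [IsRegularLocalRing R] :
    ∃ s : Finset R, Ideal.span (s : Set R) = maximalIdeal R ∧
      (s.card : WithBot ℕ∞) = ringKrullDim R := by
  obtain ⟨s, hs, hspan⟩ := Submodule.FG.exists_span_finset_card_eq_spanFinrank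
    (IsNoetherian.noetherian (maximalIdeal R))
  exact ⟨s, hspan, by rw [hs, IsRegularLocalRing.spanFinrank_maximalIdeal]⟩

theorem isDomain_of_isRegularLocalRing (R : Type u) [CommRing R] [IsRegularLocalRing R] :
    IsDomain R := by
  obtain ⟨s, hs, hcard⟩ := exists_finset_span_eq_maximalIdeal R
  exact isDomain_of_span_eq_maximalIdeal s.card R s hs le_rfl hcard.le

/-- A regular local ring of dimension at most two is factorial. -/
theorem uniqueFactorizationMonoid_of_isRegularLocalRing (R : Type u) [CommRing R]
    [IsDomain R] [IsRegularLocalRing R] (h : ringKrullDim R ≤ 2) :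
    UniqueFactorizationMonoid R := by
  classical
  obtain ⟨s, hs, hcard⟩ := exists_finset_span_eq_maximalIdeal R
  have hle : s.card ≤ 2 := by
    rw [← hcard] at h; exact_mod_cast h
  rcases s.eq_empty_or_nonempty with rfl | ⟨b, hbs⟩
  · have : IsField R := isField_iff_maximalIdeal_eq.2 (by rw [← hs]; simp)
    let _ := this.toField
    infer_instance
  have hb : b ∈ maximalIdeal R := by rw [← hs]; exact Ideal.subset_span hbs
  have hne : Ideal.span {b} ≠ ⊤ := fun h =>
    (maximalIdeal.isMaximal R).ne_top (top_le_iff.1 (h ▸ (Ideal.span_singleton_le_iff_mem _).2 hb))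
  have : Nontrivial (R ⧸ Ideal.span {b}) := Ideal.Quotient.nontrivial_iff.2 hne
  have := IsLocalRing.of_surjective' (Ideal.Quotient.mk (Ideal.span {b}))
    Ideal.Quotient.mk_surjective
  have hmax := map_maximalIdeal_of_surjective (Ideal.Quotient.mk (Ideal.span {b}))
    Ideal.Quotient.mk_surjective
  have hspan : Ideal.span (((s.erase b).image (Ideal.Quotient.mk (Ideal.span {b})) :
      Finset (R ⧸ Ideal.span {b})) : Set (R ⧸ Ideal.span {b})) =
      maximalIdeal (R ⧸ Ideal.span {b}) := by
    have h0 : Ideal.Quotient.mk (Ideal.span {b}) b = 0 :=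
      Ideal.Quotient.eq_zero_iff_mem.2 (Ideal.mem_span_singleton_self _)
    rw [← hmax, ← hs, Ideal.map_span]
    conv_rhs => rw [← Finset.insert_erase hbs]
    rw [Finset.coe_insert, Set.image_insert_eq, h0, Ideal.span_insert_zero, Finset.coe_image]
  have hcard1 : ((s.erase b).image (Ideal.Quotient.mk (Ideal.span {b}))).card ≤ s.card - 1 := by
    refine Finset.card_image_le.trans ?_
    rw [Finset.card_erase_of_mem hbs]
  have hdim : ((s.card - 1 : ℕ) : WithBot ℕ∞) ≤ ringKrullDim (R ⧸ Ideal.span {b}) := by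
    have h := ringKrullDim_le_ringKrullDim_quotient_add_card (R := R) {b} (by
      rw [IsLocalRing.ringJacobson_eq_maximalIdeal]; simpa using hb)
    have h2 := hcard.le.trans h
    rw [Finset.card_singleton, Finset.coe_singleton,
      ← Nat.sub_add_cancel (Finset.card_pos.2 ⟨b, hbs⟩), Nat.cast_add] at h2
    exact ENat.WithBot.add_le_add_one_right_iff.1 (by exact_mod_cast h2)
  have := isDomain_of_span_eq_maximalIdeal _ _ _ hspan hcard1 hdim
  have hprinc : (maximalIdeal (R ⧸ Ideal.span {b})).IsPrincipal := by
    rw [← hspan]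
    have h1 : ((s.erase b).image (Ideal.Quotient.mk (Ideal.span {b}))).card ≤ 1 := by omega
    obtain ⟨x, hx⟩ := Finset.card_le_one_iff_subset_singleton.1 h1
    rcases Finset.subset_singleton_iff.1 hx with h | h
    · rw [h]; simpa using bot_isPrincipal
    · rw [h]; exact ⟨x, by simp⟩
  have : IsPrincipalIdealRing (R ⧸ Ideal.span {b}) :=
    ((tfae_of_isNoetherianRing_of_isLocalRing_of_isDomain (R ⧸ Ideal.span {b})).out 0 4).2 hprinc
  refine uniqueFactorizationMonoid_of_quotient_isPrincipalIdealRing R hb ?_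
  rintro rfl
  -- A generator `0` would be superfluous, so the dimension would be too small.
  have h1 : ringKrullDim (R ⧸ Ideal.span {(0 : R)}) ≤ _ := ringKrullDim_le_spanFinrank_maximalIdeal _
  have e : ringKrullDim R ≤ ringKrullDim (R ⧸ Ideal.span {(0 : R)}) := by
    rw [Ideal.span_singleton_eq_bot.2 rfl]
    exact (ringKrullDim_eq_of_ringEquiv (RingEquiv.quotientBot R)).ge
  rw [← hspan] at h1
  have h3 := Submodule.spanFinrank_span_le_ncard_of_finite (R := R ⧸ Ideal.span {(0 : R)})
    (Finset.finite_toSet ((s.erase 0).image (Ideal.Quotient.mk (Ideal.span {(0 : R)}))))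
  rw [Set.ncard_coe_finset] at h3
  have h4 : (s.card : WithBot ℕ∞) ≤ ((s.card - 1 : ℕ) : WithBot ℕ∞) :=
    (hcard.le.trans e).trans (h1.trans (by exact_mod_cast h3.trans hcard1))
  rw [Nat.cast_le] at h4
  have := Finset.card_pos.2 ⟨_, hbs⟩
  omega

end RegularLocal

/-! ### Krull dimension and transcendence degree -/

section Dimension

variable (F : Type u) [Field F]

/-- A non-injective surjection of domains lowers the transcendence degree: an element of the kernel
is transcendental over lifts of an algebraically independent family. -/
theorem trdeg_add_one_le_of_surjective {A B : Type u} [CommRing A] [IsDomain A] [Algebra F A]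
    [CommRing B] [IsDomain B] [Algebra F B] (φ : A →ₐ[F] B) (hs : Function.Surjective φ)
    (hi : ¬ Function.Injective φ) : Algebra.trdeg F B + 1 ≤ Algebra.trdeg F A := by
  obtain ⟨ι, x, hx⟩ := exists_isTranscendenceBasis' F B
  obtain ⟨y, hy⟩ : ∃ y : ι → A, ∀ i, φ (y i) = x i := ⟨fun i => (hs (x i)).choose,
    fun i => (hs (x i)).choose_spec⟩
  have hyx : φ ∘ y = x := funext hy
  have hyi : AlgebraicIndependent F y := AlgebraicIndependent.of_comp φ (hyx ▸ hx.1)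
  obtain ⟨a, ha, ha0⟩ : ∃ a, φ a = 0 ∧ a ≠ 0 := by
    rw [injective_iff_map_eq_zero] at hi
    push Not at hi
    exact hi
  have htr : Transcendental (Algebra.adjoin F (Set.range y)) a := by
    rintro ⟨p, hp, hpa⟩
    obtain ⟨q, hq, hqd⟩ := Polynomial.exists_eq_pow_rootMultiplicity_mul_and_not_dvd p hp 0
    rw [hq, map_mul, map_pow, Polynomial.C_0, sub_zero, Polynomial.aeval_X] at hpa
    have hqa := (mul_eq_zero.1 hpa).resolve_left (pow_ne_zero _ ha0)
    rw [Polynomial.C_0, sub_zero, Polynomial.X_dvd_iff] at hqd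
    apply hqd
    rw [← Polynomial.divX_mul_X_add q, map_add, map_mul, Polynomial.aeval_X,
      Polynomial.aeval_C] at hqa
    have h0 : φ (algebraMap (Algebra.adjoin F (Set.range y)) A (q.coeff 0)) = 0 := by
      have := congrArg φ hqa
      rwa [map_add, map_mul, ha, mul_zero, zero_add, map_zero] at this
    obtain ⟨g, hg⟩ : ∃ g : MvPolynomial ι F, MvPolynomial.aeval y g = (q.coeff 0 : A) :=
      (Algebra.adjoin_range_eq_range_aeval F y).le (q.coeff 0).2
    have h1 : MvPolynomial.aeval x g = 0 := by
      rw [← hyx]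
      exact (MvPolynomial.comp_aeval_apply y φ g).symm.trans (by rw [hg]; exact h0)
    have hg0 : g = 0 := hx.1.eq_zero_of_aeval_eq_zero g h1
    rw [hg0, map_zero] at hg
    exact Subtype.ext hg.symm
  have := ((hyi.option_iff_transcendental a).2 htr).cardinalMk_le_trdeg
  rwa [Cardinal.mk_option, hx.cardinalMk_eq_trdeg] at this

/-- The Krull dimension of a domain over a field is at most its transcendence degree; no finiteness
assumption is needed. -/
theorem ringKrullDim_le_of_trdeg_le {R : Type u} [CommRing R] [IsDomain R] [Algebra F R] (n : ℕ)
    (h : Algebra.trdeg F R ≤ n) : ringKrullDim R ≤ n := by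
  have hle : ∀ p : PrimeSpectrum R, Algebra.trdeg F (R ⧸ p.asIdeal) ≤ n := fun p =>
    (trdeg_le_of_surjective (Ideal.Quotient.mkₐ F p.asIdeal)
      (Ideal.Quotient.mkₐ_surjective F _)).trans h
  have hcast : ∀ p : PrimeSpectrum R,
      ((Cardinal.toNat (Algebra.trdeg F (R ⧸ p.asIdeal)) : ℕ) : Cardinal) =
        Algebra.trdeg F (R ⧸ p.asIdeal) := fun p =>
    Cardinal.cast_toNat_of_lt_aleph0 ((hle p).trans_lt (Cardinal.natCast_lt_aleph0))
  have hlt : ∀ p q : PrimeSpectrum R, p < q →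
      Cardinal.toNat (Algebra.trdeg F (R ⧸ q.asIdeal)) <
        Cardinal.toNat (Algebra.trdeg F (R ⧸ p.asIdeal)) := by
    intro p q hpq
    have hpq' : p.asIdeal < q.asIdeal := hpq
    have := trdeg_add_one_le_of_surjective F (Ideal.Quotient.factorₐ F hpq'.le)
      (Ideal.Quotient.factor_surjective hpq'.le) (by
        intro hinj
        apply hpq'.not_ge
        intro x hx
        rw [← Ideal.Quotient.eq_zero_iff_mem]
        apply hinj
        rw [map_zero]
        exact Ideal.Quotient.eq_zero_iff_mem.2 hx)
    rw [← hcast p, ← hcast q] at this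
    exact_mod_cast this
  let f : PrimeSpectrum R → (Fin (n + 1))ᵒᵈ := fun p => OrderDual.toDual
    ⟨Cardinal.toNat (Algebra.trdeg F (R ⧸ p.asIdeal)), by
      have := hle p
      rw [← hcast p] at this
      exact Nat.lt_succ_of_le (by exact_mod_cast this)⟩
  have hf : StrictMono f := fun p q hpq => hlt p q hpq
  have := Order.krullDim_le_of_strictMono f hf
  refine this.trans (iSup_le fun p => ?_)
  have h := p.length_lt_card
  rw [Fintype.card_orderDual, Fintype.card_fin] at h
  exact_mod_cast Nat.lt_succ_iff.1 h

end Dimension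

/-! ### Monomials on factorial local rings -/

section Core

open Polynomial IsLocalRing

/-- If a fraction `a/b` of non-units without common factor is a root of a polynomial over a local
ring, all coefficients of the polynomial are non-units. -/
theorem coeff_mem_maximalIdeal_of_sum_eq_zero {O : Type u} [CommRing O] [IsDomain O]
    [UniqueFactorizationMonoid O] [IsLocalRing O] {a b : O} (hab : IsRelPrime a b)
    (ha : a ∈ maximalIdeal O) (hb : b ∈ maximalIdeal O) (hb0 : b ≠ 0) (n : ℕ) :
    ∀ g : ℕ → O, ∑ i ∈ Finset.range (n + 1), g i * a ^ i * b ^ (n - i) = 0 →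
      ∀ i ≤ n, g i ∈ maximalIdeal O := by
  induction n with
  | zero =>
    intro g hg i hi
    obtain rfl : i = 0 := by omega
    have : g 0 = 0 := by simpa using hg
    rw [this]; exact zero_mem _
  | succ n ih =>
    intro g hg
    have e1 : ∀ h : ℕ → O, ∑ i ∈ Finset.range (n + 1), h i * a ^ i * b ^ (n + 1 - i) =
        b * ∑ i ∈ Finset.range (n + 1), h i * a ^ i * b ^ (n - i) := by
      intro h
      rw [Finset.mul_sum]
      refine Finset.sum_congr rfl fun i hi => ?_
      rw [Nat.succ_sub (Nat.lt_succ_iff.1 (Finset.mem_range.1 hi)), pow_succ]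
      ring
    rw [Finset.sum_range_succ, e1, Nat.sub_self, pow_zero, mul_one] at hg
    have hdvd : b ∣ a ^ (n + 1) * g (n + 1) :=
      ⟨-∑ i ∈ Finset.range (n + 1), g i * a ^ i * b ^ (n - i), by linear_combination hg⟩
    obtain ⟨c, hc⟩ := (IsRelPrime.pow_right hab.symm).dvd_of_dvd_mul_left hdvd
    -- The leading coefficient `bc` is absorbed into the next one.
    have h2 := ih (fun i => g i + if i = n then c * a else 0) (by
      apply mul_left_cancel₀ hb0
      have e2 : ∀ i, (g i + if i = n then c * a else 0) * a ^ i * b ^ (n - i) =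
          g i * a ^ i * b ^ (n - i) + if i = n then c * a * a ^ n else 0 := by
        intro i
        split_ifs with h
        · subst h; simp; ring
        · simp
      simp only [e2]
      rw [Finset.sum_add_distrib, Finset.sum_ite_eq' (Finset.range (n + 1)) n, mul_zero, ← hg, hc]
      simp only [Finset.mem_range, Nat.lt_succ_self, if_true]
      ring)
    intro i hi
    rcases Nat.lt_or_ge n i with h | h
    · obtain rfl : i = n + 1 := by omega
      rw [hc]; exact Ideal.mul_mem_right _ _ hb
    · have h3 := h2 i h
      by_cases hin : i = n
      · simp only [hin, if_true] at h3 ⊢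
        have := Ideal.sub_mem _ h3 (Ideal.mul_mem_left _ c ha)
        simpa using this
      · simpa [hin] using h3

/-- The homomorphism `F[X][Y] → O[X]` that sends `Y` to `t`. -/
def bivariateMap (F : Type u) [Field F] {O : Type u} [CommRing O] [Algebra F O] (t : O) :
    F[X][X] →+* O[X] :=
  eval₂RingHom (mapRingHom (algebraMap F O)) (C t)

theorem bivariateMap_X {F : Type u} [Field F] {O : Type u} [CommRing O] [Algebra F O] (t : O) :
    bivariateMap F t X = C t := by
  simp [bivariateMap]

/-- Modulo the maximal ideal only the part of degree zero in `t` survives. -/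
theorem map_residue_bivariateMap {F : Type u} [Field F] {O : Type u} [CommRing O] [IsLocalRing O]
    [Algebra F O] {t : O} (ht : t ∈ maximalIdeal O) (P : F[X][X]) :
    (bivariateMap F t P).map (residue O) =
      (P.coeff 0).map ((residue O).comp (algebraMap F O)) := by
  have h : (mapRingHom (residue O)).comp (bivariateMap F t) =
      (mapRingHom ((residue O).comp (algebraMap F O))).comp constantCoeff := by
    have ht' : residue O t = 0 := (residue_eq_zero_iff t).2 ht
    ext <;> simp [bivariateMap, ht']
  exact congrArg (fun f => f P) h

variable {F O K : Type u} [Field F] [CommRing O] [IsDomain O] [UniqueFactorizationMonoid O]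
  [IsLocalRing O] [Algebra F O] [Field K] [Algebra O K] [IsFractionRing O K]

/-- A polynomial relation over a local ring for a quotient of coprime non-units is trivial modulo
the maximal ideal, so the residue of such a quotient is transcendental. -/
theorem coeff_mem_maximalIdeal_of_aeval_eq_zero {a b : O} (hab : IsRelPrime a b)
    (ha : a ∈ maximalIdeal O) (hb : b ∈ maximalIdeal O) (hb0 : b ≠ 0) {G : O[X]}
    (hG : aeval (algebraMap O K a / algebraMap O K b) G = 0) (i : ℕ) :
    G.coeff i ∈ maximalIdeal O := by
  have hbK : algebraMap O K b ≠ 0 := by simpa using hb0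
  rcases Nat.lt_or_ge G.natDegree i with h | h
  · rw [coeff_eq_zero_of_natDegree_lt h]; exact zero_mem _
  refine coeff_mem_maximalIdeal_of_sum_eq_zero hab ha hb hb0 G.natDegree G.coeff ?_ i h
  apply IsFractionRing.injective O K
  rw [map_zero, map_sum]
  have h2 := congrArg (· * algebraMap O K b ^ G.natDegree) hG
  simp only [zero_mul] at h2
  rw [aeval_eq_sum_range, Finset.sum_mul] at h2
  rw [← h2]
  refine Finset.sum_congr rfl fun j hj => ?_
  have hj' := Nat.lt_succ_iff.1 (Finset.mem_range.1 hj)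
  rw [map_mul, map_mul, map_pow, map_pow, Algebra.smul_def, div_pow]
  rw [← Nat.sub_add_cancel hj', pow_add, Nat.add_sub_cancel]
  field_simp

/-- An element of the maximal ideal has numerator divisible by `t`, as long as `t` is a non-unit and
neither `y` nor `y⁻¹` lies in the local ring. -/
theorem X_dvd_of_mul_eq {a b t f : O} (hab : IsRelPrime a b)
    (ha : a ∈ maximalIdeal O) (hb : b ∈ maximalIdeal O) (hb0 : b ≠ 0) (ht : t ∈ maximalIdeal O)
    (hf : f ∈ maximalIdeal O) {P Q : F[X][X]}
    (h : aeval (algebraMap O K a / algebraMap O K b) (bivariateMap F t P) * algebraMap O K f =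
      aeval (algebraMap O K a / algebraMap O K b) (bivariateMap F t Q)) : X ∣ Q := by
  have h0 : aeval (algebraMap O K a / algebraMap O K b)
      (bivariateMap F t P * C f - bivariateMap F t Q) = 0 := by
    rw [map_sub, map_mul, aeval_C, h, sub_self]
  have h1 := coeff_mem_maximalIdeal_of_aeval_eq_zero hab ha hb hb0 h0
  have h2 : (bivariateMap F t P * C f - bivariateMap F t Q).map (residue O) = 0 := by
    ext i
    rw [coeff_map, coeff_zero]
    exact (residue_eq_zero_iff _).2 (h1 i)
  rw [Polynomial.map_sub, Polynomial.map_mul, map_C, (residue_eq_zero_iff f).2 hf, C_0, mul_zero,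
    zero_sub, neg_eq_zero, map_residue_bivariateMap ht] at h2
  rw [X_dvd_iff]
  exact (Polynomial.map_eq_zero _).1 h2

/-- Let `O` be a factorial local ring whose fraction field is generated by `y` and `t`,
algebraically independent over the field `F ⊆ O`. If `t` is a non-unit of `O` and `tᴺ y`, `tᴺ y⁻¹`
lie in `O`, then `O` contains `y` or `y⁻¹`. Otherwise every non-unit would be a multiple of `t` for
the `t`-adic valuation of `F(y)(t)`, whereas `t` is itself a product of two non-units: it is
divisible by a prime factor of the numerator and by one of the denominator of `y`. -/
theorem mem_or_inv_mem_of_factorial {t : O} {y : K}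
    (hinj : Function.Injective fun P : F[X][X] => aeval y (bivariateMap F t P))
    (hfrac : ∀ f : O, ∃ P Q : F[X][X], P ≠ 0 ∧
      aeval y (bivariateMap F t P) * algebraMap O K f = aeval y (bivariateMap F t Q))
    (ht : t ∈ maximalIdeal O) {N : ℕ} (hy : ∃ c : O, algebraMap O K c = algebraMap O K t ^ N * y)
    (hy' : ∃ c : O, algebraMap O K c = algebraMap O K t ^ N * y⁻¹) :
    (∃ c : O, algebraMap O K c = y) ∨ ∃ c : O, algebraMap O K c = y⁻¹ := by
  obtain ⟨a, ⟨b, hb⟩, hab, rfl⟩ := IsFractionRing.exists_reduced_fraction (A := O) y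
  have hb0 : b ≠ 0 := nonZeroDivisors.ne_zero hb
  have hbK : algebraMap O K b ≠ 0 := by simpa using hb0
  rw [IsFractionRing.mk'_eq_div] at *
  simp only at *
  by_cases hbu : IsUnit b
  · obtain ⟨v, hv⟩ := hbu.exists_right_inv
    refine Or.inl ⟨a * v, ?_⟩
    rw [eq_div_iff hbK, ← map_mul, mul_assoc, mul_comm v, hv, mul_one]
  by_cases hau : IsUnit a
  · obtain ⟨v, hv⟩ := hau.exists_right_inv
    have haK : algebraMap O K a ≠ 0 := by simpa using hau.ne_zero
    refine Or.inr ⟨b * v, ?_⟩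
    rw [inv_div, eq_div_iff haK, ← map_mul, mul_assoc, mul_comm v, hv, mul_one]
  exfalso
  have hbm : b ∈ maximalIdeal O := hbu
  have ham : a ∈ maximalIdeal O := hau
  have ht0 : t ≠ 0 := by
    rintro rfl
    have := @hinj X 0 (by simp [bivariateMap_X])
    exact X_ne_zero this
  have htK : algebraMap O K t ≠ 0 := by simpa using ht0
  have ha0 : a ≠ 0 := by
    rintro rfl
    have := @hinj (C X) 0 (by simp [bivariateMap])
    simp at this
  have haK : algebraMap O K a ≠ 0 := by simpa using ha0
  obtain ⟨p, hp, hpa⟩ := WfDvdMonoid.exists_irreducible_factor hau ha0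
  obtain ⟨q, hq, hqb⟩ := WfDvdMonoid.exists_irreducible_factor hbu hb0
  have hpp := UniqueFactorizationMonoid.irreducible_iff_prime.1 hp
  have hqp := UniqueFactorizationMonoid.irreducible_iff_prime.1 hq
  have hbt : b ∣ t ^ N := by
    obtain ⟨c, hc⟩ := hy
    refine hab.symm.dvd_of_dvd_mul_right ⟨c, IsFractionRing.injective O K ?_⟩
    rw [map_mul, map_mul, hc, map_pow]
    field_simp
  have hat : a ∣ t ^ N := by
    obtain ⟨c, hc⟩ := hy'
    refine hab.dvd_of_dvd_mul_right ⟨c, IsFractionRing.injective O K ?_⟩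
    rw [map_mul, map_mul, hc, map_pow, inv_div]
    field_simp
  obtain ⟨t', rfl⟩ := hpp.dvd_of_dvd_pow (hpa.trans hat)
  have hqt : q ∣ t' := (hqp.dvd_or_dvd (hqp.dvd_of_dvd_pow (hqb.trans hbt))).resolve_left fun h =>
    hq.not_isUnit (hab (h.trans hpa) hqb)
  -- Each non-unit `f` has the form `t Q / P` with `t ∤ P`: cancel common powers of `t`, which
  -- always divides the numerator.
  have hmem : ∀ f ∈ maximalIdeal O, ∃ P Q : F[X][X], ¬ X ∣ P ∧
      aeval (algebraMap O K a / algebraMap O K b) (bivariateMap F (p * t') P) * algebraMap O K f =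
        algebraMap O K (p * t') *
          aeval (algebraMap O K a / algebraMap O K b) (bivariateMap F (p * t') Q) := by
    intro f hf
    obtain ⟨P, Q, hP, h⟩ := hfrac f
    obtain ⟨P', hP', hPd⟩ := Polynomial.exists_eq_pow_rootMultiplicity_mul_and_not_dvd P hP 0
    rw [C_0, sub_zero] at hP' hPd
    generalize rootMultiplicity 0 P = n at hP'
    induction n generalizing P Q with
    | zero =>
      obtain ⟨Q', rfl⟩ := X_dvd_of_mul_eq hab ham hbm hb0 ht hf h
      rw [pow_zero, one_mul] at hP'
      subst hP'
      exact ⟨P, Q', hPd, by rw [h, map_mul, map_mul, bivariateMap_X, aeval_C]⟩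
    | succ n ih =>
      obtain ⟨Q', rfl⟩ := X_dvd_of_mul_eq hab ham hbm hb0 ht hf h
      have hP0 : X ^ n * P' ≠ 0 := by
        rintro e
        rw [pow_succ', mul_assoc, e, mul_zero] at hP'
        exact hP hP'
      refine ih (X ^ n * P') Q' hP0 ?_ rfl
      apply mul_left_cancel₀ htK
      rw [hP', pow_succ', mul_assoc, map_mul _ X, map_mul _ X, bivariateMap_X, map_mul (aeval _) (C _),
        map_mul (aeval _) (C _), aeval_C] at h
      linear_combination h
  -- Applied to both factors of `t = p t'`, this makes `t` divide `P₁ P₂`.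
  obtain ⟨P₁, Q₁, hP₁, h₁⟩ := hmem p hp.not_isUnit
  obtain ⟨P₂, Q₂, hP₂, h₂⟩ := hmem t' fun h => hq.not_isUnit (isUnit_of_dvd_unit hqt h)
  have key : P₁ * P₂ = X * (Q₁ * Q₂) := by
    apply hinj
    apply mul_left_cancel₀ htK
    simp only [map_mul, bivariateMap_X, aeval_C] at h₁ h₂ ⊢
    linear_combination (algebraMap O K t') * (aeval (algebraMap O K a / algebraMap O K b)
      (bivariateMap F (p * t') P₂)) * h₁ + (algebraMap O K p * algebraMap O K t') *
      aeval (algebraMap O K a / algebraMap O K b) (bivariateMap F (p * t') Q₁) * h₂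
  rcases Polynomial.prime_X.dvd_or_dvd ⟨_, key⟩ with h | h
  exacts [hP₁ h, hP₂ h]

end Core

/-! ### Linear forms, planar cones and rays -/

section Pairing

/-- The integral pairing of `M` and `N`. -/
def intPairing (u v : Lattice) : ℤ := u 0 * v 0 + u 1 * v 1

theorem pairing_toPlane (u v : Lattice) : pairing u (toPlane v) = (intPairing u v : ℝ) := by
  simp [pairing, toPlane, intPairing]

theorem mem_dualMonoid_latticeCone {S : Set Lattice} {u : Lattice} :
    u ∈ dualMonoid (latticeCone S) ↔ ∀ a ∈ S, 0 ≤ intPairing u a := by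
  constructor
  · intro h a ha
    have := h _ (toPlane_mem_latticeCone ha)
    rw [pairing_toPlane] at this
    exact_mod_cast this
  · intro h
    refine pairing_nonneg rfl fun a ha => ?_
    rw [pairing_toPlane]
    exact_mod_cast h a ha

/-- The primitive linear form `det(r, ·)` vanishing on the ray through `r`. -/
def normal (r : Lattice) : Lattice := ![-r 1, r 0]

theorem intPairing_normal (r v : Lattice) : intPairing (normal r) v = det r v := by
  simp [intPairing, normal, det]; ring

theorem intPairing_neg (u v : Lattice) : intPairing (-u) v = -intPairing u v := by
  simp [intPairing]; ring

theorem intPairing_add (u u' v : Lattice) :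
    intPairing (u + u') v = intPairing u v + intPairing u' v := by
  simp [intPairing]; ring

theorem intPairing_zsmul (c : ℤ) (u v : Lattice) : intPairing (c • u) v = c * intPairing u v := by
  simp [intPairing]; ring

theorem normal_neg (r : Lattice) : normal (-r) = -normal r := by
  funext i; fin_cases i <;> simp [normal]

/-- The coordinates of a linear form in the basis dual to a positively oriented lattice basis. -/
theorem eq_normal_combination {a b : Lattice} (h : det a b = 1) (u : Lattice) :
    u = intPairing u b • normal a + intPairing u a • (-normal b) := by
  funext i
  fin_cases i <;> simp [intPairing, normal] <;> simp only [det] at h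
  · linear_combination (-u 0) * h
  · linear_combination (-u 1) * h

theorem mem_latticeCone_pair_of_det_nonneg {a b : Lattice} (h : 0 < det a b) {x : Plane}
    (h1 : 0 ≤ (a 0 : ℝ) * x 1 - a 1 * x 0) (h2 : 0 ≤ x 0 * (b 1 : ℝ) - x 1 * b 0) :
    x ∈ latticeCone {a, b} := by
  have hd : (0 : ℝ) < (a 0 : ℝ) * b 1 - a 1 * b 0 := by exact_mod_cast h
  refine mem_latticeCone_pair.2 ⟨(x 0 * b 1 - x 1 * b 0) / (a 0 * b 1 - a 1 * b 0),
    (a 0 * x 1 - a 1 * x 0) / (a 0 * b 1 - a 1 * b 0), by positivity, by positivity, ?_⟩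
  funext i
  fin_cases i <;>
    simp only [toPlane, Pi.add_apply, Pi.smul_apply, smul_eq_mul, Fin.zero_eta, Fin.mk_one] <;>
    rw [div_mul_eq_mul_div, div_mul_eq_mul_div, ← add_div, div_eq_iff hd.ne'] <;> ring

theorem toPlane_mem_latticeCone_pair {a b r : Lattice} (h : 0 < det a b) :
    toPlane r ∈ latticeCone {a, b} ↔ 0 ≤ det a r ∧ 0 ≤ det r b := by
  constructor
  · intro hr
    obtain ⟨s, t, hs, ht, e⟩ := mem_latticeCone_pair.1 hr
    have e0 := congrFun e 0
    have e1 := congrFun e 1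
    simp only [toPlane, Pi.add_apply, Pi.smul_apply, smul_eq_mul] at e0 e1
    have hd : (0 : ℝ) < (a 0 : ℝ) * b 1 - a 1 * b 0 := by exact_mod_cast h
    constructor
    · have : (0 : ℝ) ≤ (a 0 : ℝ) * r 1 - a 1 * r 0 := by
        rw [← e0, ← e1]
        have := mul_nonneg ht hd.le
        linarith
      exact_mod_cast this
    · have : (0 : ℝ) ≤ (r 0 : ℝ) * b 1 - r 1 * b 0 := by
        rw [← e0, ← e1]
        have := mul_nonneg hs hd.le
        linarith
      exact_mod_cast this
  · rintro ⟨h1, h2⟩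
    refine mem_latticeCone_pair_of_det_nonneg h ?_ ?_
    · simp only [toPlane]; exact_mod_cast h1
    · simp only [toPlane]; exact_mod_cast h2

theorem toPlane_injective : Function.Injective toPlane := by
  intro v w h
  funext i
  have : (v i : ℝ) = w i := congrFun h i
  exact_mod_cast this

/-- Primitive vectors generating the same ray are equal. -/
theorem eq_of_latticeCone_singleton_eq {v w : Lattice} (hv : IsCoprime (v 0) (v 1))
    (hw : IsCoprime (w 0) (w 1)) (h : latticeCone {v} = latticeCone {w}) : v = w := by
  obtain ⟨s, hs, e⟩ := mem_latticeCone_singleton.1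
    (h ▸ toPlane_mem_latticeCone rfl : toPlane v ∈ latticeCone {w})
  obtain ⟨t, ht, e'⟩ := mem_latticeCone_singleton.1
    (h.symm ▸ toPlane_mem_latticeCone rfl : toPlane w ∈ latticeCone {v})
  have key : ∀ (s : ℝ) (v w : Lattice), IsCoprime (w 0) (w 1) → s • toPlane w = toPlane v →
      ∃ n : ℤ, s = n := by
    rintro s v w ⟨p, q, hpq⟩ e
    have e0 := congrFun e 0
    have e1 := congrFun e 1
    simp only [toPlane, Pi.smul_apply, smul_eq_mul] at e0 e1
    have hpq' : (p : ℝ) * w 0 + q * w 1 = 1 := by exact_mod_cast hpq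
    exact ⟨p * v 0 + q * v 1, by push_cast; rw [← e0, ← e1]; linear_combination (-s) * hpq'⟩
  obtain ⟨n, rfl⟩ := key s v w hw e
  obtain ⟨n', rfl⟩ := key t w v hv e'
  have hv0 : toPlane v ≠ 0 := by
    intro h0
    have h1 : v = 0 := toPlane_injective (by rw [h0]; funext i; simp [toPlane])
    rw [h1] at hv
    exact not_isCoprime_zero_zero hv
  have h1 : ((n : ℝ) * n') • toPlane v = (1 : ℝ) • toPlane v := by
    rw [mul_smul, e', e, one_smul]
  have h2 : (n : ℝ) * n' = 1 := smul_left_injective ℝ hv0 h1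
  have h3 : n * n' = 1 := by exact_mod_cast h2
  have hn : 0 ≤ n := by exact_mod_cast hs
  have hn1 : n = 1 := by
    rcases Int.eq_one_or_neg_one_of_mul_eq_one h3 with h | h <;> omega
  rw [hn1, Int.cast_one, one_smul] at e
  exact toPlane_injective e.symm

/-- The rays of a planar fan with primitive ray generators. -/
theorem planarFan_rays {R : Finset Lattice} (hR : ∀ r ∈ R, IsCoprime (r 0) (r 1)) :
    (planarFan R).rays = R := by
  ext v
  constructor
  · rintro ⟨hv, h⟩
    have hv0 : v ≠ 0 := by rintro rfl; exact not_isCoprime_zero_zero hv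
    rcases h with h | ⟨a, ha, h⟩ | ⟨a, b, hab, h⟩
    · exfalso
      have h1 : toPlane v ∈ latticeCone ∅ := h ▸ toPlane_mem_latticeCone rfl
      rw [mem_latticeCone_empty] at h1
      exact hv0 (toPlane_injective (by rw [h1]; funext i; simp [toPlane]))
    · rw [eq_of_latticeCone_singleton_eq hv (hR a ha) h]; exact ha
    · exfalso
      obtain ⟨s, hs, e⟩ := mem_latticeCone_singleton.1
        (h.symm ▸ toPlane_mem_latticeCone (by simp) : toPlane a ∈ latticeCone {v})
      obtain ⟨t, ht, e'⟩ := mem_latticeCone_singleton.1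
        (h.symm ▸ toPlane_mem_latticeCone (by simp) : toPlane b ∈ latticeCone {v})
      have h0 : t • toPlane a + (0 : ℝ) • toPlane b = (0 : ℝ) • toPlane a + s • toPlane b := by
        rw [← e, ← e', zero_smul, zero_smul, add_zero, zero_add, smul_smul, smul_smul, mul_comm]
      obtain ⟨h1, h2⟩ := latticeCone_pair_eq hab.2.2.1 h0
      have h3 : (1 : ℝ) • toPlane a + (0 : ℝ) • toPlane b =
          (0 : ℝ) • toPlane a + (0 : ℝ) • toPlane b := by
        rw [← e, ← h2]; simp
      exact one_ne_zero (latticeCone_pair_eq hab.2.2.1 h3).1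
  · intro hv
    exact ⟨hR v hv, Or.inr (Or.inl ⟨v, hv, rfl⟩)⟩

end Pairing

/-! ### The cyclic order of the rays of the refined fan -/

section Cycle

/-- A discrete intermediate value principle. -/
theorem exists_consecutive {P Q : ℕ → Prop} {a b : ℕ} (hab : a < b)
    (h : ∀ i, a < i → i < b → P i ∨ Q i) (ha : P a) (hb : Q b) :
    ∃ i, a ≤ i ∧ i < b ∧ P i ∧ Q (i + 1) := by
  induction b, hab using Nat.le_induction with
  | base => exact ⟨a, le_rfl, Nat.lt_succ_self a, ha, hb⟩
  | succ b hab ih =>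
    rcases h b hab (Nat.lt_succ_self b) with hP | hQ
    · exact ⟨b, by omega, Nat.lt_succ_self b, hP, hb⟩
    · obtain ⟨i, h1, h2, h3⟩ := ih (fun i h1 h2 => h i h1 (by omega)) hQ
      exact ⟨i, h1, by omega, h3⟩

/-- The ray generators of the fan in counterclockwise order: `v_0, …, v_m`, then `(-1, -(k+1))`,
`-e₂`, `e₁`, and `v_0 = e₂` again. -/
def rayCycle (m k i : ℕ) : Lattice :=
  if i ≤ m then rayV k i else if i = m + 1 then ![-1, -((k : ℤ) + 1)]
  else if i = m + 2 then ![0, -1] else if i = m + 3 then ![1, 0] else ![0, 1]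

variable {m k : ℕ}

theorem rayCycle_of_le {i : ℕ} (h : i ≤ m) :
    rayCycle m k i = ![-(i : ℤ), -((i : ℤ) * k + i - 1)] := by
  simp [rayCycle, h, rayV]

theorem rayCycle_zero : rayCycle m k 0 = ![0, 1] := by simp [rayCycle_of_le (Nat.zero_le m)]

theorem rayCycle_add_one : rayCycle m k (m + 1) = ![-1, -((k : ℤ) + 1)] := by simp [rayCycle]

theorem rayCycle_add_two : rayCycle m k (m + 2) = ![0, -1] := by simp [rayCycle]

theorem rayCycle_add_three : rayCycle m k (m + 3) = ![1, 0] := by simp [rayCycle]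

theorem rayCycle_add_four : rayCycle m k (m + 4) = ![0, 1] := by simp [rayCycle]

theorem index_cases {i : ℕ} (h : i ≤ m + 3) :
    i ≤ m ∨ i = m + 1 ∨ i = m + 2 ∨ i = m + 3 := by omega

theorem mem_desingularizationRays {r : Lattice} :
    r ∈ desingularizationRays m k ↔ ∃ i ≤ m + 3, r = rayCycle m k i := by
  simp only [desingularizationRays, Finset.mem_union, Finset.mem_insert, Finset.mem_singleton,
    Finset.mem_image, Finset.mem_range]
  constructor
  · rintro ((rfl | rfl | rfl) | ⟨j, hj, rfl⟩)
    · exact ⟨m + 3, le_rfl, rayCycle_add_three.symm⟩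
    · exact ⟨m + 2, by omega, rayCycle_add_two.symm⟩
    · exact ⟨m + 1, by omega, rayCycle_add_one.symm⟩
    · exact ⟨j, by omega, by rw [rayCycle_of_le (by omega)]; rfl⟩
  · rintro ⟨i, hi, rfl⟩
    rcases index_cases hi with h | rfl | rfl | rfl
    · exact Or.inr ⟨i, by omega, by rw [rayCycle_of_le h]; rfl⟩
    · exact Or.inl (Or.inr (Or.inr rayCycle_add_one))
    · exact Or.inl (Or.inr (Or.inl rayCycle_add_two))
    · exact Or.inl (Or.inl rayCycle_add_three)

theorem rayCycle_mem {i : ℕ} (h : i ≤ m + 4) : rayCycle m k i ∈ desingularizationRays m k := by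
  rcases h.eq_or_lt with rfl | h
  · exact mem_desingularizationRays.2 ⟨0, by omega, by rw [rayCycle_add_four, rayCycle_zero]⟩
  · exact mem_desingularizationRays.2 ⟨i, by omega, rfl⟩

/-- Consecutive ray generators form a positively oriented basis of the lattice. -/
theorem det_rayCycle_succ {i : ℕ} (h : i ≤ m + 3) :
    det (rayCycle m k i) (rayCycle m k (i + 1)) = 1 := by
  rcases index_cases h with h | rfl | rfl | rfl
  · rcases h.eq_or_lt with rfl | h
    · rw [rayCycle_of_le le_rfl, rayCycle_add_one]
      simp [det]; ring
    · rw [rayCycle_of_le h.le, rayCycle_of_le h]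
      simp [det]; ring
  · rw [rayCycle_add_one, rayCycle_add_two]; simp [det]
  · rw [rayCycle_add_two, rayCycle_add_three]; simp [det]
  · rw [rayCycle_add_three, rayCycle_add_four]; simp [det]

/-- No further ray lies between consecutive ones, so these pairs span cones of the fan. -/
theorem isAdjacent_rayCycle (hm : 2 ≤ m) (hk : 1 ≤ k) {i : ℕ} (h : i ≤ m + 3) :
    IsAdjacent (desingularizationRays m k) (rayCycle m k i) (rayCycle m k (i + 1)) := by
  have hdet := det_rayCycle_succ (k := k) h
  refine ⟨rayCycle_mem (by omega), rayCycle_mem (by omega), by rw [hdet]; exact one_ne_zero, ?_⟩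
  intro r hr hmem
  rw [toPlane_mem_latticeCone_pair (by rw [hdet]; exact one_pos)] at hmem
  obtain ⟨j, hj, rfl⟩ := mem_desingularizationRays.1 hr
  obtain ⟨h1, h2⟩ := hmem
  have hk' : (1 : ℤ) ≤ k := by exact_mod_cast hk
  have hm' : (2 : ℤ) ≤ m := by exact_mod_cast hm
  have hik : (0 : ℤ) ≤ (i : ℤ) * k := by positivity
  have hjk : (0 : ℤ) ≤ (j : ℤ) * k := by positivity
  rcases index_cases h with h | rfl | rfl | rfl
  · rcases h.eq_or_lt with rfl | h
    · rw [rayCycle_of_le le_rfl, rayCycle_add_one] at *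
      rcases index_cases hj with hj | rfl | rfl | rfl
      · left
        rw [rayCycle_of_le hj] at *
        simp [det] at h1
        obtain rfl : j = i := by
          have : (i : ℤ) ≤ j := by linarith
          omega
        rfl
      · right; exact rayCycle_add_one
      · exfalso
        simp [rayCycle_add_two, det] at h2
      · exfalso
        simp [rayCycle_add_three, det] at h2
        linarith
    · rw [rayCycle_of_le h.le, rayCycle_of_le h] at *
      rcases index_cases hj with hj | rfl | rfl | rfl
      · rw [rayCycle_of_le hj] at *
        simp [det] at h1 h2
        have h3 : (i : ℤ) ≤ j := by linarith
        have h4 : (j : ℤ) ≤ i + 1 := by linarith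
        obtain rfl | rfl : j = i ∨ j = i + 1 := by omega
        · left; rfl
        · right; rfl
      · exfalso
        simp [rayCycle_add_one, det] at h2
        linarith
      · exfalso
        simp [rayCycle_add_two, det] at h2
        linarith
      · exfalso
        simp [rayCycle_add_three, det] at h2
        linarith
  · rw [rayCycle_add_one, rayCycle_add_two] at *
    rcases index_cases hj with hj | rfl | rfl | rfl
    · exfalso
      rw [rayCycle_of_le hj] at h1
      simp [det] at h1
      linarith
    · left; exact rayCycle_add_one
    · right; exact rayCycle_add_two
    · exfalso
      simp [rayCycle_add_three, det] at h2
  · rw [rayCycle_add_two, rayCycle_add_three] at *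
    rcases index_cases hj with hj | rfl | rfl | rfl
    · exfalso
      rw [rayCycle_of_le hj] at h1 h2
      simp [det] at h1 h2
      subst h1
      simp at h2
    · exfalso
      simp [rayCycle_add_one, det] at h1
    · left; exact rayCycle_add_two
    · right; exact rayCycle_add_three
  · rw [rayCycle_add_three, rayCycle_add_four] at *
    rcases index_cases hj with hj | rfl | rfl | rfl
    · right
      rw [rayCycle_of_le hj] at *
      simp [det] at h1
      obtain rfl : j = 0 := by
        by_contra hne
        have h3 : (1 : ℤ) ≤ j := by omega
        have h4 : (1 : ℤ) * 1 ≤ (j : ℤ) * k := mul_le_mul h3 hk' (by norm_num) (by linarith)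
        linarith
      simp
    · exfalso
      simp [rayCycle_add_one, det] at h1
      linarith
    · exfalso
      simp [rayCycle_add_two, det] at h1
    · left; exact rayCycle_add_three

theorem isCoprime_of_mem_desingularizationRays {r : Lattice}
    (h : r ∈ desingularizationRays m k) : IsCoprime (r 0) (r 1) := by
  obtain ⟨i, hi, rfl⟩ := mem_desingularizationRays.1 h
  have hdet := det_rayCycle_succ (k := k) hi
  refine ⟨rayCycle m k (i + 1) 1, -rayCycle m k (i + 1) 0, ?_⟩
  rw [← hdet, det]; ring

/-- The selection of a cone by sign conditions on the normals: if `P r` reads "nonnegative on the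
left of `r`" and `Q r` "nonnegative on the right", some pair of consecutive rays satisfies `P` at
its first and `Q` at its second member. -/
theorem exists_rayCycle {P Q : Lattice → Prop} (h : ∀ r, P r ∨ Q r) (hneg : ∀ r, P r → Q (-r))
    (hneg' : ∀ r, Q r → P (-r)) :
    ∃ i ≤ m + 3, P (rayCycle m k i) ∧ Q (rayCycle m k (i + 1)) := by
  have e : (![0, -1] : Lattice) = -![0, 1] := by simp
  -- The opposite ray of `v_0 = e₂` has the opposite sign, so the sign changes on one of the two
  -- half-circles.
  rcases h (rayCycle m k 0) with h0 | h0
  · obtain ⟨i, -, h1, h2⟩ := exists_consecutive (P := fun i => P (rayCycle m k i))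
      (Q := fun i => Q (rayCycle m k i)) (show 0 < m + 2 by omega) (fun i _ _ => h _) h0 (by
        rw [rayCycle_zero] at h0
        rw [rayCycle_add_two, e]
        exact hneg _ h0)
    exact ⟨i, by omega, h2⟩
  · obtain ⟨i, -, h1, h2⟩ := exists_consecutive (P := fun i => P (rayCycle m k i))
      (Q := fun i => Q (rayCycle m k i)) (show m + 2 < m + 4 by omega) (fun i _ _ => h _) (by
        rw [rayCycle_zero] at h0
        rw [rayCycle_add_two, e]
        exact hneg' _ h0) (by
        rw [rayCycle_zero] at h0
        rwa [rayCycle_add_four])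
    exact ⟨i, by omega, h2⟩

/-- The cone of the fan spanned by the `i`-th and the following ray. -/
def cycleCone (m k i : ℕ) : PointedCone ℝ Plane :=
  latticeCone {rayCycle m k i, rayCycle m k (i + 1)}

theorem exists_mem_cycleCone (x : Plane) : ∃ i ≤ m + 3, x ∈ cycleCone m k i := by
  obtain ⟨i, hi, h1, h2⟩ := exists_rayCycle (m := m) (k := k)
    (P := fun r => (0 : ℝ) ≤ (r 0 : ℝ) * x 1 - r 1 * x 0)
    (Q := fun r => (r 0 : ℝ) * x 1 - r 1 * x 0 ≤ 0) (fun r => le_total _ _)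
    (fun r h => by simp only [Pi.neg_apply]; push_cast; linarith)
    (fun r h => by simp only [Pi.neg_apply]; push_cast; linarith)
  exact ⟨i, hi, mem_latticeCone_pair_of_det_nonneg (by rw [det_rayCycle_succ hi]; exact one_pos) h1
    (by linarith)⟩

theorem cycleCone_mem (hm : 2 ≤ m) (hk : 1 ≤ k) {i : ℕ} (h : i ≤ m + 3) :
    cycleCone m k i ∈ (planarFan (desingularizationRays m k)).cones :=
  Or.inr (Or.inr ⟨_, _, isAdjacent_rayCycle hm hk h, rfl⟩)

theorem planarFan_desingularizationRays_isComplete (hm : 2 ≤ m) (hk : 1 ≤ k) :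
    (planarFan (desingularizationRays m k)).IsComplete := fun x =>
  let ⟨_, hi, hx⟩ := exists_mem_cycleCone x
  ⟨_, cycleCone_mem hm hk hi, hx⟩

/-- Every cone of the fan is contained in a cone spanned by consecutive rays. -/
theorem exists_le_cycleCone (hm : 2 ≤ m) (hk : 1 ≤ k) {σ : PointedCone ℝ Plane}
    (hσ : σ ∈ (planarFan (desingularizationRays m k)).cones) :
    ∃ i ≤ m + 3, σ ≤ cycleCone m k i := by
  rcases hσ with rfl | ⟨a, ha, rfl⟩ | ⟨a, b, h, rfl⟩
  · exact ⟨0, by omega, latticeCone_mono (Set.empty_subset _)⟩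
  · obtain ⟨i, hi, rfl⟩ := mem_desingularizationRays.1 ha
    exact ⟨i, hi, latticeCone_mono (by simp)⟩
  · obtain ⟨i, hi, hx⟩ := exists_mem_cycleCone (m := m) (k := k)
      ((1 : ℝ) • toPlane a + (1 : ℝ) • toPlane b)
    have h' := isAdjacent_rayCycle hm hk hi
    obtain ⟨h1, h2⟩ := pair_interior h.1 h'.1 h'.2.1 h.2.2.1 h'.2.2.1 h.2.2.2 h'.2.2.2 one_pos
      one_pos hx
    exact ⟨i, hi, latticeCone_le (by rintro c (rfl | rfl) <;> assumption)⟩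

end Cycle

/-! ### The fan of the weighted projective plane -/

section Weighted

/-- The ray generators of `P(1,m,n)` in counterclockwise order: `e₁`, `e₂`, `u₀`. -/
def weightedRay (m n : ℕ) : Fin 3 → Lattice := ![![1, 0], ![0, 1], ![-(m : ℤ), -(n : ℤ)]]

/-- The two-dimensional cones of the fan of `P(1,m,n)`. -/
def weightedCone (m n : ℕ) (i : Fin 3) : PointedCone ℝ Plane :=
  latticeCone {weightedRay m n i, weightedRay m n (i + 1)}

variable {m n : ℕ}

theorem det_weightedRay_pos (hm : 0 < m) (hn : 0 < n) (i : Fin 3) :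
    0 < det (weightedRay m n i) (weightedRay m n (i + 1)) := by
  fin_cases i <;> simp [det, weightedRay, hm, hn]

theorem isAdjacent_weightedRay (hm : 0 < m) (hn : 0 < n) (i : Fin 3) :
    IsAdjacent {![-(m : ℤ), -(n : ℤ)], ![1, 0], ![0, 1]} (weightedRay m n i)
      (weightedRay m n (i + 1)) := by
  refine ⟨by fin_cases i <;> simp [weightedRay], by fin_cases i <;> simp [weightedRay],
    (det_weightedRay_pos hm hn i).ne', fun r hr hmem => ?_⟩
  rw [toPlane_mem_latticeCone_pair (det_weightedRay_pos hm hn i)] at hmem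
  obtain ⟨h1, h2⟩ := hmem
  simp only [Finset.mem_insert, Finset.mem_singleton] at hr
  have hm' : (0 : ℤ) < m := by exact_mod_cast hm
  have hn' : (0 : ℤ) < n := by exact_mod_cast hn
  fin_cases i <;> rcases hr with rfl | rfl | rfl <;> simp [weightedRay, det] at h1 h2 ⊢ <;> omega

theorem weightedCone_mem (hm : 0 < m) (hn : 0 < n) (i : Fin 3) :
    weightedCone m n i ∈ (weightedProjectivePlaneFan m n).cones :=
  Or.inr (Or.inr ⟨_, _, isAdjacent_weightedRay hm hn i, rfl⟩)

theorem exists_le_weightedCone {σ : PointedCone ℝ Plane}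
    (hσ : σ ∈ (weightedProjectivePlaneFan m n).cones) : ∃ i, σ ≤ weightedCone m n i := by
  have hR : ∀ r ∈ ({![-(m : ℤ), -(n : ℤ)], ![1, 0], ![0, 1]} : Finset Lattice),
      ∃ i, r = weightedRay m n i := by
    intro r hr
    simp only [Finset.mem_insert, Finset.mem_singleton] at hr
    rcases hr with rfl | rfl | rfl
    exacts [⟨2, rfl⟩, ⟨0, rfl⟩, ⟨1, rfl⟩]
  rcases hσ with rfl | ⟨a, ha, rfl⟩ | ⟨a, b, h, rfl⟩
  · exact ⟨0, latticeCone_mono (Set.empty_subset _)⟩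
  · obtain ⟨i, rfl⟩ := hR a ha
    exact ⟨i, latticeCone_mono (by simp)⟩
  · obtain ⟨i, rfl⟩ := hR a h.1
    obtain ⟨j, rfl⟩ := hR b h.2.1
    have hij : i ≠ j := by
      rintro rfl
      exact h.2.2.1 (by simp [det, mul_comm])
    have hd : ∀ i j : Fin 3, i ≠ j → j = i + 1 ∨ i = j + 1 := by decide
    obtain rfl | rfl := hd i j hij
    · exact ⟨i, le_rfl⟩
    · exact ⟨j, by rw [Set.pair_comm]; exact le_rfl⟩

end Weighted

/-! ### Position of the refined fan in the fan of the weighted projective plane -/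

section Refinement

variable {m k : ℕ}

theorem rayCycle_self (hm : 0 < m) :
    rayCycle m k m = ![-(m : ℤ), -((m * k + m - 1 : ℕ) : ℤ)] := by
  rw [rayCycle_of_le le_rfl, Nat.cast_sub (by nlinarith [Nat.zero_le (m * k)])]
  push_cast
  rfl

/-- The position of the `i`-th cone of the fan inside the fan of `P(1,m,n)`. -/
theorem cycleCone_le_weightedCone (hm : 2 ≤ m) (hk : 1 ≤ k) (i : ℕ) :
    (i < m → cycleCone m k i ≤ weightedCone m (m * k + m - 1) 1) ∧
    (m ≤ i → i < m + 3 → cycleCone m k i ≤ weightedCone m (m * k + m - 1) 2) ∧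
    (i = m + 3 → cycleCone m k i ≤ weightedCone m (m * k + m - 1) 0) := by
  have hk' : (1 : ℤ) ≤ k := by exact_mod_cast hk
  have hm' : (2 : ℤ) ≤ m := by exact_mod_cast hm
  have hmk : (1 : ℤ) * 1 ≤ (m : ℤ) * k := mul_le_mul (by linarith) hk' (by norm_num) (by linarith)
  have hn : 0 < m * k + m - 1 := by
    have : 0 ≤ m * k := Nat.zero_le _
    omega
  have e0 : weightedRay m (m * k + m - 1) 0 = ![1, 0] := rfl
  have e1 : weightedRay m (m * k + m - 1) 1 = ![0, 1] := rfl
  have e2 : weightedRay m (m * k + m - 1) 2 = ![-(m : ℤ), -((m : ℤ) * k + m - 1)] := by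
    rw [← rayCycle_of_le (k := k) le_rfl, rayCycle_self (by omega)]; rfl
  have key : ∀ (l : Fin 3), (0 ≤ det (weightedRay m (m * k + m - 1) l) (rayCycle m k i) ∧
      0 ≤ det (rayCycle m k i) (weightedRay m (m * k + m - 1) (l + 1))) →
      (0 ≤ det (weightedRay m (m * k + m - 1) l) (rayCycle m k (i + 1)) ∧
      0 ≤ det (rayCycle m k (i + 1)) (weightedRay m (m * k + m - 1) (l + 1))) →
      cycleCone m k i ≤ weightedCone m (m * k + m - 1) l := by
    intro l h1 h2
    have hd := det_weightedRay_pos (m := m) (n := m * k + m - 1) (by omega) hn l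
    refine latticeCone_le ?_
    rintro c (rfl | rfl)
    exacts [(toPlane_mem_latticeCone_pair hd).2 h1, (toPlane_mem_latticeCone_pair hd).2 h2]
  refine ⟨fun h => key 1 ?_ ?_, fun h h' => key 2 ?_ ?_, fun h => key 0 ?_ ?_⟩
  · rw [show (1 : Fin 3) + 1 = 2 from rfl, e1, e2, rayCycle_of_le h.le]
    have : (i : ℤ) < m := by exact_mod_cast h
    constructor <;> simp [det]
    linarith
  · rw [show (1 : Fin 3) + 1 = 2 from rfl, e1, e2, rayCycle_of_le h]
    have : (i : ℤ) < m := by exact_mod_cast h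
    constructor <;> simp [det] <;> linarith
  · rw [show (2 : Fin 3) + 1 = 0 from rfl, e0, e2]
    obtain rfl | rfl | rfl : i = m ∨ i = m + 1 ∨ i = m + 2 := by omega
    · rw [rayCycle_of_le le_rfl]
      constructor <;> simp [det] <;> linarith
    · rw [rayCycle_add_one]
      constructor <;> simp [det] <;> linarith
    · rw [rayCycle_add_two]
      constructor <;> simp [det]
  · rw [show (2 : Fin 3) + 1 = 0 from rfl, e0, e2]
    obtain rfl | rfl | rfl : i = m ∨ i = m + 1 ∨ i = m + 2 := by omega
    · rw [rayCycle_add_one]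
      constructor <;> simp [det] <;> linarith
    · rw [rayCycle_add_two]
      constructor <;> simp [det]
    · rw [rayCycle_add_three]
      constructor <;> simp [det]; linarith
  · subst h
    rw [show (0 : Fin 3) + 1 = 1 from rfl, e0, e1, rayCycle_add_three]
    constructor <;> simp [det]
  · subst h
    rw [show (0 : Fin 3) + 1 = 1 from rfl, e0, e1, rayCycle_add_four]
    constructor <;> simp [det]

theorem exists_cycleCone_le_weightedCone (hm : 2 ≤ m) (hk : 1 ≤ k) {i : ℕ} (hi : i ≤ m + 3) :
    ∃ l, cycleCone m k i ≤ weightedCone m (m * k + m - 1) l := by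
  obtain ⟨h1, h2, h3⟩ := cycleCone_le_weightedCone hm hk i
  rcases lt_or_ge i m with h | h
  · exact ⟨1, h1 h⟩
  · rcases hi.eq_or_lt with h' | h'
    · exact ⟨0, h3 h'⟩
    · exact ⟨2, h2 h h'⟩

/-- The combinatorial content of minimality. Each two-dimensional cone `σ` of `P(1,m,n)` that is
subdivided carries a linear form, positive on `σ`, with value `1` on every new ray in its interior:
`(-(k+1), 1)` on the cone of `e₂` and `u₀`, and `(k, -1)` on the cone of `u₀` and `e₁`. If a set `X`
of linear forms contains `σ^∨` and one of `±u` whenever `u` is normal to a ray on which a positive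
form takes the value `1`, then `X` contains the generators of `τ^∨` for some cone `τ ⊆ σ` of the
refined fan. -/
theorem exists_cycleCone_of_weightedCone (hm : 2 ≤ m) (hk : 1 ≤ k) (l : Fin 3)
    (X : Lattice → Prop) (hX : ∀ u ∈ dualMonoid (weightedCone m (m * k + m - 1) l), X u)
    (hXr : ∀ s r : Lattice, 0 < intPairing s (weightedRay m (m * k + m - 1) l) →
      0 < intPairing s (weightedRay m (m * k + m - 1) (l + 1)) → intPairing s r = 1 →
      X (normal r) ∨ X (-normal r)) :
    ∃ i ≤ m + 3, cycleCone m k i ≤ weightedCone m (m * k + m - 1) l ∧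
      X (normal (rayCycle m k i)) ∧ X (-normal (rayCycle m k (i + 1))) := by
  have hk' : (1 : ℤ) ≤ k := by exact_mod_cast hk
  have hm' : (2 : ℤ) ≤ m := by exact_mod_cast hm
  have hn : 0 < m * k + m - 1 := by
    have : 0 ≤ m * k := Nat.zero_le _
    omega
  have hpos := det_weightedRay_pos (m := m) (n := m * k + m - 1) (by omega) hn l
  have e0 : weightedRay m (m * k + m - 1) 0 = ![1, 0] := rfl
  have e1 : weightedRay m (m * k + m - 1) 1 = ![0, 1] := rfl
  have e2' : weightedRay m (m * k + m - 1) 2 = rayCycle m k m := by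
    rw [rayCycle_self (by omega)]; rfl
  have e2 : weightedRay m (m * k + m - 1) 2 = ![-(m : ℤ), -((m : ℤ) * k + m - 1)] := by
    rw [← rayCycle_of_le (k := k) le_rfl, e2']
  have hleft : X (normal (weightedRay m (m * k + m - 1) l)) := by
    refine hX _ (mem_dualMonoid_latticeCone.2 ?_)
    rintro c (rfl | rfl) <;> rw [intPairing_normal]
    · simp [det, mul_comm]
    · exact hpos.le
  have hright : X (-normal (weightedRay m (m * k + m - 1) (l + 1))) := by
    refine hX _ (mem_dualMonoid_latticeCone.2 ?_)
    rintro c (rfl | rfl) <;> rw [intPairing_neg, intPairing_normal]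
    · rw [det_swap, neg_neg]; exact hpos.le
    · simp [det, mul_comm]
  fin_cases l
  · refine ⟨m + 3, le_rfl, (cycleCone_le_weightedCone hm hk _).2.2 rfl, ?_, ?_⟩
    · rw [rayCycle_add_three]; exact hleft
    · rw [rayCycle_add_four]; exact hright
  · obtain ⟨i, -, h2, h3, h4⟩ := exists_consecutive (P := fun i => X (normal (rayCycle m k i)))
      (Q := fun i => X (-normal (rayCycle m k i))) (show 0 < m by omega) (fun i h0 h1 => by
        refine hXr ![-((k : ℤ) + 1), 1] _ ?_ ?_ ?_
        · change 0 < intPairing _ (weightedRay m (m * k + m - 1) 1)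
          rw [e1]; simp [intPairing]
        · change 0 < intPairing _ (weightedRay m (m * k + m - 1) 2)
          rw [e2]; simp [intPairing]; linarith
        · rw [rayCycle_of_le h1.le]; simp [intPairing]; ring) (by
        rw [rayCycle_zero]; exact hleft) (by rw [← e2']; exact hright)
    exact ⟨i, by omega, (cycleCone_le_weightedCone hm hk i).1 h2, h3, h4⟩
  · obtain ⟨i, h1, h2, h3, h4⟩ := exists_consecutive (P := fun i => X (normal (rayCycle m k i)))
      (Q := fun i => X (-normal (rayCycle m k i))) (show m < m + 3 by omega) (fun i h0 h1 => by
        refine hXr ![k, -1] _ ?_ ?_ ?_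
        · change 0 < intPairing _ (weightedRay m (m * k + m - 1) 2)
          rw [e2]; simp [intPairing]; linarith
        · change 0 < intPairing _ (weightedRay m (m * k + m - 1) 0)
          rw [e0]; simp [intPairing]; linarith
        · obtain rfl | rfl : i = m + 1 ∨ i = m + 2 := by omega
          · rw [rayCycle_add_one]; simp [intPairing]
          · rw [rayCycle_add_two]; simp [intPairing]) (by
        rw [← e2']; exact hleft) (by rw [rayCycle_add_three]; exact hright)
    exact ⟨i, by omega, (cycleCone_le_weightedCone hm hk i).2.1 h1 h2, h3, h4⟩

end Refinement

/-! ### Separation of rational planar cones -/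

section Separation

/-- The integral form of Farkas' lemma in the plane. If `v` is not in the cone of `S`, then either
all of `S` lies on one side of the line of `v`, and a large multiple of the normal of that line
corrects `-v`; or the normal of the element of `S` closest to `v` on one side separates. -/
theorem exists_intPairing_neg_of_notMem {S : Set Lattice} (hS : S.Finite) {v : Lattice}
    (hv : toPlane v ∉ latticeCone S) :
    ∃ u : Lattice, (∀ s ∈ S, 0 ≤ intPairing u s) ∧ intPairing u v < 0 := by
  have hv0 : v ≠ 0 := by
    rintro rfl
    apply hv
    have : toPlane 0 = 0 := by funext i; simp [toPlane]
    rw [this]; exact zero_mem _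
  have hvv : 0 < intPairing v v := by
    have : v 0 ≠ 0 ∨ v 1 ≠ 0 := by
      by_contra! h
      exact hv0 (by funext i; fin_cases i; exacts [h.1, h.2])
    simp only [intPairing]
    rcases this with h | h
    · linarith [mul_self_pos.2 h, mul_self_nonneg (v 1)]
    · linarith [mul_self_pos.2 h, mul_self_nonneg (v 0)]
  -- an element on the line of `v` lies on its negative side
  have hline : ∀ s ∈ S, det v s = 0 → intPairing v s ≤ 0 := by
    intro s hs h
    by_contra! hc
    apply hv
    have e : toPlane v = ((intPairing v v : ℝ) / intPairing v s) • toPlane s := by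
      have hc' : (intPairing v s : ℝ) ≠ 0 := by exact_mod_cast hc.ne'
      have e0 : intPairing v s * v 0 = intPairing v v * s 0 := by
        simp only [intPairing, det] at h ⊢; linear_combination v 1 * h
      have e1 : intPairing v s * v 1 = intPairing v v * s 1 := by
        simp only [intPairing, det] at h ⊢; linear_combination (-v 0) * h
      have e0' : (intPairing v s : ℝ) * v 0 = intPairing v v * s 0 := by exact_mod_cast e0
      have e1' : (intPairing v s : ℝ) * v 1 = intPairing v v * s 1 := by exact_mod_cast e1
      funext i
      fin_cases i
      · simp only [toPlane, Pi.smul_apply, smul_eq_mul, Fin.zero_eta]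
        field_simp; linarith
      · simp only [toPlane, Pi.smul_apply, smul_eq_mul, Fin.mk_one]
        field_simp; linarith
    rw [e]
    have : (0 : ℝ) ≤ (intPairing v v : ℝ) / intPairing v s := by
      have h1 : (0 : ℝ) < intPairing v v := by exact_mod_cast hvv
      have h2 : (0 : ℝ) < intPairing v s := by exact_mod_cast hc
      positivity
    exact (latticeCone S).smul_mem this (toPlane_mem_latticeCone hs)
  -- the case in which all of `S` lies on one side of the line of `v`
  have oneside : ∀ ε : ℤ, ε * ε = 1 → (∀ s ∈ S, 0 ≤ ε * det v s) →
      ∃ u : Lattice, (∀ s ∈ S, 0 ≤ intPairing u s) ∧ intPairing u v < 0 := by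
    intro ε hε h
    obtain ⟨B, hB⟩ := (hS.image (fun s => |intPairing v s|)).bddAbove
    refine ⟨(|B| * ε) • normal v + -v, fun s hs => ?_, ?_⟩
    · rw [intPairing_add, intPairing_zsmul, intPairing_normal, intPairing_neg]
      rcases (h s hs).eq_or_lt with h0 | h0
      · have : det v s = 0 := by
          rcases mul_eq_zero.1 h0.symm with rfl | h
          · norm_num at hε
          · exact h
        have h1 := hline s hs this
        rw [this]; linarith
      · have h1 := (le_abs_self _).trans ((hB ⟨s, hs, rfl⟩ : |intPairing v s| ≤ B).trans (le_abs_self B))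
        have h2 : (1 : ℤ) ≤ ε * det v s := h0
        have h3 := mul_le_mul_of_nonneg_left h2 (abs_nonneg B)
        rw [mul_assoc]; linarith
    · rw [intPairing_add, intPairing_zsmul, intPairing_normal, intPairing_neg]
      have : det v v = 0 := by simp only [det]; ring
      rw [this]; linarith
  by_cases hp : ∃ s ∈ S, 0 < det v s
  swap
  · push Not at hp
    exact oneside (-1) (by norm_num) fun s hs => by linarith [hp s hs]
  by_cases hn : ∃ s ∈ S, det v s < 0
  swap
  · push Not at hn
    exact oneside 1 (by norm_num) fun s hs => by linarith [hn s hs]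
  -- the element closest to `v` on the positive side
  obtain ⟨p, ⟨hpS, hp0⟩, hpmax⟩ := Set.exists_max_image {s ∈ S | 0 < det v s}
    (fun s => (intPairing v s : ℚ) / det v s) (hS.subset (Set.sep_subset _ _)) hp
  refine ⟨normal p, fun s hs => ?_, ?_⟩
  · rw [intPairing_normal]
    have key : intPairing v v * det p s = intPairing v p * det v s - intPairing v s * det v p := by
      simp only [intPairing, det]; ring
    rcases lt_trichotomy (det v s) 0 with h | h | h
    · by_contra! hc
      apply hv
      have e0 : det p s * v 0 = det v s * p 0 - det v p * s 0 := by simp only [det]; ring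
      have e1 : det p s * v 1 = det v s * p 1 - det v p * s 1 := by simp only [det]; ring
      have e0' : (det p s : ℝ) * v 0 = det v s * p 0 - det v p * s 0 := by exact_mod_cast e0
      have e1' : (det p s : ℝ) * v 1 = det v s * p 1 - det v p * s 1 := by exact_mod_cast e1
      have hc' : (det p s : ℝ) < 0 := by exact_mod_cast hc
      have h' : (det v s : ℝ) < 0 := by exact_mod_cast h
      have hp0' : (0 : ℝ) < det v p := by exact_mod_cast hp0
      have e : toPlane v = ((det v s : ℝ) / det p s) • toPlane p +
          ((det v p : ℝ) / -det p s) • toPlane s := by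
        have hne := hc'.ne
        funext i
        fin_cases i
        · simp only [toPlane, Pi.add_apply, Pi.smul_apply, smul_eq_mul, Fin.zero_eta]
          field_simp; linarith
        · simp only [toPlane, Pi.add_apply, Pi.smul_apply, smul_eq_mul, Fin.mk_one]
          field_simp; linarith
      rw [e]
      exact add_mem
        ((latticeCone S).smul_mem (div_nonneg_of_nonpos h'.le hc'.le) (toPlane_mem_latticeCone hpS))
        ((latticeCone S).smul_mem (div_nonneg hp0'.le (by linarith)) (toPlane_mem_latticeCone hs))
    · have h1 := hline s hs h
      rw [h] at key
      nlinarith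
    · have h1 := hpmax s ⟨hs, h⟩
      have h' : (0 : ℚ) < det v s := by exact_mod_cast h
      have hp0' : (0 : ℚ) < det v p := by exact_mod_cast hp0
      have h1' : (intPairing v s : ℚ) / det v s ≤ (intPairing v p : ℚ) / det v p := h1
      rw [div_le_div_iff₀ h' hp0'] at h1'
      have h2 : intPairing v s * det v p ≤ intPairing v p * det v s := by exact_mod_cast h1'
      nlinarith
  · rw [intPairing_normal, det_swap]; linarith

/-- Two rational cones meeting in a face of the first are separated by a form that cuts out this
face. -/
theorem exists_separating_form {σ τ : PointedCone ℝ Plane}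
    (hσ : ∃ S : Set Lattice, S.Finite ∧ σ = latticeCone S)
    (hτ : ∃ S : Set Lattice, S.Finite ∧ τ = latticeCone S) (hface : IsFace (σ ⊓ τ) σ) :
    ∃ u ∈ dualMonoid σ, -u ∈ dualMonoid τ ∧ ∀ x, x ∈ σ ⊓ τ ↔ x ∈ σ ∧ pairing u x = 0 := by
  obtain ⟨S, hS, rfl⟩ := hσ
  obtain ⟨T, hT, rfl⟩ := hτ
  obtain ⟨w, hw, hwf⟩ := hface
  have hsep : ∀ a ∈ S, ∃ u ∈ dualMonoid (latticeCone S), -u ∈ dualMonoid (latticeCone T) ∧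
      (pairing u (toPlane a) = 0 → toPlane a ∈ latticeCone T) := by
    intro a ha
    -- If `-a ∈ σ - τ`, then `a + x ∈ σ ∩ τ` for some `x ∈ σ`, and `a` lies in the face `σ ∩ τ`.
    by_cases h : toPlane (-a) ∈ latticeCone (S ∪ Neg.neg '' T)
    · refine ⟨0, zero_mem _, by simp, fun _ => ?_⟩
      have hle : latticeCone (S ∪ Neg.neg '' T) ≤ latticeCone S ⊔ latticeCone (Neg.neg '' T) :=
        latticeCone_le fun c hc => hc.elim
          (fun hc => Submodule.mem_sup_left (toPlane_mem_latticeCone hc))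
          (fun hc => Submodule.mem_sup_right (toPlane_mem_latticeCone hc))
      obtain ⟨x, hx, y, hy, e⟩ := Submodule.mem_sup.1 (hle h)
      have hy' : -y ∈ latticeCone T := by
        refine Submodule.span_induction (p := fun y _ => -y ∈ latticeCone T) ?_ ?_ ?_ ?_ hy
        · rintro _ ⟨_, ⟨t, ht, rfl⟩, rfl⟩
          have : -toPlane (-t) = toPlane t := by funext i; simp [toPlane]
          rw [this]; exact toPlane_mem_latticeCone ht
        · rw [neg_zero]; exact zero_mem _
        · intro x y _ _ h1 h2
          rw [neg_add]; exact add_mem h1 h2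
        · intro c x _ h
          rw [← smul_neg]; exact Submodule.smul_mem _ _ h
      have ha' : toPlane a ∈ latticeCone S := toPlane_mem_latticeCone ha
      have e' : toPlane a + x = -y := by
        have : toPlane (-a) = -toPlane a := by funext i; simp [toPlane]
        rw [this] at e
        rw [eq_neg_iff_add_eq_zero, add_assoc, e, add_neg_cancel]
      have h0 := ((hwf (-y)).1 ⟨by rw [← e']; exact add_mem ha' hx, hy'⟩).2
      rw [← e', pairing_add] at h0
      have h1 := hw _ ha'
      have h2 := hw _ hx
      exact ((hwf _).2 ⟨ha', by linarith⟩).2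
    · obtain ⟨u, hu, hua⟩ := exists_intPairing_neg_of_notMem (hS.union (hT.image _)) h
      refine ⟨u, mem_dualMonoid_latticeCone.2 fun s hs => hu s (Or.inl hs),
        mem_dualMonoid_latticeCone.2 fun t ht => ?_, fun h0 => ?_⟩
      · have := hu (-t) (Or.inr ⟨t, ht, rfl⟩)
        simp only [intPairing, Pi.neg_apply] at this ⊢
        linarith
      · exfalso
        rw [pairing_toPlane] at h0
        have h0' : intPairing u a = 0 := by exact_mod_cast h0
        simp only [intPairing, Pi.neg_apply] at hua h0'
        linarith
  choose! φ hφσ hφτ hφ using hsep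
  let u : Lattice := ∑ a ∈ hS.toFinset, φ a
  have hsum : ∀ x, pairing u x = ∑ a ∈ hS.toFinset, pairing (φ a) x := fun x =>
    map_sum (⟨⟨fun v => pairing v x, pairing_zero_left x⟩, fun v w => pairing_add_left v w x⟩ :
      Lattice →+ ℝ) φ _
  have huσ : u ∈ dualMonoid (latticeCone S) := sum_mem fun a ha => hφσ a (hS.mem_toFinset.1 ha)
  have huτ : -u ∈ dualMonoid (latticeCone T) := by
    rw [← Finset.sum_neg_distrib]
    exact sum_mem fun a ha => hφτ a (hS.mem_toFinset.1 ha)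
  have hneg : ∀ x, pairing (-u) x = -pairing u x := fun x => by
    have := pairing_add_left u (-u) x
    rw [add_neg_cancel, pairing_zero_left] at this
    linarith
  refine ⟨u, huσ, huτ, fun x => ⟨fun ⟨h1, h2⟩ => ⟨h1, ?_⟩, fun ⟨h1, h2⟩ => ⟨h1, ?_⟩⟩⟩
  · have i1 := huσ x h1
    have i2 := huτ x h2
    rw [hneg] at i2
    linarith
  · refine Submodule.span_induction
      (p := fun x _ => pairing u x = 0 → x ∈ latticeCone T) ?_ ?_ ?_ ?_ h1 h2
    · rintro _ ⟨a, ha, rfl⟩ h0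
      refine hφ a ha ?_
      rw [hsum, Finset.sum_eq_zero_iff_of_nonneg] at h0
      · exact h0 a (hS.mem_toFinset.2 ha)
      · intro b hb
        exact hφσ b (hS.mem_toFinset.1 hb) _ (toPlane_mem_latticeCone ha)
    · intro _; exact zero_mem _
    · intro x y hx hy h1 h2 h0
      rw [pairing_add] at h0
      have i1 := huσ x hx
      have i2 := huσ y hy
      exact add_mem (h1 (by linarith)) (h2 (by linarith))
    · intro c x hx h h0
      have e : c • x = (c : ℝ) • x := rfl
      rw [e, pairing_smul] at h0
      rcases mul_eq_zero.1 h0 with h0 | h0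
      · rw [e, h0, zero_smul]; exact zero_mem _
      · exact Submodule.smul_mem _ _ (h h0)

end Separation

/-! ### Charts of toric surfaces and separatedness -/

section Separated

variable (F : Type u) [Field F]

theorem coneAlgebraMap_single {τ σ : PointedCone ℝ Plane} (h : τ ≤ σ) (v : dualMonoid σ) (c : F) :
    coneAlgebraMap F h (AddMonoidAlgebra.single v c) =
      AddMonoidAlgebra.single (AddSubmonoid.inclusion (dualMonoid_anti h) v) c :=
  AddMonoidAlgebra.mapDomain_single

open TensorProduct in
/-- For two cones of a fan, `F[S_σ]` and `F[S_τ]` generate `F[S_{σ ∩ τ}]`: a form in the dual of the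
face becomes nonnegative on `σ` after adding a multiple of a separating form. This is what makes
toric surfaces separated. -/
theorem lift_coneAlgebraMap_surjective {σ τ : PointedCone ℝ Plane}
    (hσ : ∃ S : Set Lattice, S.Finite ∧ σ = latticeCone S)
    (hτ : ∃ S : Set Lattice, S.Finite ∧ τ = latticeCone S) (hface : IsFace (σ ⊓ τ) σ) :
    Function.Surjective (Algebra.TensorProduct.lift
      (coneAlgebraMap F (inf_le_left : σ ⊓ τ ≤ σ)) (coneAlgebraMap F (inf_le_right : σ ⊓ τ ≤ τ))
      (fun _ _ => .all _ _)) := by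
  obtain ⟨u, hu, hu', hf⟩ := exists_separating_form hσ hτ hface
  intro z
  induction z using AddMonoidAlgebra.induction_linear with
  | zero => exact ⟨0, map_zero _⟩
  | add f g hf hg =>
    obtain ⟨a, rfl⟩ := hf
    obtain ⟨b, rfl⟩ := hg
    exact ⟨a + b, map_add _ _ _⟩
  | single w c =>
    obtain ⟨n, hn⟩ := exists_nsmul_add_mem hσ hu hf w.2
    refine ⟨AddMonoidAlgebra.single ⟨_, hn n le_rfl⟩ c ⊗ₜ
      AddMonoidAlgebra.single ⟨n • (-u), nsmul_mem hu' n⟩ 1, ?_⟩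
    rw [Algebra.TensorProduct.lift_tmul, coneAlgebraMap_single, coneAlgebraMap_single,
      AddMonoidAlgebra.single_mul_single, mul_one]
    congr 1
    ext1
    simp

variable (Δ : Fan)

instance (σ : Δ.Index) : IsOpenImmersion (toricChart F Δ σ) :=
  inferInstanceAs (IsOpenImmersion (colimit.ι (toricDiagram F Δ) σ))

theorem affineToricMap_toricChart {τ σ : Δ.Index} (h : τ.1 ≤ σ.1) :
    affineToricMap F h ≫ toricChart F Δ σ = toricChart F Δ τ :=
  colimit.w (toricDiagram F Δ) (homOfLE h)

theorem toricChart_toSpec (σ : Δ.Index) :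
    toricChart F Δ σ ≫ toricSurfaceToSpec F Δ = affineToricToSpec F σ.1 :=
  colimit.ι_desc _ _

/-- The open cover of `X(Δ)` by the charts. -/
def toricCover : (toricSurface F Δ).OpenCover :=
  Scheme.IsLocallyDirected.openCover (toricDiagram F Δ)

theorem toricSurface_exists (x : toricSurface F Δ) :
    ∃ (σ : Δ.Index) (y : affineToric F σ.1), toricChart F Δ σ y = x :=
  Scheme.IsLocallyDirected.ι_jointly_surjective (toricDiagram F Δ) x

/-- The common face of two cones of a fan. -/
def Fan.inter (σ τ : Δ.Index) : Δ.Index := ⟨σ.1 ⊓ τ.1, Δ.inter_mem σ.2 τ.2⟩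

theorem mem_range_toricChart_inter {σ τ : Δ.Index} {x : toricSurface F Δ}
    (h : x ∈ Set.range (toricChart F Δ σ)) (h' : x ∈ Set.range (toricChart F Δ τ)) :
    x ∈ Set.range (toricChart F Δ (Δ.inter σ τ)) := by
  obtain ⟨y, rfl⟩ := h
  obtain ⟨z, hz⟩ := h'
  obtain ⟨ρ, fi, fj, w, hw, -⟩ :=
    (Scheme.IsLocallyDirected.ι_eq_ι_iff (toricDiagram F Δ)).1 hz.symm
  have hρ : ρ.1 ≤ (Δ.inter σ τ).1 := le_inf (leOfHom fi) (leOfHom fj)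
  refine ⟨affineToricMap F hρ w, ?_⟩
  have e1 : toricChart F Δ ρ w = toricChart F Δ (Δ.inter σ τ) (affineToricMap F hρ w) := by
    rw [← affineToricMap_toricChart F Δ hρ]; rfl
  have hw' : affineToricMap F (show ρ.1 ≤ σ.1 from leOfHom fi) w = y := hw
  rw [← e1, ← hw', ← affineToricMap_toricChart F Δ (show ρ.1 ≤ σ.1 from leOfHom fi)]
  rfl

/-- The charts of `σ` and `τ` intersect in the chart of `σ ∩ τ`. -/
theorem isPullback_toricChart (σ τ : Δ.Index) :
    IsPullback (affineToricMap F (inf_le_left : σ.1 ⊓ τ.1 ≤ σ.1))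
      (affineToricMap F (inf_le_right : σ.1 ⊓ τ.1 ≤ τ.1)) (toricChart F Δ σ) (toricChart F Δ τ) := by
  have h1 := affineToricMap_toricChart F Δ (τ := Δ.inter σ τ) (σ := σ) inf_le_left
  have h2 := affineToricMap_toricChart F Δ (τ := Δ.inter σ τ) (σ := τ) inf_le_right
  have : IsOpenImmersion (affineToricMap F (inf_le_right : σ.1 ⊓ τ.1 ≤ τ.1)) :=
    isOpenImmersion_face F _ (Δ.rational τ.1 τ.2)
      (Δ.isFace_of_le (τ := Δ.inter σ τ) (σ := τ) (inf_le_right : σ.1 ⊓ τ.1 ≤ τ.1))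
  refine IsOpenImmersion.isPullback _ _ _ _ (h2.trans h1.symm) ?_
  ext x
  constructor
  · rintro hx
    obtain ⟨y, hy⟩ := mem_range_toricChart_inter F Δ (σ := σ) (τ := τ)
      (x := toricChart F Δ τ x) hx ⟨x, rfl⟩
    refine ⟨y, (toricChart F Δ τ).isOpenEmbedding.injective ?_⟩
    rw [← hy, ← h2]; rfl
  · rintro ⟨y, rfl⟩
    refine ⟨affineToricMap F (inf_le_left : σ.1 ⊓ τ.1 ≤ σ.1) y, ?_⟩
    rw [← Scheme.Hom.comp_apply, ← Scheme.Hom.comp_apply]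
    exact congrArg (fun g => g.base y) (h1.trans h2.symm)

/-- Over the product of the charts `i` and `j` the diagonal is the intersection of the charts. -/
theorem isPullback_diagonal_of_isPullback {C : Type*} [Category C] {X S U V P D W : C} {f : X ⟶ S}
    {i : U ⟶ X} {j : V ⟶ X} {p : P ⟶ U} {q : P ⟶ V} (h : IsPullback p q i j)
    {d₁ d₂ : D ⟶ X} (hD : IsPullback d₁ d₂ f f) {w₁ : W ⟶ U} {w₂ : W ⟶ V}
    (hW : IsPullback w₁ w₂ (i ≫ f) (j ≫ f)) {d : X ⟶ D} (hd₁ : d ≫ d₁ = 𝟙 X) (hd₂ : d ≫ d₂ = 𝟙 X)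
    {μ : W ⟶ D} (hμ₁ : μ ≫ d₁ = w₁ ≫ i) (hμ₂ : μ ≫ d₂ = w₂ ≫ j)
    {l : P ⟶ W} (hl₁ : l ≫ w₁ = p) (hl₂ : l ≫ w₂ = q) :
    IsPullback (p ≫ i) l d μ := by
  have cond : ∀ s : PullbackCone d μ, s.fst = s.snd ≫ w₁ ≫ i ∧ s.fst = s.snd ≫ w₂ ≫ j := by
    intro s
    have e1 := s.condition =≫ d₁
    have e2 := s.condition =≫ d₂
    rw [Category.assoc, Category.assoc, hd₁, hμ₁, Category.comp_id] at e1
    rw [Category.assoc, Category.assoc, hd₂, hμ₂, Category.comp_id] at e2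
    exact ⟨e1, e2⟩
  refine ⟨⟨?_⟩, ⟨PullbackCone.IsLimit.mk _ (fun s => h.lift (s.snd ≫ w₁) (s.snd ≫ w₂) ?_)
    ?_ ?_ ?_⟩⟩
  · apply hD.hom_ext
    · simp only [Category.assoc, hd₁, hμ₁, Category.comp_id, ← hl₁]
    · simp only [Category.assoc, hd₂, hμ₂, Category.comp_id, h.w, reassoc_of% hl₂]
  · rw [Category.assoc, Category.assoc, ← (cond s).1, (cond s).2]
  · intro s
    rw [IsPullback.lift_fst_assoc, Category.assoc, (cond s).1]
  · intro s
    apply hW.hom_ext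
    · rw [Category.assoc, hl₁, h.lift_fst]
    · rw [Category.assoc, hl₂, h.lift_snd]
  · intro s m _ h2
    apply h.hom_ext
    · rw [h.lift_fst, ← h2, Category.assoc, hl₁]
    · rw [h.lift_snd, ← h2, Category.assoc, hl₂]

open TensorProduct in
/-- A morphism from an affine scheme to a fibre product of affine schemes is a closed immersion if
the coordinate rings of the factors generate its ring of functions. -/
theorem isClosedImmersion_of_lift_surjective {A B C : Type u} [CommRing A] [CommRing B]
    [CommRing C] [Algebra F A] [Algebra F B] [Algebra F C] (α : A →ₐ[F] C) (β : B →ₐ[F] C)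
    (hs : Function.Surjective (Algebra.TensorProduct.lift α β (fun _ _ => .all _ _)))
    {W : Scheme.{u}} {w₁ : W ⟶ Spec (.of A)} {w₂ : W ⟶ Spec (.of B)}
    {a : Spec (.of A) ⟶ Spec (.of F)} {b : Spec (.of B) ⟶ Spec (.of F)}
    (hW : IsPullback w₁ w₂ a b) (ha : a = Spec.map (CommRingCat.ofHom (algebraMap F A)))
    (hb : b = Spec.map (CommRingCat.ofHom (algebraMap F B)))
    {l : Spec (.of C) ⟶ W} (hl₁ : l ≫ w₁ = Spec.map (CommRingCat.ofHom α.toRingHom))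
    (hl₂ : l ≫ w₂ = Spec.map (CommRingCat.ofHom β.toRingHom)) : IsClosedImmersion l := by
  subst ha hb
  have hT := isPullback_SpecMap_of_isPushout _ _ _ _ (CommRingCat.isPushout_tensorProduct F A B)
  have hl : l ≫ (hW.isoIsPullback _ _ hT).hom = Spec.map
      (CommRingCat.ofHom (Algebra.TensorProduct.lift α β (fun _ _ => .all _ _)).toRingHom) := by
    apply hT.hom_ext
    · rw [Category.assoc, IsPullback.isoIsPullback_hom_fst, hl₁, ← Spec.map_comp,
        ← CommRingCat.ofHom_comp]
      congr 2
      ext x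
      simp
    · rw [Category.assoc, IsPullback.isoIsPullback_hom_snd, hl₂, ← Spec.map_comp,
        ← CommRingCat.ofHom_comp]
      congr 2
      ext x
      simp
  rw [← MorphismProperty.cancel_right_of_respectsIso (P := @IsClosedImmersion) _
    (hW.isoIsPullback _ _ hT).hom, hl]
  exact IsClosedImmersion.spec_of_surjective _ hs

theorem isClosedImmersion_pullback_snd {P X Y S : Scheme.{u}} {p : P ⟶ X} {q : P ⟶ Y} {f : X ⟶ S}
    {g : Y ⟶ S} (h : IsPullback p q f g) (hq : IsClosedImmersion q) :
    IsClosedImmersion (pullback.snd f g) := by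
  rw [← h.isoPullback_hom_snd] at hq
  exact (MorphismProperty.cancel_left_of_respectsIso (P := @IsClosedImmersion) _ _).1 hq

instance isSeparated_toricSurfaceToSpec : IsSeparated (toricSurfaceToSpec F Δ) := by
  refine ⟨IsZariskiLocalAtTarget.of_openCover (Scheme.Pullback.openCoverOfLeftRight
    (toricCover F Δ) (toricCover F Δ) _ _) ?_⟩
  rintro ⟨σ, τ⟩
  have hW : IsPullback (pullback.fst (toricChart F Δ σ ≫ toricSurfaceToSpec F Δ)
      (toricChart F Δ τ ≫ toricSurfaceToSpec F Δ)) (pullback.snd _ _) _ _ :=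
    IsPullback.of_hasPullback _ _
  have hch := isPullback_toricChart F Δ σ τ
  let l := hW.lift (affineToricMap F (inf_le_left : σ.1 ⊓ τ.1 ≤ σ.1))
      (affineToricMap F (inf_le_right : σ.1 ⊓ τ.1 ≤ τ.1)) (by rw [reassoc_of% hch.w])
  have hP : IsPullback _ l (pullback.diagonal (toricSurfaceToSpec F Δ))
      ((Scheme.Pullback.openCoverOfLeftRight (toricCover F Δ) (toricCover F Δ)
        (toricSurfaceToSpec F Δ) (toricSurfaceToSpec F Δ)).f ⟨σ, τ⟩) :=
    isPullback_diagonal_of_isPullback hch (IsPullback.of_hasPullback _ _) hW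
      (pullback.diagonal_fst _) (pullback.diagonal_snd _)
      (pullback.lift_fst _ _ _) (pullback.lift_snd _ _ _) (hW.lift_fst _ _ _) (hW.lift_snd _ _ _)
  have h : IsClosedImmersion l := isClosedImmersion_of_lift_surjective F
    (coneAlgebraMap F (inf_le_left : σ.1 ⊓ τ.1 ≤ σ.1))
    (coneAlgebraMap F (inf_le_right : σ.1 ⊓ τ.1 ≤ τ.1))
    (lift_coneAlgebraMap_surjective F (Δ.rational σ.1 σ.2) (Δ.rational τ.1 τ.2)
      (Δ.inter_isFace σ.1 σ.2 τ.1 τ.2)) (w₁ := pullback.fst _ _) (w₂ := pullback.snd _ _)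
    hW (toricChart_toSpec F Δ σ) (toricChart_toSpec F Δ τ) (hW.lift_fst _ _ _) (hW.lift_snd _ _ _)
  exact isClosedImmersion_pullback_snd hP h

end Separated

/-! ### Characters on affine toric surfaces -/

section Characters

variable (F : Type u) [Field F]

theorem coneAlgebraMap_character {τ σ : PointedCone ℝ Plane} (h : τ ≤ σ) (v : dualMonoid σ) :
    coneAlgebraMap F h (character F v) =
      character F (⟨v, dualMonoid_anti h v.2⟩ : dualMonoid τ) :=
  coneAlgebraMap_single F h v 1

theorem character_add {σ : PointedCone ℝ Plane} (u v : dualMonoid σ) :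
    character F (u + v) = character F u * character F v := by
  rw [character, character, character, AddMonoidAlgebra.single_mul_single, mul_one]

theorem character_nsmul {σ : PointedCone ℝ Plane} (n : ℕ) (u : dualMonoid σ) :
    character F (n • u) = character F u ^ n := by
  rw [character, character, AddMonoidAlgebra.single_pow, one_pow]

theorem character_zero {σ : PointedCone ℝ Plane} : character F (0 : dualMonoid σ) = 1 :=
  AddMonoidAlgebra.one_def.symm

theorem mem_dualMonoid_origin (u : Lattice) : u ∈ dualMonoid (latticeCone ∅) :=
  mem_dualMonoid_latticeCone.2 (by simp)

theorem normal_mem_dualMonoid {a b : Lattice} (h : 0 ≤ det a b) :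
    normal a ∈ dualMonoid (latticeCone {a, b}) := by
  refine mem_dualMonoid_latticeCone.2 ?_
  rintro c (rfl | rfl) <;> rw [intPairing_normal]
  · simp only [det]; linarith [mul_comm (c 0) (c 1)]
  · exact h

theorem neg_normal_mem_dualMonoid {a b : Lattice} (h : 0 ≤ det a b) :
    -normal b ∈ dualMonoid (latticeCone {a, b}) := by
  refine mem_dualMonoid_latticeCone.2 ?_
  rintro c (rfl | rfl) <;> rw [intPairing_neg, intPairing_normal]
  · rw [det_swap]; linarith
  · simp only [det]; linarith [mul_comm (c 0) (c 1)]

theorem exists_nsmul_normal {a b : Lattice} (h : det a b = 1) {u : Lattice}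
    (hu : u ∈ dualMonoid (latticeCone {a, b})) :
    ∃ p q : ℕ, u = p • normal a + q • (-normal b) := by
  have hu' := mem_dualMonoid_latticeCone.1 hu
  obtain ⟨p, hp⟩ := Int.eq_ofNat_of_zero_le (hu' b (by simp))
  obtain ⟨q, hq⟩ := Int.eq_ofNat_of_zero_le (hu' a (by simp))
  refine ⟨p, q, ?_⟩
  have := eq_normal_combination h u
  rwa [hp, hq, natCast_zsmul, natCast_zsmul] at this

/-- If `a, b` is a basis of the lattice, `F[S_σ]` for `σ = ⟨a, b⟩` is generated by the characters
`normal a` and `-normal b`. -/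
theorem map_mem_of_generators {K : Type*} [CommRing K] {a b : Lattice} (h : det a b = 1)
    (φ : coneAlgebra F (latticeCone {a, b}) →+* K) (R : Subring K)
    (hF : ∀ c : F, φ (algebraMap F _ c) ∈ R)
    (hα : φ (character F ⟨normal a, normal_mem_dualMonoid (h ▸ zero_le_one)⟩) ∈ R)
    (hβ : φ (character F ⟨-normal b, neg_normal_mem_dualMonoid (h ▸ zero_le_one)⟩) ∈ R)
    (z : coneAlgebra F (latticeCone {a, b})) : φ z ∈ R := by
  induction z using AddMonoidAlgebra.induction_linear with
  | zero => rw [map_zero]; exact R.zero_mem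
  | add f g hf hg => rw [map_add]; exact R.add_mem hf hg
  | single w c =>
    obtain ⟨p, q, e⟩ := exists_nsmul_normal h w.2
    have e' : (AddMonoidAlgebra.single w c : coneAlgebra F (latticeCone {a, b})) =
        algebraMap F _ c *
          (character F ⟨normal a, normal_mem_dualMonoid (h ▸ zero_le_one)⟩ ^ p *
          character F ⟨-normal b, neg_normal_mem_dualMonoid (h ▸ zero_le_one)⟩ ^ q) := by
      rw [← character_nsmul, ← character_nsmul, ← character_add, AddMonoidAlgebra.coe_algebraMap]
      simp only [character, Function.comp_apply, Algebra.algebraMap_self, RingHom.id_apply,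
        AddMonoidAlgebra.single_mul_single, mul_one, zero_add]
      congr 1
      exact Subtype.ext e
    rw [e', map_mul, map_mul, map_pow, map_pow]
    exact R.mul_mem (hF c) (R.mul_mem (R.pow_mem hα p) (R.pow_mem hβ q))

instance isDomain_coneAlgebra (σ : PointedCone ℝ Plane) : IsDomain (coneAlgebra F σ) := by
  have : UniqueSums (dualMonoid σ) := UniqueSums.of_injective_addHom
    (dualMonoid σ).subtype.toAddHom Subtype.coe_injective inferInstance
  have : NoZeroDivisors (coneAlgebra F σ) := inferInstance
  have : Nontrivial (coneAlgebra F σ) := inferInstance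
  exact NoZeroDivisors.to_isDomain _

end Characters

/-! ### Regularity and finiteness of smooth charts -/

section SmoothChart

variable (F : Type u) [Field F]

/-- A basis `a, b` of the lattice identifies the dual semigroup of the cone `⟨a, b⟩` with `ℕ²`. -/
theorem nonempty_dualMonoid_equiv {a b : Lattice} (h : det a b = 1) :
    Nonempty ((Fin 2 →₀ ℕ) ≃+ dualMonoid (latticeCone {a, b})) := by
  let f : (Fin 2 →₀ ℕ) →+ dualMonoid (latticeCone {a, b}) :=
    { toFun := fun n => n 0 • ⟨normal a, normal_mem_dualMonoid (h ▸ zero_le_one)⟩ +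
        n 1 • ⟨-normal b, neg_normal_mem_dualMonoid (h ▸ zero_le_one)⟩
      map_zero' := by simp
      map_add' := fun x y => by simp only [Finsupp.add_apply, add_smul]; abel }
  have hf : ∀ n, (f n : Lattice) = (n 0 : ℤ) • normal a + (n 1 : ℤ) • (-normal b) := fun n => by
    rw [natCast_zsmul, natCast_zsmul]; rfl
  have hself : ∀ c : Lattice, det c c = 0 := fun c => by simp only [det]; ring
  refine ⟨AddEquiv.ofBijective f ⟨fun x y e => ?_, fun u => ?_⟩⟩
  · have e' : (f x : Lattice) = f y := congrArg Subtype.val e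
    have h1 := congrArg (fun u => intPairing u b) e'
    have h2 := congrArg (fun u => intPairing u a) e'
    simp only [hf, intPairing_add, intPairing_zsmul, intPairing_neg, intPairing_normal, hself,
      h, det_swap a b] at h1 h2
    ext i
    fin_cases i
    · exact_mod_cast (by linarith : (x 0 : ℤ) = y 0)
    · exact_mod_cast (by linarith : (x 1 : ℤ) = y 1)
  · obtain ⟨p, q, e⟩ := exists_nsmul_normal h u.2
    refine ⟨Finsupp.single 0 p + Finsupp.single 1 q, Subtype.ext ?_⟩
    rw [hf, e]
    simp

theorem nonempty_mvPolynomial_equiv {a b : Lattice} (h : det a b = 1) :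
    Nonempty (MvPolynomial (Fin 2) F ≃ₐ[F] coneAlgebra F (latticeCone {a, b})) := by
  obtain ⟨e⟩ := nonempty_dualMonoid_equiv h
  exact ⟨AddMonoidAlgebra.domCongr F F e⟩

theorem isRegularRing_coneAlgebra {a b : Lattice} (h : det a b = 1) :
    IsRegularRing (coneAlgebra F (latticeCone {a, b})) := by
  obtain ⟨e⟩ := nonempty_mvPolynomial_equiv F h
  exact IsRegularRing.of_ringEquiv e.toRingEquiv

theorem locallyOfFiniteType_affineToricToSpec {a b : Lattice} (h : det a b = 1) :
    LocallyOfFiniteType (affineToricToSpec F (latticeCone {a, b})) := by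
  obtain ⟨e⟩ := nonempty_mvPolynomial_equiv F h
  have : Algebra.FiniteType F (coneAlgebra F (latticeCone {a, b})) :=
    Algebra.FiniteType.equiv inferInstance e
  rw [affineToricToSpec, HasRingHomProperty.Spec_iff (P := @LocallyOfFiniteType)]
  exact (RingHom.finiteType_algebraMap).2 this

theorem isRegularLocalRing_stalk_spec (R : CommRingCat.{u}) [IsRegularRing R] (x : Spec R) :
    IsRegularLocalRing ((Spec R).presheaf.stalk x) :=
  IsRegularLocalRing.of_ringEquiv (Spec.stalkIso R x).commRingCatIsoToRingEquiv.symm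

instance compactSpace_toricSurface (Δ : Fan) : CompactSpace (toricSurface F Δ) := by
  have : Finite (toricCover F Δ).I₀ := inferInstanceAs (Finite Δ.Index)
  have : ∀ σ : (toricCover F Δ).I₀, CompactSpace ((toricCover F Δ).X σ) := fun σ =>
    inferInstanceAs (CompactSpace (affineToric F σ.1))
  exact Scheme.OpenCover.compactSpace (toricCover F Δ)

theorem isRegularLocalRing_stalk_toricSurface {Δ : Fan}
    (hΔ : ∀ σ ∈ Δ.cones, ∃ a b, det a b = 1 ∧ latticeCone {a, b} ∈ Δ.cones ∧ σ ≤ latticeCone {a, b})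
    (x : toricSurface F Δ) :
    IsRegularLocalRing ((toricSurface F Δ).presheaf.stalk x) := by
  obtain ⟨σ, y, rfl⟩ := toricSurface_exists F Δ x
  obtain ⟨a, b, hab, hmem, hle⟩ := hΔ σ.1 σ.2
  have e := affineToricMap_toricChart F Δ (τ := σ) (σ := ⟨_, hmem⟩) hle
  rw [← e]
  have := isRegularRing_coneAlgebra F hab
  have := isRegularLocalRing_stalk_spec (CommRingCat.of (coneAlgebra F (latticeCone {a, b})))
    (affineToricMap F hle y)
  exact IsRegularLocalRing.of_ringEquiv (asIso ((toricChart F Δ ⟨_, hmem⟩).stalkMap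
    (affineToricMap F hle y))).commRingCatIsoToRingEquiv.symm

theorem locallyOfFiniteType_toricSurfaceToSpec {Δ : Fan} (hΔ : ∀ σ ∈ Δ.cones,
    ∃ a b, det a b = 1 ∧ latticeCone {a, b} ∈ Δ.cones ∧ σ ≤ latticeCone {a, b}) :
    LocallyOfFiniteType (toricSurfaceToSpec F Δ) := by
  have hloc : IsZariskiLocalAtSource @LocallyOfFiniteType :=
    HasRingHomProperty.instIsZariskiLocalAtSource
  refine (IsZariskiLocalAtSource.iff_of_openCover (P := @LocallyOfFiniteType)
    (toricCover F Δ)).2 fun σ => ?_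
  obtain ⟨a, b, hab, hmem, hle⟩ := hΔ σ.1 σ.2
  have e : (toricCover F Δ).f σ ≫ toricSurfaceToSpec F Δ =
      affineToricMap F hle ≫ affineToricToSpec F (latticeCone {a, b}) :=
    (toricChart_toSpec F Δ σ).trans (affineToricMap_toSpec F hle).symm
  rw [e]
  have := isOpenImmersion_face F hle (Δ.rational _ hmem)
    (Δ.isFace_of_le (τ := σ) (σ := ⟨_, hmem⟩) hle)
  have h1 : LocallyOfFiniteType (affineToricMap F hle) := inferInstance
  have h2 := locallyOfFiniteType_affineToricToSpec F hab
  exact MorphismProperty.comp_mem _ _ _ h1 h2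

end SmoothChart

/-! ### The valuative criterion and properness -/

section Valuative

variable (F : Type u) [Field F]

theorem exists_comp_eq_of_forall_mem_range {A R K : Type*} [CommRing A] [CommRing R] [CommRing K]
    {ι : R →+* K} (hι : Function.Injective ι) (φ : A →+* K) (h : ∀ a, φ a ∈ ι.range) :
    ∃ ψ : A →+* R, ι.comp ψ = φ := by
  let e : R ≃+* ι.range := RingEquiv.ofBijective ι.rangeRestrict
    ⟨fun x y hxy => hι (congrArg Subtype.val hxy), ι.rangeRestrict_surjective⟩
  refine ⟨e.symm.toRingHom.comp (φ.codRestrict ι.range h), RingHom.ext fun a => ?_⟩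
  exact congrArg Subtype.val (e.apply_symm_apply (φ.codRestrict ι.range h a))

/-- A homomorphism `F[S_σ] → K` extends to `F[S_τ]`, where `τ = σ ∩ u^⊥`, if `x^u` is inverted. -/
theorem exists_extend_to_face {τ σ : PointedCone ℝ Plane} (h : τ ≤ σ)
    (hσ : ∃ S : Set Lattice, S.Finite ∧ σ = latticeCone S) (u : dualMonoid σ)
    (hτ : ∀ x, x ∈ τ ↔ x ∈ σ ∧ pairing u x = 0) {K : Type*} [CommRing K]
    (φ : coneAlgebra F σ →+* K) (hu : IsUnit (φ (character F u))) :
    ∃ φ' : coneAlgebra F τ →+* K, φ'.comp (coneAlgebraMap F h).toRingHom = φ := by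
  let _ := (coneAlgebraMap F h).toRingHom.toAlgebra
  have := isLocalization_face F h hσ u hτ
  exact ⟨IsLocalization.Away.lift (character F u) hu, IsLocalization.Away.lift_comp _ hu⟩

theorem mem_ray_left_iff {a b : Lattice} (h : det a b = 1) (x : Plane) :
    x ∈ latticeCone {a} ↔ x ∈ latticeCone {a, b} ∧ pairing (normal a) x = 0 := by
  have h1 : pairing (normal a) (toPlane a) = 0 := by
    rw [pairing_toPlane, intPairing_normal]; simp only [det]; push_cast; ring
  have h2 : pairing (normal a) (toPlane b) = 1 := by
    rw [pairing_toPlane, intPairing_normal, h]; simp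
  rw [mem_latticeCone_singleton, mem_latticeCone_pair]
  constructor
  · rintro ⟨s, hs, rfl⟩
    exact ⟨⟨s, 0, hs, le_rfl, by simp⟩, by rw [pairing_smul, h1, mul_zero]⟩
  · rintro ⟨⟨s, t, hs, ht, rfl⟩, e⟩
    rw [pairing_add, pairing_smul, pairing_smul, h1, h2, mul_zero, zero_add, mul_one] at e
    exact ⟨s, hs, by simp [e]⟩

theorem mem_ray_right_iff {a b : Lattice} (h : det a b = 1) (x : Plane) :
    x ∈ latticeCone {b} ↔ x ∈ latticeCone {a, b} ∧ pairing (-normal b) x = 0 := by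
  have h1 : pairing (-normal b) (toPlane a) = 1 := by
    rw [pairing_toPlane, intPairing_neg, intPairing_normal, det_swap, h]; simp
  have h2 : pairing (-normal b) (toPlane b) = 0 := by
    rw [pairing_toPlane, intPairing_neg, intPairing_normal]; simp only [det]; push_cast; ring
  rw [mem_latticeCone_singleton, mem_latticeCone_pair]
  constructor
  · rintro ⟨s, hs, rfl⟩
    exact ⟨⟨0, s, le_rfl, hs, by simp⟩, by rw [pairing_smul, h2, mul_zero]⟩
  · rintro ⟨⟨s, t, hs, ht, rfl⟩, e⟩
    rw [pairing_add, pairing_smul, pairing_smul, h1, h2, mul_zero, add_zero, mul_one] at e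
    exact ⟨t, ht, by simp [e]⟩

theorem mem_origin_iff {a b : Lattice} (h : det a b = 1) (x : Plane) :
    x ∈ latticeCone ∅ ↔ x ∈ latticeCone {a, b} ∧ pairing (normal a + -normal b) x = 0 := by
  rw [mem_latticeCone_empty, pairing_add_left]
  constructor
  · rintro rfl
    exact ⟨zero_mem _, by simp [pairing_zero_right]⟩
  · rintro ⟨hx, e⟩
    have h1 := normal_mem_dualMonoid (h ▸ zero_le_one) x hx
    have h2 := neg_normal_mem_dualMonoid (h ▸ zero_le_one) x hx
    obtain ⟨s, -, rfl⟩ := mem_latticeCone_singleton.1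
      ((mem_ray_left_iff h x).2 ⟨hx, by linarith⟩)
    have h3 : pairing (-normal b) (s • toPlane a) = 0 := by linarith
    rw [pairing_smul, pairing_toPlane, intPairing_neg, intPairing_normal, det_swap, h] at h3
    have : s = 0 := by simpa using h3
    rw [this, zero_smul]

variable {F} {Δ : Fan}

theorem specMap_comp_toricChart {τ σ : Δ.Index} (h : τ.1 ≤ σ.1) {K : Type u} [CommRing K]
    (φ : coneAlgebra F τ.1 →+* K) :
    Spec.map (CommRingCat.ofHom (φ.comp (coneAlgebraMap F h).toRingHom)) ≫ toricChart F Δ σ =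
      Spec.map (CommRingCat.ofHom φ) ≫ toricChart F Δ τ := by
  rw [← affineToricMap_toricChart F Δ h, affineToricMap, ← Category.assoc, ← Spec.map_comp,
    ← CommRingCat.ofHom_comp]

theorem toricSurface_hom_ext_toSpec {σ : Δ.Index} {K : Type u} [CommRing K]
    (φ : coneAlgebra F σ.1 →+* K) :
    (Spec.map (CommRingCat.ofHom φ) ≫ toricChart F Δ σ) ≫ toricSurfaceToSpec F Δ =
      Spec.map (CommRingCat.ofHom (φ.comp (algebraMap F _))) := by
  rw [Category.assoc, toricChart_toSpec, affineToricToSpec, ← Spec.map_comp,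
    ← CommRingCat.ofHom_comp]

/-- A `K`-valued point of a chart extends to an `R`-valued point of `X(Δ)` if it lies in a smooth
chart whose two coordinates take values in `R`. -/
theorem exists_lift_of_coordinates {R K : Type u} [CommRing R] [Field K] [Algebra R K]
    (hinj : Function.Injective (algebraMap R K)) {ι : F →+* R} {ρ : Δ.Index} {a b : Lattice}
    (hab : det a b = 1) (hmem : latticeCone {a, b} ∈ Δ.cones) (hle : ρ.1 ≤ latticeCone {a, b})
    (φ : coneAlgebra F ρ.1 →+* K)
    (hφ : φ.comp (algebraMap F _) = (algebraMap R K).comp ι)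
    (hα : φ (character F ⟨normal a,
      dualMonoid_anti hle (normal_mem_dualMonoid (hab ▸ zero_le_one))⟩) ∈ (algebraMap R K).range)
    (hβ : φ (character F ⟨-normal b,
      dualMonoid_anti hle (neg_normal_mem_dualMonoid (hab ▸ zero_le_one))⟩) ∈
        (algebraMap R K).range) :
    ∃ l : Spec (CommRingCat.of R) ⟶ toricSurface F Δ,
      Spec.map (CommRingCat.ofHom (algebraMap R K)) ≫ l =
        Spec.map (CommRingCat.ofHom φ) ≫ toricChart F Δ ρ ∧
      l ≫ toricSurfaceToSpec F Δ = Spec.map (CommRingCat.ofHom ι) := by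
  let φ₁ := φ.comp (coneAlgebraMap F hle).toRingHom
  have hF : φ₁.comp (algebraMap F _) = (algebraMap R K).comp ι := by
    rw [← hφ, RingHom.comp_assoc]
    congr 1
    exact (coneAlgebraMap F hle).comp_algebraMap
  obtain ⟨ψ, hψ⟩ := exists_comp_eq_of_forall_mem_range hinj φ₁
    (map_mem_of_generators F hab φ₁ _ (fun c => ⟨ι c, (RingHom.congr_fun hF c).symm⟩)
      (by
        change φ (coneAlgebraMap F hle _) ∈ _
        rw [coneAlgebraMap_character]; exact hα)
      (by
        change φ (coneAlgebraMap F hle _) ∈ _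
        rw [coneAlgebraMap_character]; exact hβ))
  refine ⟨Spec.map (CommRingCat.ofHom ψ) ≫ toricChart F Δ ⟨_, hmem⟩, ?_, ?_⟩
  · rw [← Category.assoc, ← Spec.map_comp, ← CommRingCat.ofHom_comp, hψ]
    exact specMap_comp_toricChart (σ := ⟨_, hmem⟩) hle φ
  · refine (toricSurface_hom_ext_toSpec (σ := ⟨_, hmem⟩) ψ).trans ?_
    congr 2
    ext c
    apply hinj
    exact (RingHom.congr_fun hψ _).trans (RingHom.congr_fun hF c)

/-- On the boundary of the chart of a ray `ρ`, the vanishing of one function of order one along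
`ρ` forces the vanishing of all characters positive on `ρ`. -/
theorem map_character_eq_zero {r : Lattice} {K : Type*} [CommRing K]
    (φ : coneAlgebra F (latticeCone {r}) →+* K) {w : dualMonoid (latticeCone {r})}
    (hw : intPairing w r = 1) (h0 : φ (character F w) = 0) {u : dualMonoid (latticeCone {r})}
    (hu : 0 < intPairing u r) : φ (character F u) = 0 := by
  have hd : (u : Lattice) + -w ∈ dualMonoid (latticeCone {r}) := by
    refine mem_dualMonoid_latticeCone.2 ?_
    rintro c rfl
    rw [intPairing_add, intPairing_neg, hw]
    linarith
  have e : u = w + ⟨_, hd⟩ := Subtype.ext (by simp)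
  rw [e, character_add, map_mul, h0, zero_mul]

/-- The character `u` on a point of the torus. -/
def torusChar {K : Type*} [CommRing K] (φ : coneAlgebra F (latticeCone ∅) →+* K)
    (u : Lattice) : K :=
  φ (character F ⟨u, mem_dualMonoid_origin u⟩)

theorem torusChar_mul_neg {K : Type*} [CommRing K] (φ : coneAlgebra F (latticeCone ∅) →+* K)
    (u : Lattice) : torusChar φ u * torusChar φ (-u) = 1 := by
  rw [torusChar, torusChar, ← map_mul, ← character_add, ← map_one φ, ← character_zero]
  congr 2
  exact Subtype.ext (add_neg_cancel u)

theorem torusChar_mem_range_or {R K : Type*} [CommRing R] [IsDomain R] [ValuationRing R] [Field K]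
    [Algebra R K] [IsFractionRing R K] (φ : coneAlgebra F (latticeCone ∅) →+* K) (u : Lattice) :
    torusChar φ u ∈ (algebraMap R K).range ∨ torusChar φ (-u) ∈ (algebraMap R K).range := by
  rw [eq_inv_of_mul_eq_one_right (torusChar_mul_neg φ u)]
  exact ValuationRing.isInteger_or_isInteger R _

/-- The indices of the rays are cyclic: `m + 4` may be replaced by `0`. -/
theorem exists_rayCycle_eq_succ {m k i : ℕ} (hi : i ≤ m + 3) :
    ∃ j ≤ m + 3, rayCycle m k j = rayCycle m k (i + 1) := by
  rcases hi.lt_or_eq with h | rfl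
  · exact ⟨i + 1, h, rfl⟩
  · exact ⟨0, by omega, by rw [rayCycle_zero, rayCycle_add_four]⟩

theorem exists_rayCycle_succ_eq {m k i : ℕ} (hi : i ≤ m + 3) :
    ∃ j ≤ m + 3, rayCycle m k (j + 1) = rayCycle m k i := by
  rcases i with _ | i
  · exact ⟨m + 3, le_rfl, by rw [rayCycle_zero, rayCycle_add_four]⟩
  · exact ⟨i, by omega, rfl⟩

/-- The existence part of the valuative criterion. A `K`-valued point of a chart lies on the torus,
on the orbit of one of the two rays, or on the fixed point. On the torus the signs of the valuations
of the characters select a cone of the complete fan; on the orbit of a ray the point extends to one of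
the two charts that contain the ray. -/
theorem exists_lift_of_valuationRing {m k : ℕ} (hm : 2 ≤ m) (hk : 1 ≤ k) {R K : Type u}
    [CommRing R] [IsDomain R] [ValuationRing R] [Field K] [Algebra R K] [IsFractionRing R K]
    {ι : F →+* R} {i : ℕ} (hi : i ≤ m + 3) (φ : coneAlgebra F (cycleCone m k i) →+* K)
    (hφ : φ.comp (algebraMap F _) = (algebraMap R K).comp ι) :
    ∃ l : Spec (CommRingCat.of R) ⟶
        toricSurface F (planarFan (desingularizationRays m k)),
      Spec.map (CommRingCat.ofHom (algebraMap R K)) ≫ l =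
        Spec.map (CommRingCat.ofHom φ) ≫
          toricChart F (planarFan (desingularizationRays m k)) ⟨_, cycleCone_mem hm hk hi⟩ ∧
      l ≫ toricSurfaceToSpec F (planarFan (desingularizationRays m k)) =
        Spec.map (CommRingCat.ofHom ι) := by
  let Δ := planarFan (desingularizationRays m k)
  have hinj : Function.Injective (algebraMap R K) := IsFractionRing.injective R K
  have hdet : ∀ {j : ℕ}, j ≤ m + 3 → det (rayCycle m k j) (rayCycle m k (j + 1)) = 1 :=
    fun h => det_rayCycle_succ h
  have hrat := Δ.rational _ (cycleCone_mem hm hk hi)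
  have hnorm := normal_mem_dualMonoid ((hdet hi).symm ▸ zero_le_one)
  have hneg := neg_normal_mem_dualMonoid ((hdet hi).symm ▸ zero_le_one)
  let α : dualMonoid (cycleCone m k i) := ⟨_, hnorm⟩
  let β : dualMonoid (cycleCone m k i) := ⟨_, hneg⟩
  -- the point extended to the chart of a face lifts if it lifts there
  have reduce : ∀ (τ : PointedCone ℝ Plane) (hτ : τ ∈ Δ.cones) (hτi : τ ≤ cycleCone m k i)
      (φ' : coneAlgebra F τ →+* K), φ'.comp (coneAlgebraMap F hτi).toRingHom = φ →
      ∀ {j : ℕ} (hj : j ≤ m + 3) (hle : τ ≤ cycleCone m k j),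
      (∀ h, φ' (character F ⟨normal (rayCycle m k j), h⟩) ∈ (algebraMap R K).range) →
      (∀ h, φ' (character F ⟨-normal (rayCycle m k (j + 1)), h⟩) ∈ (algebraMap R K).range) →
      ∃ l : Spec (CommRingCat.of R) ⟶ toricSurface F Δ,
        Spec.map (CommRingCat.ofHom (algebraMap R K)) ≫ l =
          Spec.map (CommRingCat.ofHom φ) ≫ toricChart F Δ ⟨_, cycleCone_mem hm hk hi⟩ ∧
        l ≫ toricSurfaceToSpec F Δ = Spec.map (CommRingCat.ofHom ι) := by
    intro τ hτ hτi φ' hφ' j hj hle h1 h2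
    have hF : φ'.comp (algebraMap F _) = (algebraMap R K).comp ι := by
      rw [← hφ, ← hφ', RingHom.comp_assoc]
      congr 1
      exact (coneAlgebraMap F hτi).comp_algebraMap.symm
    obtain ⟨l, hl, hl'⟩ := exists_lift_of_coordinates (ρ := ⟨τ, hτ⟩) hinj (hdet hj)
      (cycleCone_mem hm hk hj) hle φ' hF (h1 _) (h2 _)
    refine ⟨l, hl.trans ?_, hl'⟩
    rw [← hφ']
    exact (specMap_comp_toricChart (τ := ⟨τ, hτ⟩) (σ := ⟨_, cycleCone_mem hm hk hi⟩) hτi φ').symm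
  by_cases hα : φ (character F α) = 0
  · by_cases hβ : φ (character F β) ∈ (algebraMap R K).range
    · exact reduce _ (cycleCone_mem hm hk hi) le_rfl φ (by rw [coneAlgebraMap_refl]; rfl) hi le_rfl
        (fun _ => ⟨0, by rw [map_zero]; exact hα.symm⟩) (fun _ => hβ)
    · -- the point lies on the ray `i + 1`, and extends to the following chart
      have hβ0 : φ (character F β) ≠ 0 := fun h => hβ ⟨0, by rw [map_zero, h]⟩
      have hray : latticeCone {rayCycle m k (i + 1)} ≤ cycleCone m k i :=
        latticeCone_mono (by simp)
      obtain ⟨φ', hφ'⟩ := exists_extend_to_face F hray hrat β (mem_ray_right_iff (hdet hi)) φ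
        hβ0.isUnit
      obtain ⟨j, hj, ej⟩ := exists_rayCycle_eq_succ (m := m) (k := k) hi
      have hinv := (ValuationRing.isInteger_or_isInteger R (φ (character F β))).resolve_left hβ
      refine reduce _ (Or.inr (Or.inl ⟨_, rayCycle_mem (by omega), rfl⟩)) hray φ' hφ' hj
        (latticeCone_mono (by simp [ej])) (fun h => ?_) (fun h => ?_)
      · obtain ⟨c, hc⟩ := hinv
        refine ⟨c, hc.trans (Eq.symm (eq_inv_of_mul_eq_one_right ?_))⟩
        rw [← hφ']
        change φ' (coneAlgebraMap F hray _) * _ = 1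
        rw [coneAlgebraMap_character, ← map_mul, ← character_add, ← map_one φ', ← character_zero]
        congr 2
        refine Subtype.ext ?_
        simp [β, ej]
      · rw [map_character_eq_zero φ' (w := ⟨α, dualMonoid_anti hray α.2⟩)]
        · exact zero_mem _
        · simp [α, intPairing_normal, hdet hi]
        · rw [← coneAlgebraMap_character F hray α]
          rw [← hφ'] at hα
          exact hα
        · change 0 < intPairing (-normal _) _
          rw [← ej, intPairing_neg, intPairing_normal, det_swap, hdet hj]
          norm_num
  by_cases hβ : φ (character F β) = 0
  · by_cases hα' : φ (character F α) ∈ (algebraMap R K).range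
    · exact reduce _ (cycleCone_mem hm hk hi) le_rfl φ (by rw [coneAlgebraMap_refl]; rfl) hi le_rfl
        (fun _ => hα') (fun _ => ⟨0, by rw [map_zero]; exact hβ.symm⟩)
    · -- the point lies on the ray `i`, and extends to the preceding chart
      have hray : latticeCone {rayCycle m k i} ≤ cycleCone m k i := latticeCone_mono (by simp)
      obtain ⟨φ', hφ'⟩ := exists_extend_to_face F hray hrat α (mem_ray_left_iff (hdet hi)) φ
        (IsUnit.mk0 _ hα)
      obtain ⟨j, hj, ej⟩ := exists_rayCycle_succ_eq (m := m) (k := k) hi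
      have hinv := (ValuationRing.isInteger_or_isInteger R (φ (character F α))).resolve_left hα'
      refine reduce _ (Or.inr (Or.inl ⟨_, rayCycle_mem (by omega), rfl⟩)) hray φ' hφ' hj
        (latticeCone_mono (by simp [ej])) (fun h => ?_) (fun h => ?_)
      · rw [map_character_eq_zero φ' (w := ⟨β, dualMonoid_anti hray β.2⟩)]
        · exact zero_mem _
        · simp [β, intPairing_neg, intPairing_normal, det_swap _ (rayCycle m k (i + 1)), hdet hi]
        · rw [← coneAlgebraMap_character F hray β]
          rw [← hφ'] at hβ
          exact hβ
        · change 0 < intPairing (normal _) _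
          rw [← ej, intPairing_normal, hdet hj]
          norm_num
      · obtain ⟨c, hc⟩ := hinv
        refine ⟨c, hc.trans (Eq.symm (eq_inv_of_mul_eq_one_right ?_))⟩
        rw [← hφ']
        change φ' (coneAlgebraMap F hray _) * _ = 1
        rw [coneAlgebraMap_character, ← map_mul, ← character_add, ← map_one φ', ← character_zero]
        congr 2
        refine Subtype.ext ?_
        simp [α, ej]
  · have h0 : latticeCone ∅ ≤ cycleCone m k i := latticeCone_mono (by simp)
    have hu : IsUnit (φ (character F (α + β))) := by
      rw [character_add, map_mul]
      exact (IsUnit.mk0 _ hα).mul (IsUnit.mk0 _ hβ)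
    obtain ⟨φ', hφ'⟩ := exists_extend_to_face F h0 hrat (α + β) (mem_origin_iff (hdet hi)) φ hu
    obtain ⟨j, hj, h1, h2⟩ := exists_rayCycle (m := m) (k := k)
      (P := fun r => torusChar φ' (normal r) ∈ (algebraMap R K).range)
      (Q := fun r => torusChar φ' (-normal r) ∈ (algebraMap R K).range)
      (fun r => torusChar_mem_range_or φ' _) (fun r h => by rwa [normal_neg, neg_neg])
      (fun r h => by rwa [normal_neg])
    exact reduce _ (Or.inl rfl) h0 φ' hφ' hj (latticeCone_mono (by simp)) (fun _ => h1) (fun _ => h2)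

theorem exists_smooth_cone {m k : ℕ} (hm : 2 ≤ m) (hk : 1 ≤ k) :
    ∀ σ ∈ (planarFan (desingularizationRays m k)).cones, ∃ a b, det a b = 1 ∧
      latticeCone {a, b} ∈ (planarFan (desingularizationRays m k)).cones ∧
      σ ≤ latticeCone {a, b} := fun _ hσ =>
  let ⟨_, hi, hle⟩ := exists_le_cycleCone hm hk hσ
  ⟨_, _, det_rayCycle_succ hi, cycleCone_mem hm hk hi, hle⟩

variable (F) in
theorem isProper_toricSurfaceToSpec {m k : ℕ} (hm : 2 ≤ m) (hk : 1 ≤ k) :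
    IsProper (toricSurfaceToSpec F (planarFan (desingularizationRays m k))) := by
  have : QuasiCompact (toricSurfaceToSpec F (planarFan (desingularizationRays m k))) :=
    (quasiCompact_iff_compactSpace _).2 inferInstance
  have := locallyOfFiniteType_toricSurfaceToSpec F (exists_smooth_cone hm hk)
  have : UniversallyClosed (toricSurfaceToSpec F (planarFan (desingularizationRays m k))) := by
    refine UniversallyClosed.of_valuativeCriterion _ ?_
    rintro ⟨R, K, i₁, i₂, ⟨w⟩⟩
    obtain ⟨σ, y, hy⟩ := toricSurface_exists F _ (i₁ default)
    obtain ⟨i, hi, hle⟩ := exists_le_cycleCone hm hk σ.2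
    have hr : Set.range i₁ ⊆ Set.range (toricChart F (planarFan (desingularizationRays m k))
        ⟨_, cycleCone_mem hm hk hi⟩) := by
      rintro _ ⟨p, rfl⟩
      rw [Subsingleton.elim p default, ← hy]
      refine ⟨affineToricMap F hle y, ?_⟩
      rw [← affineToricMap_toricChart F _ (τ := σ) (σ := ⟨_, cycleCone_mem hm hk hi⟩) hle]
      rfl
    obtain ⟨φ, hφ⟩ := Spec.map_surjective (IsOpenImmersion.lift _ i₁ hr)
    obtain ⟨ι, rfl⟩ := Spec.map_surjective i₂
    have e := IsOpenImmersion.lift_fac _ i₁ hr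
    rw [← hφ] at e
    have hφι : φ.hom.comp (algebraMap F _) = (algebraMap R K).comp ι.hom := by
      rw [← e] at w
      have w' := (toricSurface_hom_ext_toSpec (σ := ⟨_, cycleCone_mem hm hk hi⟩) φ.hom).symm.trans w
      rw [← Spec.map_comp] at w'
      exact congrArg CommRingCat.Hom.hom (Spec.map_injective w')
    obtain ⟨l, hl, hl'⟩ := exists_lift_of_valuationRing hm hk hi φ.hom hφι
    exact ⟨⟨l, hl.trans e, hl'⟩⟩
  constructor

end Valuative

/-! ### The morphism of a refinement -/

section Refinement

variable (F : Type u) [Field F] {Δ' Δ : Fan}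

/-- The morphism from the chart of `τ` to `X(Δ)` does not depend on the cone of `Δ` containing `τ`.
-/
theorem affineToricMap_toricChart_eq {τ : PointedCone ℝ Plane} {σ₁ σ₂ : Δ.Index} (h₁ : τ ≤ σ₁.1)
    (h₂ : τ ≤ σ₂.1) :
    affineToricMap F h₁ ≫ toricChart F Δ σ₁ = affineToricMap F h₂ ≫ toricChart F Δ σ₂ := by
  have h : τ ≤ (Δ.inter σ₁ σ₂).1 := le_inf h₁ h₂
  have e₁ := affineToricMap_toricChart F Δ (τ := Δ.inter σ₁ σ₂) (σ := σ₁) inf_le_left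
  have e₂ := affineToricMap_toricChart F Δ (τ := Δ.inter σ₁ σ₂) (σ := σ₂) inf_le_right
  rw [← affineToricMap_comp F h (inf_le_left : σ₁.1 ⊓ σ₂.1 ≤ σ₁.1), Category.assoc, e₁,
    ← affineToricMap_comp F h (inf_le_right : σ₁.1 ⊓ σ₂.1 ≤ σ₂.1), Category.assoc, e₂]

variable (h : ∀ σ' : Δ'.Index, ∃ σ : Δ.Index, σ'.1 ≤ σ.1)

/-- The morphism `X(Δ') → X(Δ)` induced by the identity of the lattice for a refinement `Δ'`
of `Δ`. -/
def refinementMorphism : toricSurface F Δ' ⟶ toricSurface F Δ :=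
  colimit.desc (toricDiagram F Δ')
    { pt := toricSurface F Δ
      ι :=
        { app := fun σ' => affineToricMap F (h σ').choose_spec ≫ toricChart F Δ (h σ').choose
          naturality := fun σ' τ' f => by
            have hle : σ'.1 ≤ τ'.1 := leOfHom f
            refine Eq.trans ?_ (Category.comp_id _).symm
            change affineToricMap F hle ≫ _ = _
            have e := affineToricMap_comp F hle (h τ').choose_spec
            refine (Category.assoc _ _ _).symm.trans ?_
            exact (congrArg (· ≫ toricChart F Δ _) e).trans (affineToricMap_toricChart_eq F _ _) } }

theorem isRefinementMorphism_refinementMorphism :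
    IsRefinementMorphism F (refinementMorphism F h) := by
  refine ⟨h, fun σ' σ hle => ?_⟩
  refine (colimit.ι_desc _ _).trans ?_
  exact affineToricMap_toricChart_eq F _ _

variable {F}

theorem toricSurface_hom_ext {Y : Scheme.{u}} {f g : toricSurface F Δ ⟶ Y}
    (h : ∀ σ, toricChart F Δ σ ≫ f = toricChart F Δ σ ≫ g) : f = g :=
  colimit.hom_ext h

theorem IsRefinementMorphism.comp_toSpec {f : toricSurface F Δ' ⟶ toricSurface F Δ}
    (hf : IsRefinementMorphism F f) : f ≫ toricSurfaceToSpec F Δ = toricSurfaceToSpec F Δ' := by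
  refine toricSurface_hom_ext fun σ' => ?_
  obtain ⟨σ, hle⟩ := hf.1 σ'
  rw [← Category.assoc, hf.2 σ' σ hle, Category.assoc, toricChart_toSpec, toricChart_toSpec,
    affineToricMap_toSpec]

end Refinement

/-! ### The torus and birationality of refinements -/

section Torus

variable (F : Type u) [Field F] (Δ : Fan)

theorem latticeCone_empty_le (σ : PointedCone ℝ Plane) : latticeCone ∅ ≤ σ :=
  latticeCone_le (by rintro c ⟨⟩)

/-- The torus in `X(Δ)`, the chart of the cone `{0}`. -/
def torus (h0 : latticeCone ∅ ∈ Δ.cones) : (toricSurface F Δ).Opens :=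
  (toricChart F Δ ⟨_, h0⟩).opensRange

theorem dense_torus (h0 : latticeCone ∅ ∈ Δ.cones) :
    Dense (torus F Δ h0 : Set (toricSurface F Δ)) := by
  rw [dense_iff_inter_open]
  rintro V hV ⟨x, hx⟩
  obtain ⟨σ, y, rfl⟩ := toricSurface_exists F Δ x
  have hle := latticeCone_empty_le σ.1
  have hopen := isOpenImmersion_face F hle (Δ.rational σ.1 σ.2)
    (Δ.isFace_of_le (τ := ⟨_, h0⟩) (σ := σ) hle)
  obtain ⟨z, hzV, w, rfl⟩ := nonempty_preirreducible_inter
    (hV.preimage (toricChart F Δ σ).continuous) (affineToricMap F hle).isOpenEmbedding.isOpen_range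
    ⟨y, hx⟩ (Set.range_nonempty _)
  refine ⟨_, hzV, w, ?_⟩
  rw [← affineToricMap_toricChart F Δ (τ := ⟨_, h0⟩) (σ := σ) hle]
  rfl

theorem isIntegral_toricSurface (h0 : latticeCone ∅ ∈ Δ.cones) : IsIntegral (toricSurface F Δ) := by
  have : AlgebraicGeometry.IsReduced (toricSurface F Δ) := by
    have : ∀ σ : (toricCover F Δ).I₀, AlgebraicGeometry.IsReduced ((toricCover F Δ).X σ) :=
      fun σ => inferInstanceAs (AlgebraicGeometry.IsReduced (affineToric F σ.1))
    exact IsReduced.of_openCover _ (toricCover F Δ)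
  have : IrreducibleSpace (toricSurface F Δ) := by
    rw [irreducibleSpace_def]
    have hirr : IsIrreducible (Set.range (toricChart F Δ ⟨_, h0⟩)) := by
      rw [← Set.image_univ]
      exact (IrreducibleSpace.isIrreducible_univ _).image _
        (toricChart F Δ ⟨_, h0⟩).continuous.continuousOn
    have := hirr.closure
    rwa [show closure (Set.range (toricChart F Δ ⟨_, h0⟩)) = Set.univ from
      (dense_torus F Δ h0).closure_eq] at this
  exact isIntegral_of_irreducibleSpace_of_isReduced _

variable {F Δ} {Δ' : Fan} {f : toricSurface F Δ' ⟶ toricSurface F Δ}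

theorem preimage_torus (h0 : latticeCone ∅ ∈ Δ.cones) (h0' : latticeCone ∅ ∈ Δ'.cones)
    (hf : IsRefinementMorphism F f) : f ⁻¹ᵁ torus F Δ h0 = torus F Δ' h0' := by
  ext x
  constructor
  · intro hx
    obtain ⟨σ', y, rfl⟩ := toricSurface_exists F Δ' x
    obtain ⟨σ, hle⟩ := hf.1 σ'
    have hx' : toricChart F Δ σ (affineToricMap F hle y) ∈ torus F Δ h0 := by
      have e := hf.2 σ' σ hle
      have hx : f (toricChart F Δ' σ' y) ∈ torus F Δ h0 := hx
      have e' : f (toricChart F Δ' σ' y) = toricChart F Δ σ (affineToricMap F hle y) :=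
        congrArg (fun g => g.base y) e
      rwa [e'] at hx
    -- the torus is the locus of `σ` on which some monomial is invertible; the same monomial
    -- defines the torus in `σ'`
    obtain ⟨u, hu, huf⟩ := Δ.isFace_of_le (τ := ⟨_, h0⟩) (σ := σ) (latticeCone_empty_le σ.1)
    have hr := range_face F (latticeCone_empty_le σ.1) (Δ.rational σ.1 σ.2) ⟨u, hu⟩ huf
    have hr' := range_face F (latticeCone_empty_le σ'.1) (Δ'.rational σ'.1 σ'.2)
      ⟨u, dualMonoid_anti hle hu⟩ (fun z => by
        constructor
        · intro hz
          rw [mem_latticeCone_empty] at hz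
          subst hz
          exact ⟨zero_mem _, pairing_zero_right _⟩
        · rintro ⟨hz, e⟩
          exact (huf z).2 ⟨hle hz, e⟩)
    have h1 : affineToricMap F hle y ∈ Set.range (affineToricMap F (latticeCone_empty_le σ.1)) := by
      obtain ⟨z, hz⟩ := hx'
      refine ⟨z, (toricChart F Δ σ).isOpenEmbedding.injective ?_⟩
      rw [← hz, ← affineToricMap_toricChart F Δ (τ := ⟨_, h0⟩) (σ := σ) (latticeCone_empty_le σ.1)]
      rfl
    have h2 : y ∈ Set.range (affineToricMap F (latticeCone_empty_le σ'.1)) := by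
      rw [hr] at h1
      rw [hr']
      have e : character F (⟨u, dualMonoid_anti hle hu⟩ : dualMonoid σ'.1) =
        coneAlgebraMap F hle (character F ⟨u, hu⟩) := (coneAlgebraMap_character F hle ⟨u, hu⟩).symm
      rw [e]
      exact h1
    obtain ⟨z, hz⟩ := h2
    refine ⟨z, ?_⟩
    rw [← affineToricMap_toricChart F Δ' (τ := ⟨_, h0'⟩) (σ := σ') (latticeCone_empty_le σ'.1),
      ← hz]
    rfl
  · rintro ⟨y, rfl⟩
    refine ⟨affineToricMap F (le_refl (latticeCone ∅)) y, ?_⟩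
    have e := hf.2 ⟨_, h0'⟩ ⟨_, h0⟩ le_rfl
    exact (congrArg (fun g => g.base y) e).symm

theorem isIso_morphismRestrict_torus (h0 : latticeCone ∅ ∈ Δ.cones) (h0' : latticeCone ∅ ∈ Δ'.cones)
    (hf : IsRefinementMorphism F f) : IsIso (f ∣_ torus F Δ h0) := by
  have e := hf.2 ⟨_, h0'⟩ ⟨_, h0⟩ le_rfl
  rw [affineToricMap_refl, Category.id_comp] at e
  let c : affineToric F (latticeCone ∅) ≅ (torus F Δ h0 : Scheme.{u}) :=
    (toricChart F Δ ⟨_, h0⟩).isoOpensRange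
  have h1 := IsOpenImmersion.isPullback c.hom (toricChart F Δ' ⟨_, h0'⟩) (torus F Δ h0).ι f
    (e.trans (Scheme.Hom.isoOpensRange_hom_ι _).symm)
    (by rw [Scheme.Opens.opensRange_ι]; exact preimage_torus h0 h0' hf)
  have h2 := isPullback_morphismRestrict f (torus F Δ h0)
  rw [← h2.isoIsPullback_hom_fst _ _ h1]
  infer_instance

theorem IsRefinementMorphism.isDesingularization (h0 : latticeCone ∅ ∈ Δ.cones)
    (h0' : latticeCone ∅ ∈ Δ'.cones) (hf : IsRefinementMorphism F f)
    (hreg : ∀ x : toricSurface F Δ', IsRegularLocalRing ((toricSurface F Δ').presheaf.stalk x))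
    (hprop : IsProper (toricSurfaceToSpec F Δ')) : IsDesingularization f where
  regular := hreg
  proper := by
    have : IsProper (f ≫ toricSurfaceToSpec F Δ) := by rwa [hf.comp_toSpec]
    exact IsProper.of_comp f (toricSurfaceToSpec F Δ)
  birational := ⟨torus F Δ h0, dense_torus F Δ h0, by
    rw [preimage_torus h0 h0' hf]; exact dense_torus F Δ' h0',
    isIso_morphismRestrict_torus h0 h0' hf⟩

end Torus

/-! ### Gluing local factorizations through a birational morphism -/

section Factorization

variable {X Y Z W : Scheme.{u}}

/-- Two lifts of a morphism whose image lies in the open set over which `f` is an isomorphism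
agree. -/
theorem hom_eq_of_isIso_morphismRestrict (f : Y ⟶ X) {U : X.Opens} [IsIso (f ∣_ U)]
    {a b : W ⟶ Y} (h : a ≫ f = b ≫ f) (hU : Set.range (a ≫ f) ⊆ U) : a = b := by
  have hp := isPullback_morphismRestrict f U
  have ha : Set.range a ⊆ Set.range (f ⁻¹ᵁ U).ι := by
    rintro _ ⟨w, rfl⟩
    rw [Scheme.Opens.range_ι]
    exact hU ⟨w, rfl⟩
  have hb : Set.range b ⊆ Set.range (f ⁻¹ᵁ U).ι := by
    rintro _ ⟨w, rfl⟩
    rw [Scheme.Opens.range_ι]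
    rw [h] at hU
    exact hU ⟨w, rfl⟩
  rw [← IsOpenImmersion.lift_fac (f ⁻¹ᵁ U).ι a ha, ← IsOpenImmersion.lift_fac (f ⁻¹ᵁ U).ι b hb]
  congr 1
  rw [← cancel_mono (f ∣_ U), ← cancel_mono U.ι, Category.assoc, Category.assoc, hp.w,
    IsOpenImmersion.lift_fac_assoc, IsOpenImmersion.lift_fac_assoc, h]

/-- Morphisms to `Y` over `X` from an open part of a reduced scheme `Z` are unique if `Y → X` is
separated, and an isomorphism over an open set whose preimage in `Z` is dense. -/
theorem hom_eq_of_dense (f : Y ⟶ X) [IsSeparated f] (g : Z ⟶ X) [AlgebraicGeometry.IsReduced Z]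
    {U : X.Opens} [IsIso (f ∣_ U)] (hU : Dense ((g ⁻¹ᵁ U : Z.Opens) : Set Z))
    (j : W ⟶ Z) [IsOpenImmersion j] {a b : W ⟶ Y} (ha : a ≫ f = j ≫ g) (hb : b ≫ f = j ≫ g) :
    a = b := by
  have : AlgebraicGeometry.IsReduced W := isReduced_of_isOpenImmersion j
  let V : W.Opens := j ⁻¹ᵁ g ⁻¹ᵁ U
  have hV : Dense (V : Set W) := hU.preimage j.isOpenEmbedding.isOpenMap
  have : IsDominant V.ι := ⟨by rw [DenseRange, Scheme.Opens.range_ι]; exact hV⟩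
  refine ext_of_isDominant_of_isSeparated f (ha.trans hb.symm) V.ι ?_
  refine hom_eq_of_isIso_morphismRestrict f (U := U) (by simp only [Category.assoc, ha, hb]) ?_
  rw [Category.assoc, ha]
  rintro _ ⟨w, rfl⟩
  exact w.2

/-- A factorization through `f` at all local rings of `Z` spreads out and glues. -/
theorem existsUnique_factorization (f : Y ⟶ X) [IsSeparated f] [LocallyOfFiniteType f] (g : Z ⟶ X)
    [IsIntegral Z] {U : X.Opens} [IsIso (f ∣_ U)] (hU : Dense ((g ⁻¹ᵁ U : Z.Opens) : Set Z))
    (hloc : ∀ z : Z, ∃ h : Spec (Z.presheaf.stalk z) ⟶ Y, h ≫ f = Z.fromSpecStalk z ≫ g) :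
    ∃! h : Z ⟶ Y, h ≫ f = g := by
  have hex : ∀ z : Z, ∃ (V : Z.Opens) (_ : z ∈ V) (h : V.toScheme ⟶ Y), h ≫ f = V.ι ≫ g := by
    intro z
    obtain ⟨φ, hφ⟩ := hloc z
    obtain ⟨V, hz, h, -, hh⟩ := spread_out_of_isGermInjective' g f φ hφ
    exact ⟨V, hz, h, hh⟩
  choose V hz h hh using hex
  let 𝒰 : Z.OpenCover :=
    { I₀ := Z
      X := fun z => V z
      f := fun z => (V z).ι
      mem₀ := by
        rw [Scheme.presieve₀_mem_precoverage_iff]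
        exact ⟨fun z => ⟨z, by simpa using hz z⟩, inferInstance⟩ }
  have hglue : ∀ x y, pullback.fst (𝒰.f x) (𝒰.f y) ≫ h x = pullback.snd (𝒰.f x) (𝒰.f y) ≫ h y := by
    intro x y
    refine hom_eq_of_dense f g hU (pullback.fst (𝒰.f x) (𝒰.f y) ≫ 𝒰.f x) ?_ ?_
    · rw [Category.assoc, hh, Category.assoc]
    · rw [pullback.condition, Category.assoc, hh, Category.assoc]
  refine ⟨𝒰.glueMorphisms h hglue, ?_, fun h' hh' => ?_⟩
  · refine 𝒰.hom_ext _ _ fun z => ?_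
    rw [← Category.assoc, Scheme.Cover.ι_glueMorphisms]
    exact hh z
  · have e : 𝒰.glueMorphisms h hglue ≫ f = g := by
      refine 𝒰.hom_ext _ _ fun z => ?_
      rw [← Category.assoc, Scheme.Cover.ι_glueMorphisms]
      exact hh z
    exact hom_eq_of_dense f g hU (𝟙 Z) (by rw [hh', Category.id_comp])
      (by rw [e, Category.id_comp])

/-- The source of a desingularization of an integral scheme is integral: regular local rings are
domains, and a dense open part is irreducible. -/
theorem isIntegral_of_isDesingularization [IsIntegral X] {g : Z ⟶ X} (hg : IsDesingularization g) :
    IsIntegral Z := by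
  have : ∀ z : Z, _root_.IsReduced (Z.presheaf.stalk z) := fun z => by
    have := hg.regular z
    have := isDomain_of_isRegularLocalRing (Z.presheaf.stalk z)
    infer_instance
  have : AlgebraicGeometry.IsReduced Z := isReduced_of_isReduced_stalk Z
  obtain ⟨U, hU, hgU, hiso⟩ := hg.birational
  have : IrreducibleSpace Z := by
    have hne : (U : Set X).Nonempty := hU.nonempty
    have : Nonempty U := hne.to_subtype
    have : IsIntegral (U : Scheme.{u}) := inferInstance
    let e := asIso (g ∣_ U)
    have hr : Set.range (e.inv ≫ (g ⁻¹ᵁ U).ι) = ((g ⁻¹ᵁ U : Z.Opens) : Set Z) := by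
      rw [← Scheme.Opens.range_ι, Scheme.Hom.comp_base, TopCat.coe_comp]
      exact Function.Surjective.range_comp e.inv.surjective _
    rw [irreducibleSpace_def]
    have hirr : IsIrreducible (Set.range (e.inv ≫ (g ⁻¹ᵁ U).ι)) := by
      rw [← Set.image_univ]
      exact (IrreducibleSpace.isIrreducible_univ _).image _
        (e.inv ≫ (g ⁻¹ᵁ U).ι).continuous.continuousOn
    have := hirr.closure
    rwa [hr, hgU.closure_eq] at this
  exact isIntegral_of_irreducibleSpace_of_isReduced _

/-- The preimage of a dense open set under a birational morphism to an integral scheme. -/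
theorem dense_preimage_of_isDesingularization [IsIntegral X] {g : Z ⟶ X}
    (hg : IsDesingularization g) {V : X.Opens} (hV : (V : Set X).Nonempty) :
    Dense ((g ⁻¹ᵁ V : Z.Opens) : Set Z) := by
  have := isIntegral_of_isDesingularization hg
  obtain ⟨U, hU, hgU, hiso⟩ := hg.birational
  obtain ⟨x, hxU, hxV⟩ := nonempty_preirreducible_inter U.2 V.2 hU.nonempty hV
  obtain ⟨z, hz⟩ := (g ∣_ U).surjective ⟨x, hxU⟩
  refine (g ⁻¹ᵁ V).2.dense ⟨(g ⁻¹ᵁ U).ι z, ?_⟩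
  have e : g ((g ⁻¹ᵁ U).ι z) = x := by
    rw [← Scheme.Hom.comp_apply, ← morphismRestrict_ι, Scheme.Hom.comp_apply, hz]
    rfl
  change g ((g ⁻¹ᵁ U).ι z) ∈ V
  rw [e]; exact hxV

/-- The stalk map of a birational morphism at the generic point is an isomorphism. -/
theorem isIso_stalkMap_genericPoint [IsIntegral X] {g : Z ⟶ X}
    (hg : IsDesingularization g) [IsIntegral Z] : IsIso (g.stalkMap (genericPoint Z)) := by
  obtain ⟨U, hU, hgU, hiso⟩ := hg.birational
  have hη : genericPoint Z ∈ g ⁻¹ᵁ U :=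
    (genericPoint_spec Z).mem_open_set_iff (g ⁻¹ᵁ U).2 |>.2 (by simpa using hgU.nonempty)
  have e := morphismRestrictStalkMap g U ⟨genericPoint Z, hη⟩
  have hst : ∀ w, IsIso ((g ∣_ U).stalkMap w) := fun w => inferInstance
  exact ((MorphismProperty.isomorphisms CommRingCat).arrow_mk_iso_iff e).1
    (hst ⟨genericPoint Z, hη⟩)

end Factorization

/-! ### Local rings at points of affine charts -/

section StalkLift

/-- The local ring of `Spec A` at `p` as a ring of fractions of `A`. -/
theorem exists_toStalk_fraction (A : Type u) [CommRing A] (p : PrimeSpectrum A) :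
    (∀ k, ∃ a s : A, IsUnit (StructureSheaf.toStalk A p s) ∧
      StructureSheaf.toStalk A p s * k = StructureSheaf.toStalk A p a) ∧
    ∀ a : A, StructureSheaf.toStalk A p a = 0 →
      ∃ s : A, IsUnit (StructureSheaf.toStalk A p s) ∧ s * a = 0 := by
  have hloc : IsLocalization.AtPrime ((Spec.structureSheaf A).presheaf.stalk p) p.asIdeal :=
    inferInstance
  refine ⟨fun k => ?_, fun a ha => ?_⟩
  · obtain ⟨⟨a, s⟩, h⟩ := IsLocalization.surj p.asIdeal.primeCompl
      (S := (Spec.structureSheaf A).presheaf.stalk p) k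
    exact ⟨a, s, IsLocalization.map_units ((Spec.structureSheaf A).presheaf.stalk p) s,
      (mul_comm _ _).trans h⟩
  · have ha' : algebraMap A ((Spec.structureSheaf A).presheaf.stalk p) a = 0 := ha
    rw [IsLocalization.map_eq_zero_iff p.asIdeal.primeCompl] at ha'
    obtain ⟨s, hs⟩ := ha'
    exact ⟨s, IsLocalization.map_units ((Spec.structureSheaf A).presheaf.stalk p) s, hs⟩

/-- If a point of `X` lies in the open affine `Spec A`, then its local ring is a localization
of `A`. -/
theorem exists_fraction_of_bijective {X : Scheme.{u}} {A K : Type u} [CommRing A] [IsDomain A]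
    [Field K] {c : Spec (.of A) ⟶ X} [IsOpenImmersion c] {x : X} (hx : x ∈ Set.range c)
    (ψ : X.presheaf.stalk x ⟶ .of K) [IsIso ψ] {θ : A →+* K}
    (h : Spec.map (CommRingCat.ofHom θ) ≫ c = Spec.map ψ ≫ X.fromSpecStalk x) :
    Function.Injective θ ∧ ∀ k : K, ∃ a s : A, θ s ≠ 0 ∧ θ s * k = θ a := by
  obtain ⟨p, rfl⟩ := hx
  have h1 : Spec.map (CommRingCat.ofHom θ) =
      Spec.map ψ ≫ Spec.map (inv (c.stalkMap p)) ≫ (Spec (.of A)).fromSpecStalk p := by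
    rw [← cancel_mono c, h, Category.assoc, Category.assoc]
    congr 1
    rw [← Scheme.SpecMap_stalkMap_fromSpecStalk, ← Category.assoc, ← Spec.map_comp,
      IsIso.hom_inv_id, Spec.map_id, Category.id_comp]
  rw [Spec.fromSpecStalk_eq, ← Spec.map_comp, ← Spec.map_comp] at h1
  have h2 := Spec.map_injective h1
  let e : (Spec (.of A)).presheaf.stalk p ⟶ .of K := inv (c.stalkMap p) ≫ ψ
  have he : ∀ a, θ a = e (StructureSheaf.toStalk A p a) := fun a =>
    congrArg (fun f => f.hom a) h2
  have hinj : Function.Injective e := (ConcreteCategory.bijective_of_isIso e).1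
  obtain ⟨hfrac, hzero⟩ := exists_toStalk_fraction A p
  have hunit : ∀ s : A, IsUnit (StructureSheaf.toStalk A p s) → θ s ≠ 0 := fun s hs => by
    rw [he]
    exact (hs.map e.hom).ne_zero
  refine ⟨(injective_iff_map_eq_zero θ).2 fun a ha => ?_, fun k => ?_⟩
  · rw [he] at ha
    obtain ⟨s, hs, hsa⟩ := hzero a (hinj (ha.trans (map_zero e.hom).symm))
    refine (mul_eq_zero.1 hsa).resolve_left ?_
    rintro rfl
    exact hunit 0 hs (map_zero θ)
  · obtain ⟨k', rfl⟩ := (ConcreteCategory.bijective_of_isIso e).2 k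
    obtain ⟨a, s, hs, h⟩ := hfrac k'
    refine ⟨a, s, hunit s hs, ?_⟩
    rw [he, he]
    exact (map_mul e.hom _ _).symm.trans (congrArg e.hom h)

end StalkLift

/-! ### The function field of the torus -/

section TorusCoordinates

open Polynomial

variable {F : Type u} [Field F]

/-- Two lattice points as the two variables of polynomial functions on the torus: `a` for the outer
and `b` for the inner variable. -/
def torusPolynomial (F : Type u) [Field F] (a b : Lattice) :
    F[X][X] →+* coneAlgebra F (latticeCone ∅) :=
  eval₂RingHom (eval₂RingHom (algebraMap F _) (character F ⟨b, mem_dualMonoid_origin b⟩))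
    (character F ⟨a, mem_dualMonoid_origin a⟩)

theorem torusPolynomial_monomial (a b : Lattice) (i j : ℕ) (c : F) :
    torusPolynomial F a b (monomial j (monomial i c)) =
      AddMonoidAlgebra.single ⟨j • a + i • b, mem_dualMonoid_origin _⟩ c := by
  rw [torusPolynomial, coe_eval₂RingHom, eval₂_monomial, coe_eval₂RingHom, eval₂_monomial,
    ← character_nsmul, ← character_nsmul, AddMonoidAlgebra.coe_algebraMap]
  simp only [character, Function.comp_apply, Algebra.algebraMap_self, RingHom.id_apply,
    AddMonoidAlgebra.single_mul_single, mul_one, zero_add]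
  congr 1
  exact Subtype.ext (add_comm _ _)

theorem nsmul_add_nsmul_injective {a b : Lattice} (h : det a b = 1) {i j i' j' : ℕ}
    (e : j • a + i • b = j' • a + i' • b) : j = j' ∧ i = i' := by
  have e0 := congrFun e 0
  have e1 := congrFun e 1
  simp only [Pi.add_apply, Pi.smul_apply] at e0 e1
  simp only [nsmul_eq_mul] at e0 e1
  simp only [det] at h
  constructor
  · have : (j : ℤ) = j' := by
      linear_combination (b 1) * e0 - (b 0) * e1 + (j' - j) * h
    exact_mod_cast this
  · have : (i : ℤ) = i' := by
      linear_combination (a 0) * e1 - (a 1) * e0 + (i' - i) * h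
    exact_mod_cast this

/-- The characters of a basis of `M` are algebraically independent. -/
theorem torusPolynomial_injective {a b : Lattice} (h : det a b = 1) :
    Function.Injective (torusPolynomial F a b) := by
  classical
  have key : ∀ (i j : ℕ) (P : F[X][X]),
      (torusPolynomial F a b P).coeff ⟨j • a + i • b, mem_dualMonoid_origin _⟩ =
        (P.coeff j).coeff i := by
    intro i j P
    induction P using Polynomial.induction_on' with
    | add P Q hP hQ =>
      rw [map_add, AddMonoidAlgebra.coeff_add, Finsupp.add_apply, hP, hQ, coeff_add, coeff_add]
    | monomial j' p =>
      induction p using Polynomial.induction_on' with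
      | add p q hp hq =>
        rw [map_add, map_add, AddMonoidAlgebra.coeff_add, Finsupp.add_apply, hp, hq, coeff_add,
          coeff_add]
      | monomial i' c =>
        rw [torusPolynomial_monomial, AddMonoidAlgebra.coeff_single, Finsupp.single_apply,
          coeff_monomial]
        by_cases hj : j' = j
        · rw [if_pos hj, coeff_monomial]
          by_cases hi : i' = i
          · rw [if_pos hi, if_pos (by simp [hj, hi])]
          · rw [if_neg hi, if_neg fun e => hi
              (nsmul_add_nsmul_injective h (congrArg Subtype.val e)).2]
        · rw [if_neg hj, coeff_zero, if_neg fun e => hj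
            (nsmul_add_nsmul_injective h (congrArg Subtype.val e)).1]
  rw [injective_iff_map_eq_zero]
  intro P hP
  ext j i
  rw [← key, hP]
  simp

/-- For an injective homomorphism `B → K` from a domain, the fractions of elements of `B`
constitute a subfield of `K`. -/
theorem exists_subfield_fractions {B K : Type*} [CommRing B] [IsDomain B] [Field K] {γ : B →+* K}
    (hγ : Function.Injective γ) :
    ∃ L : Subfield K, (∀ P, γ P ∈ L) ∧ ∀ k ∈ L, ∃ P Q, P ≠ 0 ∧ γ P * k = γ Q := by
  refine ⟨(IsFractionRing.lift (K := FractionRing B) hγ).fieldRange,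
    fun P => ⟨algebraMap B _ P, IsFractionRing.lift_algebraMap hγ P⟩, ?_⟩
  rintro _ ⟨q, rfl⟩
  obtain ⟨Q, P, hP, rfl⟩ := IsFractionRing.div_surjective (A := B) q
  have hP0 : P ≠ 0 := nonZeroDivisors.ne_zero hP
  refine ⟨P, Q, hP0, ?_⟩
  rw [map_div₀, IsFractionRing.lift_algebraMap, IsFractionRing.lift_algebraMap]
  exact mul_div_cancel₀ _ ((map_ne_zero_iff γ hγ).2 hP0)

variable {K : Type*} [Field K]

theorem torusChar_add (φ : coneAlgebra F (latticeCone ∅) →+* K) (u v : Lattice) :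
    torusChar φ (u + v) = torusChar φ u * torusChar φ v := by
  rw [torusChar, torusChar, torusChar, ← map_mul, ← character_add]
  rfl

theorem torusChar_zero (φ : coneAlgebra F (latticeCone ∅) →+* K) : torusChar φ 0 = 1 := by
  rw [torusChar, ← map_one φ, ← character_zero]
  rfl

theorem torusChar_neg (φ : coneAlgebra F (latticeCone ∅) →+* K) (u : Lattice) :
    torusChar φ (-u) = (torusChar φ u)⁻¹ :=
  eq_inv_of_mul_eq_one_right (torusChar_mul_neg φ u)

theorem torusChar_nsmul (φ : coneAlgebra F (latticeCone ∅) →+* K) (n : ℕ) (u : Lattice) :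
    torusChar φ (n • u) = torusChar φ u ^ n := by
  induction n with
  | zero => rw [zero_smul, torusChar_zero, pow_zero]
  | succ n ih => rw [succ_nsmul, torusChar_add, ih, pow_succ]

theorem eq_zsmul_add_zsmul {a b : Lattice} (h : det a b = 1) (u : Lattice) :
    u = det u b • a + det a u • b := by
  simp only [det] at h ⊢
  funext i
  fin_cases i <;> simp only [Pi.add_apply, Pi.smul_apply, smul_eq_mul, Fin.zero_eta, Fin.mk_one]
  · linear_combination (-u 0) * h
  · linear_combination (-u 1) * h

/-- The function field of the torus consists of the fractions of polynomials in the characters of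
a basis of `M`. -/
theorem exists_torusPolynomial_fraction {a b : Lattice} (h : det a b = 1)
    {φ : coneAlgebra F (latticeCone ∅) →+* K} (hφ : Function.Injective φ)
    (hfrac : ∀ k : K, ∃ x y, φ y ≠ 0 ∧ φ y * k = φ x) (k : K) :
    ∃ P Q, P ≠ 0 ∧ φ (torusPolynomial F a b P) * k = φ (torusPolynomial F a b Q) := by
  obtain ⟨L, hL, hLfrac⟩ := exists_subfield_fractions (γ := φ.comp (torusPolynomial F a b))
    (hφ.comp (torusPolynomial_injective h))
  refine hLfrac k ?_
  have hmono : ∀ (i j : ℕ) (c : F),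
      φ (AddMonoidAlgebra.single ⟨j • a + i • b, mem_dualMonoid_origin _⟩ c) ∈ L := fun i j c => by
    rw [← torusPolynomial_monomial]
    exact hL _
  let G : AddSubgroup Lattice :=
    { carrier := {u | torusChar φ u ∈ L}
      zero_mem' := by
        change torusChar φ 0 ∈ L
        rw [torusChar_zero]; exact L.one_mem
      add_mem' := fun {u v} hu hv => by
        change torusChar φ (u + v) ∈ L
        rw [torusChar_add]; exact L.mul_mem hu hv
      neg_mem' := fun {u} hu => by
        change torusChar φ (-u) ∈ L
        rw [torusChar_neg]; exact L.inv_mem hu }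
  have ha : torusChar φ a ∈ L := by simpa [torusChar, character] using hmono 0 1 1
  have hb : torusChar φ b ∈ L := by simpa [torusChar, character] using hmono 1 0 1
  have haG : a ∈ G := ha
  have hbG : b ∈ G := hb
  have hG : ∀ u, torusChar φ u ∈ L := fun u => by
    have : u ∈ G := by
      rw [eq_zsmul_add_zsmul h u]
      exact add_mem (zsmul_mem haG _) (zsmul_mem hbG _)
    exact this
  have hall : ∀ z, φ z ∈ L := fun z => by
    induction z using AddMonoidAlgebra.induction_linear with
    | zero => rw [map_zero]; exact L.zero_mem
    | add f g hf hg => rw [map_add]; exact L.add_mem hf hg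
    | single w c =>
      have e : (AddMonoidAlgebra.single w c : coneAlgebra F (latticeCone ∅)) =
          AddMonoidAlgebra.single ⟨0 • a + 0 • b, mem_dualMonoid_origin _⟩ c * character F w := by
        rw [character, AddMonoidAlgebra.single_mul_single, mul_one]
        congr 1
        exact Subtype.ext (by simp)
      rw [e, map_mul]
      exact L.mul_mem (hmono 0 0 c) (hG w)
  obtain ⟨x, y, hy, e⟩ := hfrac k
  rw [eq_div_of_mul_eq hy ((mul_comm _ _).trans e)]
  exact L.div_mem (hall x) (hall y)

/-- A field generated by the coordinate ring of the two-dimensional torus has transcendence degree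
at most two. -/
theorem trdeg_le_two {K : Type u} [Field K] [Algebra F K]
    {φ : coneAlgebra F (latticeCone ∅) →+* K} (hφ : Function.Injective φ)
    (hF : φ.comp (algebraMap F _) = algebraMap F K)
    (hfrac : ∀ k : K, ∃ x y, φ y ≠ 0 ∧ φ y * k = φ x) : Algebra.trdeg F K ≤ 2 := by
  let a : Lattice := ![1, 0]
  let b : Lattice := ![0, 1]
  have hab : det a b = 1 := by simp [det, a, b]
  let s : Set K := {torusChar φ a, torusChar φ b}
  have hmem : ∀ P, φ (torusPolynomial F a b P) ∈ Algebra.adjoin F s := by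
    intro P
    induction P using Polynomial.induction_on' with
    | add P Q hP hQ => rw [map_add, map_add]; exact add_mem hP hQ
    | monomial j p =>
      induction p using Polynomial.induction_on' with
      | add p q hp hq => rw [map_add, map_add, map_add]; exact add_mem hp hq
      | monomial i c =>
        have e : φ (torusPolynomial F a b (monomial j (monomial i c))) =
            algebraMap F K c * torusChar φ b ^ i * torusChar φ a ^ j := by
          rw [torusPolynomial, coe_eval₂RingHom, eval₂_monomial, coe_eval₂RingHom, eval₂_monomial,
            map_mul, map_mul, map_pow, map_pow, ← hF]
          rfl
        rw [e]
        exact mul_mem (mul_mem (Subalgebra.algebraMap_mem _ c)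
          (pow_mem (Algebra.subset_adjoin (by simp [s])) i))
          (pow_mem (Algebra.subset_adjoin (by simp [s])) j)
  have halg : Algebra.IsAlgebraic (Algebra.adjoin F s) K := by
    refine ⟨fun k => ?_⟩
    obtain ⟨P, Q, hP, e⟩ := exists_torusPolynomial_fraction hab hφ hfrac k
    let p : Algebra.adjoin F s := ⟨_, hmem P⟩
    let q : Algebra.adjoin F s := ⟨_, hmem Q⟩
    have hp : p ≠ 0 := fun h => hP (hφ.comp (torusPolynomial_injective hab)
      ((congrArg Subtype.val h).trans (by simp)))
    refine ⟨C p * X - C q, fun h => hp ?_, ?_⟩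
    · have := congrArg (fun f => coeff f 1) h
      simpa using this
    · rw [map_sub, map_mul, aeval_C, aeval_C, aeval_X]
      exact sub_eq_zero.2 e
  refine (Algebra.IsAlgebraic.trdeg_le_cardinalMk F s).trans ?_
  refine (Cardinal.mk_insert_le).trans ?_
  rw [Cardinal.mk_singleton]
  norm_num

end TorusCoordinates

/-! ### Regular local rings over the weighted projective plane -/

section LocalFactorization

open Polynomial IsLocalRing

variable {F : Type u} [Field F]

theorem character_ne_zero {σ : PointedCone ℝ Plane} (v : dualMonoid σ) : character F v ≠ 0 :=
  fun h => one_ne_zero (AddMonoidAlgebra.single_eq_zero.1 h)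

/-- An embedding of the coordinate ring of a two-dimensional cone into a field extends to the
coordinate ring of the torus. -/
theorem exists_extend_to_torus {a b : Lattice} (h : det a b ≠ 0)
    (hle : latticeCone ∅ ≤ latticeCone {a, b}) {K : Type*} [Field K]
    (θ : coneAlgebra F (latticeCone {a, b}) →+* K) (hθ : Function.Injective θ) :
    ∃ φ : coneAlgebra F (latticeCone ∅) →+* K,
      φ.comp (coneAlgebraMap F hle).toRingHom = θ ∧ Function.Injective φ := by
  obtain ⟨u, hu, hface⟩ := isFace_origin_pair h
  have hσ : ∃ S : Set Lattice, S.Finite ∧ latticeCone {a, b} = latticeCone S :=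
    ⟨{a, b}, by simp, rfl⟩
  have hne : θ (character F ⟨u, hu⟩) ≠ 0 := (map_ne_zero_iff θ hθ).2 (character_ne_zero _)
  obtain ⟨φ, hφ⟩ := exists_extend_to_face F hle hσ ⟨u, hu⟩ hface θ hne.isUnit
  refine ⟨φ, hφ, (injective_iff_map_eq_zero φ).2 fun z hz => ?_⟩
  let _ := (coneAlgebraMap F hle).toRingHom.toAlgebra
  have := isLocalization_face F hle hσ ⟨u, hu⟩ hface
  obtain ⟨n, x, e⟩ := IsLocalization.Away.surj (character F ⟨u, hu⟩) z
  have hmap : ∀ w, φ (algebraMap (coneAlgebra F (latticeCone {a, b})) _ w) = θ w := fun w =>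
    congrArg (fun f => f w) hφ
  have hx : x = 0 := hθ (by rw [← hmap, ← e, map_mul, hz, zero_mul, map_zero])
  rw [hx, map_zero] at e
  refine (mul_eq_zero.1 e).resolve_right (pow_ne_zero _ fun h0 => hne ?_)
  rw [← hmap, h0, map_zero]

variable {O K : Type u} [CommRing O] [Field K] [Algebra O K]

/-- Evaluation at `x^a = t` and `x^b` factors through the polynomials over the local ring `O`. -/
theorem aeval_bivariateMap_eq [Algebra F O] {φ : coneAlgebra F (latticeCone ∅) →+* K}
    (hF : ∀ c : F, algebraMap O K (algebraMap F O c) = φ (algebraMap F _ c)) {t : O}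
    {a b : Lattice} (ht : algebraMap O K t = torusChar φ a) (P : F[X][X]) :
    aeval (torusChar φ b) (bivariateMap F t P) = φ (torusPolynomial F a b P) := by
  have h : ((aeval (R := O) (torusChar φ b)).toRingHom).comp (bivariateMap F t) =
      φ.comp (torusPolynomial F a b) := by
    ext c
    · simpa [bivariateMap, torusPolynomial] using hF c
    · simp [bivariateMap, torusPolynomial, torusChar]
    · simpa [bivariateMap, torusPolynomial, torusChar] using ht
  exact congrArg (fun f => f P) h

/-- A positive multiple of a form `s` in the interior of `σ^∨` dominates any other form on `σ`. -/
theorem exists_nsmul_add_mem_dualMonoid {a b s : Lattice} (ha : 0 < intPairing s a)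
    (hb : 0 < intPairing s b) (u : Lattice) :
    ∃ N : ℕ, ∀ n ≥ N, n • s + u ∈ dualMonoid (latticeCone {a, b}) := by
  refine ⟨(|intPairing u a| + |intPairing u b|).toNat, fun n hn => ?_⟩
  have hn' : |intPairing u a| + |intPairing u b| ≤ n := Int.toNat_le.1 hn
  refine mem_dualMonoid_latticeCone.2 ?_
  have key : ∀ c : Lattice, 0 < intPairing s c → |intPairing u c| ≤ n →
      0 ≤ intPairing (n • s + u) c := fun c hc h => by
    have e : intPairing (n • s + u) c = n * intPairing s c + intPairing u c := by
      simp only [intPairing, Pi.add_apply, Pi.smul_apply]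
      simp only [nsmul_eq_mul]
      ring
    have h1 : (n : ℤ) ≤ n * intPairing s c := le_mul_of_one_le_right (by positivity) hc
    have h2 := neg_abs_le (intPairing u c)
    rw [e]
    linarith
  rintro c (rfl | rfl)
  · exact key c ha (by linarith [abs_nonneg (intPairing u b)])
  · exact key c hb (by linarith [abs_nonneg (intPairing u a)])

variable [IsDomain O] [IsFractionRing O K]

/-- On a factorial local ring birational to the chart of `⟨a, b⟩`, one of `x^u`, `x^{-u}` is
regular, if `u` is a normal to a lattice point `r` with `⟨s, r⟩ = 1` for some form `s` that is
positive on `a` and `b`. -/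
theorem torusChar_normal_mem_range_or [UniqueFactorizationMonoid O] [IsLocalRing O] [Algebra F O]
    {φ : coneAlgebra F (latticeCone ∅) →+* K} (hφ : Function.Injective φ)
    (hF : ∀ c : F, algebraMap O K (algebraMap F O c) = φ (algebraMap F _ c))
    (hfrac : ∀ k : K, ∃ x y, φ y ≠ 0 ∧ φ y * k = φ x) {a b : Lattice}
    (hX : ∀ u ∈ dualMonoid (latticeCone {a, b}), torusChar φ u ∈ (algebraMap O K).range)
    {s r : Lattice} (ha : 0 < intPairing s a) (hb : 0 < intPairing s b)
    (hsr : intPairing s r = 1) :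
    torusChar φ (normal r) ∈ (algebraMap O K).range ∨
      torusChar φ (-normal r) ∈ (algebraMap O K).range := by
  have hdet : det s (normal r) = 1 := by
    rw [← hsr]; simp [det, normal, intPairing]
  obtain ⟨t, ht⟩ := hX s (mem_dualMonoid_latticeCone.2 (by
    rintro c (rfl | rfl)
    exacts [ha.le, hb.le]))
  obtain ⟨N, hN⟩ := exists_nsmul_add_mem_dualMonoid ha hb (normal r)
  obtain ⟨N', hN'⟩ := exists_nsmul_add_mem_dualMonoid ha hb (-normal r)
  obtain ⟨c, hc⟩ := hX _ (hN (max N N') (le_max_left _ _))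
  obtain ⟨c', hc'⟩ := hX _ (hN' (max N N') (le_max_right _ _))
  rw [torusChar_add, torusChar_nsmul, ← ht] at hc hc'
  -- `x^{Ns ± u}` is regular. If `t = x^s` is a unit, divide by its power; otherwise use
  -- factoriality.
  by_cases hu : IsUnit t
  · obtain ⟨v, hv⟩ := (hu.pow (max N N')).exists_left_inv
    refine Or.inl ⟨v * c, ?_⟩
    rw [map_mul, hc, ← map_pow, ← mul_assoc, ← map_mul, hv, map_one, one_mul]
  · rw [torusChar_neg] at hc' ⊢
    refine mem_or_inv_mem_of_factorial (F := F) (t := t) (fun P Q e => ?_) (fun f => ?_) hu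
      ⟨c, hc⟩ ⟨c', hc'⟩
    · simp only [aeval_bivariateMap_eq hF ht] at e
      exact torusPolynomial_injective hdet (hφ e)
    · obtain ⟨P, Q, hP, e⟩ := exists_torusPolynomial_fraction hdet hφ hfrac (algebraMap O K f)
      refine ⟨P, Q, hP, ?_⟩
      rwa [aeval_bivariateMap_eq hF ht, aeval_bivariateMap_eq hF ht]

/-- A homomorphism from the coordinate ring of a chart of `P(1,m,n)` to a regular local ring with
the same field of fractions extends to the coordinate ring of a chart of the refined fan. The ring
has dimension at most two, hence is factorial. -/
theorem exists_factorization_coneAlgebra [IsRegularLocalRing O] {m k : ℕ} (hm : 2 ≤ m) (hk : 1 ≤ k)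
    (l : Fin 3) (θ : coneAlgebra F (weightedCone m (m * k + m - 1) l) →+* O)
    (hinj : Function.Injective ((algebraMap O K).comp θ))
    (hfrac : ∀ z : K, ∃ x y, algebraMap O K (θ y) ≠ 0 ∧
      algebraMap O K (θ y) * z = algebraMap O K (θ x)) :
    ∃ i ≤ m + 3, ∃ (hle : cycleCone m k i ≤ weightedCone m (m * k + m - 1) l)
      (ψ : coneAlgebra F (cycleCone m k i) →+* O),
      ψ.comp (coneAlgebraMap F hle).toRingHom = θ := by
  have hle0 : latticeCone ∅ ≤ weightedCone m (m * k + m - 1) l := latticeCone_mono (by simp)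
  have hn : 0 < m * k + m - 1 := by
    have := Nat.zero_le (m * k)
    omega
  obtain ⟨φ, hφ, hφinj⟩ := exists_extend_to_torus
    (det_weightedRay_pos (m := m) (n := m * k + m - 1) (by omega) hn l).ne' hle0 _ hinj
  have hφθ : ∀ w, φ (coneAlgebraMap F hle0 w) = algebraMap O K (θ w) := fun w =>
    congrArg (fun f => f w) hφ
  have hfrac' : ∀ z : K, ∃ x y, φ y ≠ 0 ∧ φ y * z = φ x := fun z => by
    obtain ⟨x, y, hy, e⟩ := hfrac z
    refine ⟨coneAlgebraMap F hle0 x, coneAlgebraMap F hle0 y, ?_, ?_⟩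
    · rwa [hφθ]
    · rwa [hφθ, hφθ]
  let _ : Algebra F O := (θ.comp (algebraMap F _)).toAlgebra
  let _ : Algebra F K := ((algebraMap O K).comp (algebraMap F O)).toAlgebra
  have _ : IsScalarTower F O K := IsScalarTower.of_algebraMap_eq fun _ => rfl
  have hF : ∀ c : F, algebraMap O K (algebraMap F O c) = φ (algebraMap F _ c) := fun c => by
    rw [← (coneAlgebraMap F hle0).commutes c, hφθ]
    rfl
  have hdim : ringKrullDim O ≤ 2 := ringKrullDim_le_of_trdeg_le F 2 (by
    refine (trdeg_le_of_injective (IsScalarTower.toAlgHom F O K)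
      (IsFractionRing.injective O K)).trans ?_
    exact_mod_cast trdeg_le_two hφinj (RingHom.ext fun c => (hF c).symm) hfrac')
  have := uniqueFactorizationMonoid_of_isRegularLocalRing O hdim
  have hX : ∀ u ∈ dualMonoid (weightedCone m (m * k + m - 1) l),
      torusChar φ u ∈ (algebraMap O K).range := fun u hu => by
    refine ⟨θ (character F ⟨u, hu⟩), ?_⟩
    rw [← hφθ, coneAlgebraMap_character]
    rfl
  obtain ⟨i, hi, hle, hα, hβ⟩ := exists_cycleCone_of_weightedCone hm hk l
    (fun u => torusChar φ u ∈ (algebraMap O K).range) hX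
    (fun s r ha hb hsr => torusChar_normal_mem_range_or hφinj hF hfrac' hX ha hb hsr)
  refine ⟨i, hi, hle, ?_⟩
  have hle1 : latticeCone ∅ ≤ cycleCone m k i := latticeCone_mono (by simp)
  have hdet : 0 ≤ det (rayCycle m k i) (rayCycle m k (i + 1)) := by
    rw [det_rayCycle_succ hi]; exact zero_le_one
  have hmem : ∀ z, φ.comp (coneAlgebraMap F hle1).toRingHom z ∈ (algebraMap O K).range := by
    refine map_mem_of_generators F (det_rayCycle_succ hi) _ _ (fun c => ?_) ?_ ?_
    · refine ⟨algebraMap F O c, ?_⟩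
      rw [hF, ← (coneAlgebraMap F hle1).commutes c]
      rfl
    · obtain ⟨x, hx⟩ := hα
      exact ⟨x, hx.trans (congrArg φ
        (coneAlgebraMap_character F hle1 ⟨_, normal_mem_dualMonoid hdet⟩)).symm⟩
    · obtain ⟨x, hx⟩ := hβ
      exact ⟨x, hx.trans (congrArg φ
        (coneAlgebraMap_character F hle1 ⟨_, neg_normal_mem_dualMonoid hdet⟩)).symm⟩
  obtain ⟨ψ, hψ⟩ := exists_comp_eq_of_forall_mem_range (IsFractionRing.injective O K) _ hmem
  refine ⟨ψ, RingHom.ext fun w => IsFractionRing.injective O K ?_⟩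
  rw [← hφθ, ← coneAlgebraMap_comp F hle1 hle]
  exact congrArg (fun f => f (coneAlgebraMap F hle w)) hψ

end LocalFactorization

/-! ### Minimality of the refinement -/

section Minimality

variable {F : Type u} [Field F]

theorem exists_mem_range_toricChart_weightedCone {m n : ℕ} (hm : 0 < m) (hn : 0 < n)
    (x : weightedProjectivePlane F m n) : ∃ l : Fin 3,
      x ∈ Set.range (toricChart F (weightedProjectivePlaneFan m n)
        ⟨weightedCone m n l, weightedCone_mem hm hn l⟩) := by
  obtain ⟨σ, y, rfl⟩ := toricSurface_exists F _ x
  obtain ⟨l, hl⟩ := exists_le_weightedCone σ.2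
  refine ⟨l, affineToricMap F hl y, ?_⟩
  exact congrArg (fun f => f.base y) (affineToricMap_toricChart F _ (τ := σ)
    (σ := ⟨weightedCone m n l, weightedCone_mem hm hn l⟩) hl)

/-- The local scheme at `z` maps into every open affine containing the image of `z`. -/
theorem exists_fromSpecStalk_comp_eq {X Z : Scheme.{u}} {A : Type u} [CommRing A]
    (c : Spec (.of A) ⟶ X) [IsOpenImmersion c] (g : Z ⟶ X) (z : Z) (hz : g z ∈ Set.range c) :
    ∃ θ : A →+* Z.presheaf.stalk z,
      Spec.map (CommRingCat.ofHom θ) ≫ c = Z.fromSpecStalk z ≫ g := by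
  have hr : Set.range (Z.fromSpecStalk z ≫ g) ⊆ Set.range c := by
    rintro _ ⟨w, rfl⟩
    have h : Z.fromSpecStalk z w ⤳ z := by
      have : Z.fromSpecStalk z w ∈ Set.range (Z.fromSpecStalk z) := ⟨w, rfl⟩
      rwa [Scheme.range_fromSpecStalk] at this
    exact (h.map g.continuous).mem_open c.isOpenEmbedding.isOpen_range hz
  obtain ⟨θ, hθ⟩ := Spec.map_surjective (IsOpenImmersion.lift c (Z.fromSpecStalk z ≫ g) hr)
  refine ⟨θ.hom, ?_⟩
  rw [CommRingCat.ofHom_hom, hθ, IsOpenImmersion.lift_fac]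

/-- Every desingularization of `P(1,m,n)` factors through the refinement at each local ring. -/
theorem exists_local_factorization {m k : ℕ} (hm : 2 ≤ m) (hk : 1 ≤ k)
    {f : toricSurface F (planarFan (desingularizationRays m k)) ⟶
      weightedProjectivePlane F m (m * k + m - 1)} (hf : IsRefinementMorphism F f)
    {Z : Scheme.{u}} {g : Z ⟶ weightedProjectivePlane F m (m * k + m - 1)}
    (hg : IsDesingularization g) (z : Z) :
    ∃ h : Spec (Z.presheaf.stalk z) ⟶ toricSurface F (planarFan (desingularizationRays m k)),
      h ≫ f = Z.fromSpecStalk z ≫ g := by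
  have hn : 0 < m * k + m - 1 := by
    have := Nat.zero_le (m * k)
    omega
  have hX : IsIntegral (weightedProjectivePlane F m (m * k + m - 1)) :=
    isIntegral_toricSurface F _ (Or.inl rfl)
  have hZ : IsIntegral Z := isIntegral_of_isDesingularization hg
  obtain ⟨l, hl⟩ := exists_mem_range_toricChart_weightedCone (F := F) (m := m) (by omega) hn (g z)
  let σ : (weightedProjectivePlaneFan m (m * k + m - 1)).Index :=
    ⟨_, weightedCone_mem (by omega) hn l⟩
  obtain ⟨θ, hθ⟩ := exists_fromSpecStalk_comp_eq (toricChart F _ σ) g z hl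
  have hsp : genericPoint Z ⤳ z := (genericPoint_spec Z).specializes trivial
  have hgη : g (genericPoint Z) ∈ Set.range (toricChart F _ σ) :=
    (hsp.map g.continuous).mem_open (toricChart F _ σ).isOpenEmbedding.isOpen_range hl
  have hiso := isIso_stalkMap_genericPoint hg
  have hη : Spec.map (CommRingCat.ofHom
        ((algebraMap (Z.presheaf.stalk z) Z.functionField).comp θ)) ≫ toricChart F _ σ =
      Spec.map (g.stalkMap (genericPoint Z)) ≫
        (weightedProjectivePlane F m (m * k + m - 1)).fromSpecStalk (g (genericPoint Z)) := by
    rw [Scheme.SpecMap_stalkMap_fromSpecStalk, CommRingCat.ofHom_comp, Spec.map_comp,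
      Category.assoc, hθ, ← Category.assoc]
    congr 1
    exact Scheme.SpecMap_stalkSpecializes_fromSpecStalk hsp
  obtain ⟨hinj, hfrac⟩ := exists_fraction_of_bijective (K := Z.functionField) hgη
    (g.stalkMap (genericPoint Z)) hη
  have := hg.regular z
  obtain ⟨i, hi, hle, ψ, hψ⟩ := exists_factorization_coneAlgebra (K := Z.functionField)
    hm hk l θ hinj hfrac
  refine ⟨Spec.map (CommRingCat.ofHom ψ) ≫ toricChart F _ ⟨_, cycleCone_mem hm hk hi⟩, ?_⟩
  rw [Category.assoc, hf.2 ⟨_, cycleCone_mem hm hk hi⟩ σ hle, ← hθ, ← hψ, CommRingCat.ofHom_comp,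
    Spec.map_comp, Category.assoc]
  rfl

/-- Local factorizations glue because a factorization is determined over the torus. -/
theorem isMinimalDesingularization_of_isRefinementMorphism {m k : ℕ} (hm : 2 ≤ m) (hk : 1 ≤ k)
    {f : toricSurface F (planarFan (desingularizationRays m k)) ⟶
      weightedProjectivePlane F m (m * k + m - 1)} (hf : IsRefinementMorphism F f) :
    IsMinimalDesingularization f := by
  have hd : IsDesingularization f := hf.isDesingularization (Or.inl rfl) (Or.inl rfl)
    (isRegularLocalRing_stalk_toricSurface F (exists_smooth_cone hm hk))
    (isProper_toricSurfaceToSpec F hm hk)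
  refine ⟨hd, fun Z g hg => ?_⟩
  have := hd.proper
  have : IsIntegral (weightedProjectivePlane F m (m * k + m - 1)) :=
    isIntegral_toricSurface F _ (Or.inl rfl)
  have := isIntegral_of_isDesingularization hg
  have h0 : latticeCone ∅ ∈ (weightedProjectivePlaneFan m (m * k + m - 1)).cones := Or.inl rfl
  have h0' : latticeCone ∅ ∈ (planarFan (desingularizationRays m k)).cones := Or.inl rfl
  have := isIso_morphismRestrict_torus h0 h0' hf
  exact existsUnique_factorization f g (U := torus F _ h0)
    (dense_preimage_of_isDesingularization hg (dense_torus F _ h0).nonempty)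
    (exists_local_factorization hm hk hf hg)

theorem desingularizationRays_refines {m k : ℕ} (hm : 2 ≤ m) (hk : 1 ≤ k)
    (σ' : (planarFan (desingularizationRays m k)).Index) :
    ∃ σ : (weightedProjectivePlaneFan m (m * k + m - 1)).Index, σ'.1 ≤ σ.1 := by
  have hn : 0 < m * k + m - 1 := by
    have := Nat.zero_le (m * k)
    omega
  obtain ⟨i, hi, hle⟩ := exists_le_cycleCone hm hk σ'.2
  obtain ⟨l, hl⟩ := exists_cycleCone_le_weightedCone hm hk hi
  exact ⟨⟨_, weightedCone_mem (by omega) hn l⟩, hle.trans hl⟩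

end Minimality

end Toric

end

theorem mainTheorem3 (F : Type u) [Field F] (m k : ℕ) (hm : 2 ≤ m) (hk : 1 ≤ k) :
    (Toric.planarFan (Toric.desingularizationRays m k)).IsComplete ∧
    (Toric.planarFan (Toric.desingularizationRays m k)).rays =
      {![1, 0], ![0, -1], ![-1, -((k : ℤ) + 1)]} ∪
        {v | ∃ j : ℕ, j ≤ m ∧ v = ![-(j : ℤ), -((j : ℤ) * k + j - 1)]} ∧
    IsProper (Toric.toricSurfaceToSpec F
      (Toric.planarFan (Toric.desingularizationRays m k))) ∧
    ∃ f : Toric.toricSurface F (Toric.planarFan (Toric.desingularizationRays m k)) ⟶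
        Toric.weightedProjectivePlane F m (m * k + m - 1),
      f ≫ Toric.toricSurfaceToSpec F (Toric.weightedProjectivePlaneFan m (m * k + m - 1)) =
        Toric.toricSurfaceToSpec F (Toric.planarFan (Toric.desingularizationRays m k)) ∧
      Toric.IsRefinementMorphism F f ∧
      Toric.IsMinimalDesingularization f := by
  have href := Toric.isRefinementMorphism_refinementMorphism F
    (Toric.desingularizationRays_refines hm hk)
  refine ⟨Toric.planarFan_desingularizationRays_isComplete hm hk, ?_,
    Toric.isProper_toricSurfaceToSpec F hm hk, _, href.comp_toSpec, href,
    Toric.isMinimalDesingularization_of_isRefinementMorphism hm hk href⟩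
  rw [Toric.planarFan_rays fun r hr => Toric.isCoprime_of_mem_desingularizationRays hr]
  ext v
  simp only [Toric.desingularizationRays, Toric.rayV, Finset.coe_union, Finset.coe_insert,
    Finset.coe_singleton, Finset.coe_image, Finset.coe_range, Set.mem_union, Set.mem_image,
    Set.mem_Iio, Set.mem_ofPred_eq, Nat.lt_succ_iff, eq_comm (a := v)]
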